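/- Let $m\ge 3$, let $J\in\mathbb R^{3\times3}$ be symmetric positive definite, $S\in\mathbb R^{m\times m}$ skew-symmetric and $C\in\mathbb R^{3\times m}$ with $(S,C)$ observable (i.e. $CS^nv=0$ for all $n\ge0$ only if $v=0$), $X_r\in SO(3)$, $\mathring y_1,\dots,\mathring y_\nu\in\mathbb R^3$, and $k_p,k_I,k_D>0$. For $v\in\mathbb R^3$ let $v_\times$ be the skew matrix with $v_\times u=v\times u$, and let $Q=2I_3$ be the matrix with $\operatorname{tr}(u_\times^\top v_\times)=u^\top Qv$. Put $y_i^r=X_r\mathring y_i$, and assume that two of the $\mathring y_i$ are linearly independent and that $Y=\frac{k_p}{2}\sum_i y_i^r y_i^{r\top}$ has three distinct eigenvalues. Consider on $SO(3)\times SO(3)\times\mathbb R^m\times\mathbb R^m\times\mathbb R^3$, with state $(R,R_d,\delta,w,\Omega)$, the closed loop formed by the rigid body $$\dot R=R\,\Omega_\times,\qquad J\dot\Omega=-\Omega\times J\Omega+\Gamma,$$ the exosystem $$\dot R_d=({}^\circ\Omega_d)_\times R_d,\qquad {}^\circ\Omega_d=Cw,\qquad \dot w=Sw,$$ and the controller which,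 with $e_i=y_i^r-R^\top R_d\mathring y_i$, $\Delta=C\delta$, $\alpha=\frac{k_p}{2}\sum_i e_i\times y_i^r$, $\Omega^c=R^\top\Delta+\frac{k_p}{2}\sum_i e_i\times y_i^r$ and $\tilde\Omega=\Omega-\Omega^c$, is given by $$\dot\delta=S\delta+C^\top Q\beta,\qquad \beta=\tfrac{k_I}{2}\sum_i\Big(\tfrac{k_p}{2}R\,(y_i^r-e_i)_\times\, y^r_{i\times}J^\top\tilde\Omega+R\,(e_i\times y_i^r)\Big),$$ $$\Gamma=\Omega\times J\Omega-J\,\Omega_\times R^\top\Delta+JR^\top\dot\Delta+\sum_i e_i\times y_i^r+J\,\tfrac{k_p}{2}\sum_i y^r_{i\times}(y_i^r-e_i)_\times(\tilde\Omega+\alpha)-k_D\tilde\Omega ,$$ where $\dot\Delta=C\dot\delta$. Let $$\mathcal S_1=\{(R,R_d,\delta,w,\Omega):\ R^\top R_d=X_r,\ \delta=w,\ \Omega=R^\top\,{}^\circ\Omega_d\}.$$ Then every initial state has a solution on $[0,\infty)$, and $\mathcal S_1$ is almost globally asymptotically stable and locally exponentially stable for the closed loop. That is, with $d$ the distance to $\mathcal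 S_1$: 1. (stability) for all $\rho$ and all $\varepsilon>0$ there is $\eta>0$ such that every solution with $\|w(0)\|\le\rho$ and $d(0)<\eta$ satisfies $d(t)<\varepsilon$ for all $t\ge0$; 2. (almost global attractivity) for almost every initial state (Haar measure on both copies of $SO(3)$ times Lebesgue measure), every solution satisfies $d(t)\to0$ as $t\to\infty$; 3. (local exponential stability) for every $\rho$ there are $r,K,\lambda>0$ such that every solution with $\|w(0)\|\le\rho$ and $d(0)<r$ satisfies $d(t)\le Ke^{-\lambda t}d(0)$ for all $t\ge0$. -/

import Mathlib

open MeasureTheory Filter Topology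
open scoped Matrix

/-! ### The group `SO(3)`: metric, Borel sigma-algebra, Haar measure -/

/-- The special orthogonal group of `3 × 3` real matrices. -/
abbrev SO3 : Type := Matrix.specialOrthogonalGroup (Fin 3) ℝ

namespace SO3

/-- The distance on `SO(3)` is the largest entry of the difference in absolute value (any norm on
matrices gives an equivalent distance); its topology is the subspace topology. -/
noncomputable instance instMetricSpace : MetricSpace SO3 :=
  (MetricSpace.induced (fun (R : SO3) (i j : Fin 3) => (R : Matrix (Fin 3) (Fin 3) ℝ) i j)
    (fun _ _ h => Subtype.ext h) inferInstance).replaceTopology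
    (by rfl)

instance instIsTopologicalGroup : IsTopologicalGroup SO3 where
  continuous_inv := by
    refine Continuous.subtype_mk ?_ _
    exact (continuous_subtype_val (p := fun M : Matrix (Fin 3) (Fin 3) ℝ =>
      M ∈ Matrix.specialOrthogonalGroup (Fin 3) ℝ)).star

instance instCompactSpace : CompactSpace SO3 := by
  refine isCompact_iff_compactSpace.1 ?_
  have hc : IsCompact {M : Matrix (Fin 3) (Fin 3) ℝ | ∀ i j, M i j ∈ Set.Icc (-1 : ℝ) 1} := by
    have := isCompact_univ_pi (fun _ : Fin 3 => isCompact_univ_pi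
      (fun _ : Fin 3 => isCompact_Icc (a := (-1 : ℝ)) (b := 1)))
    have h : {M : Matrix (Fin 3) (Fin 3) ℝ | ∀ i j, M i j ∈ Set.Icc (-1 : ℝ) 1} =
        Set.univ.pi (fun _ : Fin 3 => Set.univ.pi (fun _ : Fin 3 => Set.Icc (-1 : ℝ) 1)) :=
      Set.ext fun M => ⟨fun h i _ j _ => h i j, fun h i j => h i trivial j trivial⟩
    rw [h]
    exact this
  refine hc.of_isClosed_subset ?_ ?_
  · have h : ((Matrix.specialOrthogonalGroup (Fin 3) ℝ : Submonoid _) :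
        Set (Matrix (Fin 3) (Fin 3) ℝ)) = {M | M * star M = 1} ∩ {M | M.det = 1} := by
      ext M
      rw [SetLike.mem_coe, Matrix.mem_specialOrthogonalGroup_iff, Matrix.mem_orthogonalGroup_iff]
      rfl
    rw [h]
    exact (isClosed_eq (by fun_prop) continuous_const).inter
      (isClosed_eq (Continuous.matrix_det continuous_id) continuous_const)
  · intro M hM i j
    have h := entry_norm_bound_of_unitary (𝕜 := ℝ) (U := M)
      (Matrix.mem_specialOrthogonalGroup_iff.1 hM).1 i j
    exact abs_le.1 h

instance instMeasurableSpace : MeasurableSpace SO3 := borel SO3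

instance instBorelSpace : BorelSpace SO3 := ⟨rfl⟩

end SO3

/-! ### Stability of sets for a family of trajectories -/

section Stability

variable {Z : Type*} [PseudoMetricSpace Z]

/-- Lyapunov stability of the set `A` for the trajectories in `T` that start in `B`. -/
def LyapunovStableOn (T : Set (ℝ → Z)) (A B : Set Z) : Prop :=
  ∀ ε > 0, ∃ η > 0, ∀ z ∈ T, z 0 ∈ B → Metric.infDist (z 0) A < η →
    ∀ t ≥ 0, Metric.infDist (z t) A < ε

/-- Local exponential stability of the set `A` for the trajectories in `T` that start in `B`. -/
def LocallyExponentiallyStableOn (T : Set (ℝ → Z)) (A B : Set Z) : Prop :=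
  ∃ r > 0, ∃ K > 0, ∃ l > 0, ∀ z ∈ T, z 0 ∈ B → Metric.infDist (z 0) A < r →
    ∀ t ≥ 0, Metric.infDist (z t) A ≤ K * Real.exp (-l * t) * Metric.infDist (z 0) A

/-- From `μ`-almost every initial state, every trajectory in `T` converges to the set `A`. -/
def AlmostGloballyAttractive [MeasurableSpace Z] (μ : Measure Z) (T : Set (ℝ → Z)) (A : Set Z) :
    Prop :=
  ∀ᵐ z₀ ∂μ, ∀ z ∈ T, z 0 = z₀ → Tendsto (fun t => Metric.infDist (z t) A) atTop (𝓝 0)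

end Stability

/-! ### The rigid body, the exosystem and the controller -/

/-- The skew-symmetric matrix `v_×` of the vector `v`, so that `v_× u = v × u`. -/
def hat (v : Fin 3 → ℝ) : Matrix (Fin 3) (Fin 3) ℝ :=
  !![0, -v 2, v 1; v 2, 0, -v 0; -v 1, v 0, 0]

/-- The Gram matrix `Q` of the trace inner product of `so(3)` in the coordinates `v ↦ v_×`, that is
`tr (u_×ᵀ v_×) = uᵀ Q v`. -/
def gramSO3 : Matrix (Fin 3) (Fin 3) ℝ :=
  Matrix.of fun i j => ((hat (Pi.single i 1))ᵀ * hat (Pi.single j 1)).trace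

/-- State of the closed loop: attitude `R`, reference attitude `R_d`, regulator state `δ`,
exosystem state `w`, body angular velocity `Ω`, in this order. -/
abbrev BodyState (m : ℕ) : Type :=
  SO3 × SO3 × (Fin m → ℝ) × (Fin m → ℝ) × (Fin 3 → ℝ)

namespace BodyState

variable {m : ℕ}

/-- The attitude `R`. -/
def R (z : BodyState m) : Matrix (Fin 3) (Fin 3) ℝ := z.1
/-- The reference attitude `R_d`. -/
def Rd (z : BodyState m) : Matrix (Fin 3) (Fin 3) ℝ := z.2.1
/-- The regulator state `δ`. -/
def δ (z : BodyState m) : Fin m → ℝ := z.2.2.1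
/-- The exosystem state `w`. -/
def w (z : BodyState m) : Fin m → ℝ := z.2.2.2.1
/-- The angular velocity `Ω` in the body frame. -/
def Ω (z : BodyState m) : Fin 3 → ℝ := z.2.2.2.2

/-- Haar measure on both copies of `SO(3)` times Lebesgue measure on the vector components. -/
noncomputable def measure (m : ℕ) : Measure (BodyState m) :=
  (Measure.haar : Measure SO3).prod ((Measure.haar : Measure SO3).prod
    ((volume : Measure (Fin m → ℝ)).prod
      ((volume : Measure (Fin m → ℝ)).prod (volume : Measure (Fin 3 → ℝ)))))

end BodyState

/-- The data of the tracking problem. -/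
structure TrackingData (m ν : ℕ) where
  /-- inertia matrix -/
  J : Matrix (Fin 3) (Fin 3) ℝ
  /-- exosystem matrix -/
  S : Matrix (Fin m) (Fin m) ℝ
  /-- exosystem output matrix -/
  C : Matrix (Fin 3) (Fin m) ℝ
  /-- reference element of the group -/
  Xr : SO3
  /-- constant reference vectors -/
  yo : Fin ν → Fin 3 → ℝ
  /-- proportional gain -/
  kp : ℝ
  /-- integral gain -/
  kI : ℝ
  /-- damping gain -/
  kD : ℝ

namespace TrackingData

variable {m ν : ℕ} (p : TrackingData m ν) (z : BodyState m)

/-- `y_i^r = X_r ẙ_i`. -/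
def yr (i : Fin ν) : Fin 3 → ℝ := (p.Xr : Matrix (Fin 3) (Fin 3) ℝ) *ᵥ p.yo i

/-- The measurements `y_i = R⁻¹ R_d ẙ_i`, with `R⁻¹ = Rᵀ`. -/
def y (i : Fin ν) : Fin 3 → ℝ := (z.Rᵀ * z.Rd) *ᵥ p.yo i

/-- The error vectors `e_i = y_i^r - y_i`. -/
def err (i : Fin ν) : Fin 3 → ℝ := p.yr i - p.y z i

/-- `Y = (k_p / 2) ∑ y_i^r (y_i^r)ᵀ`. -/
noncomputable def Y : Matrix (Fin 3) (Fin 3) ℝ :=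
  (p.kp / 2) • ∑ i, Matrix.vecMulVec (p.yr i) (p.yr i)

/-- The angular velocity `°Ω_d = C w` of the reference in the inertial frame. -/
def Ωd : Fin 3 → ℝ := p.C *ᵥ z.w

/-- `Δ = C δ`. -/
def Δ : Fin 3 → ℝ := p.C *ᵥ z.δ

/-- `α = (k_p / 2) ∑ e_i × y_i^r`. -/
noncomputable def α : Fin 3 → ℝ := (p.kp / 2) • ∑ i, p.err z i ⨯₃ p.yr i

/-- The virtual velocity input `Ω^c = Rᵀ Δ + (k_p / 2) ∑ e_i × y_i^r`. -/
noncomputable def Ωc : Fin 3 → ℝ :=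
  z.Rᵀ *ᵥ p.Δ z + (p.kp / 2) • ∑ i, p.err z i ⨯₃ p.yr i

/-- The velocity error `Ω̃ = Ω - Ω^c`. -/
noncomputable def Ωtilde : Fin 3 → ℝ := z.Ω - p.Ωc z

/-- The innovation term `β`. -/
noncomputable def β : Fin 3 → ℝ :=
  (p.kI / 2) • ∑ i, ((p.kp / 2) •
      ((z.R * hat (p.yr i - p.err z i) * hat (p.yr i) * p.Jᵀ) *ᵥ p.Ωtilde z)
    + z.R *ᵥ (p.err z i ⨯₃ p.yr i))

/-- The right-hand side `S δ + Cᵀ Q β` of the regulator. -/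
noncomputable def δdot : Fin m → ℝ := p.S *ᵥ z.δ + p.Cᵀ *ᵥ (gramSO3 *ᵥ p.β z)

/-- The torque `Γ`. -/
noncomputable def Γ : Fin 3 → ℝ :=
  z.Ω ⨯₃ (p.J *ᵥ z.Ω)
    - p.J *ᵥ (z.Ω ⨯₃ (z.Rᵀ *ᵥ p.Δ z))
    + p.J *ᵥ (z.Rᵀ *ᵥ (p.C *ᵥ p.δdot z))
    + ∑ i, p.err z i ⨯₃ p.yr i
    + p.J *ᵥ ((p.kp / 2) •
        ∑ i, (hat (p.yr i) * hat (p.yr i - p.err z i)) *ᵥ (p.Ωtilde z + p.α z))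
    - p.kD • p.Ωtilde z

/-- The solutions on `[0, ∞)` of the closed loop formed by the rigid body `Ṙ = R Ω_×`,
`J Ω̇ = - Ω × J Ω + Γ`, the exosystem `Ṙ_d = (C w)_× R_d`, `ẇ = S w`, and the controller. Only the
values of `z` on `[0, ∞)` matter. -/
def solutions : Set (ℝ → BodyState m) :=
  {z | ∀ t ∈ Set.Ici (0 : ℝ),
    (∀ i j, HasDerivWithinAt (fun s => (z s).R i j)
      (((z t).R * hat (z t).Ω) i j) (Set.Ici 0) t) ∧
    (∀ i j, HasDerivWithinAt (fun s => (z s).Rd i j)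
      ((hat (p.Ωd (z t)) * (z t).Rd) i j) (Set.Ici 0) t) ∧
    HasDerivWithinAt (fun s => (z s).δ) (p.δdot (z t)) (Set.Ici 0) t ∧
    HasDerivWithinAt (fun s => (z s).w) (p.S *ᵥ (z t).w) (Set.Ici 0) t ∧
    ∃ a : Fin 3 → ℝ, HasDerivWithinAt (fun s => (z s).Ω) a (Set.Ici 0) t ∧
      p.J *ᵥ a = - ((z t).Ω ⨯₃ (p.J *ᵥ (z t).Ω)) + p.Γ (z t)}

/-- The target set: `Rᵀ R_d = X_r`, `δ = w`, and `Ω` is the reference angular velocity expressed in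
the body frame, `Ω = Rᵀ °Ω_d`. -/
def targetSet : Set (BodyState m) :=
  {z | z.Rᵀ * z.Rd = (p.Xr : Matrix (Fin 3) (Fin 3) ℝ) ∧ z.δ = z.w ∧
    z.Ω = z.Rᵀ *ᵥ p.Ωd z}

/-- There are two linearly independent measurements, and `Y` has three distinct eigenvalues. -/
def MeasurementAssumption : Prop :=
  (∃ i j : Fin ν, LinearIndependent ℝ ![p.yo i, p.yo j]) ∧
  ∃ a b c : ℝ, a < b ∧ b < c ∧
    Module.End.HasEigenvalue (Matrix.toLin' p.Y) a ∧
    Module.End.HasEigenvalue (Matrix.toLin' p.Y) b ∧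
    Module.End.HasEigenvalue (Matrix.toLin' p.Y) c

/-- The pair `(S, C)` is observable: `C Sⁿ v = 0` for all `n` only for `v = 0`. -/
def Observable : Prop :=
  ∀ v : Fin m → ℝ, (∀ n : ℕ, p.C *ᵥ ((p.S ^ n) *ᵥ v) = 0) → v = 0

end TrackingData

/-! In the error coordinates P = Rᵀ R_d X_rᵀ, v = Ω̃, d = δ − w, with a = `attErr P` and M =
`attGain P` = PY − tr(PY) I, the closed loop reads P' = −ξ_× P, a' = Mξ, v' = J⁻¹((2/k_p) a − k_D v)
− Mζ, d' = S d + k_I Cᵀ R (Mᵀ J v + (2/k_p) a), where ζ = Rᵀ C d and ξ = ζ + a + v. The energy ½ Σ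
|y_i^r − P y_i^r|² + ½ v·Jv + |d|²/(2k_I) has derivative −(2/k_p)|a|² − k_D|v|², because all
couplings cancel (`hasDeriv_energy`). It bounds trajectories, hence gives global existence, and
Barbalat's lemma yields a, v → 0.

The zeros of a are the rotations P for which PY is symmetric. As Y has distinct nonnegative
eigenvalues, these are I and the half turns about the three eigenvectors of Y (`critical_attitude`).
At each of them N = M(P₀) is symmetric and invertible; it is negative definite at I and has a
positive eigenvalue at the others. Invertibility makes a a local coordinate on SO(3), so critical
attitudes are isolated and P(t) converges to one of them.

The energy does not decrease strictly in d. Near a critical P₀ it is replaced by the quadratic form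
W = −(1/k_p) a·N⁻¹a + ½ v·Jv + |d|²/(2k_I) + ε (v·Nζ + μ d·Bd), whose first term is the second-order
part of the attitude potential. The derivative of v·Nζ contains −|Nζ|², which damps Cd, and the
matrix B, built from observability, converts damping of Cd into damping of d. For small ε one gets
W' ≤ −c(|a|² + |v|² + |d|²), whatever the signature of N and also under small perturbations of the
linearised dynamics (`exists_strict_lyap`). Barbalat's lemma applied to W gives d → 0 along every
trajectory. At P₀ = I the form W is positive definite, which gives local exponential stability and
with it stability.

At the other critical attitudes W takes negative values. The same estimate holds for the difference
of two trajectories that share the exosystem (`exists_pair_lyap`): once W of the difference is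
negative it grows exponentially in absolute value, which is impossible for bounded trajectories that
both stay near P₀. Hence two trapped trajectories never differ in a negative direction
(`pairLyap_nonneg`), and near each trapped state there is, at every small scale, a ball of
comparable size free of trapped states. Lebesgue's density theorem for a doubling measure makes the
trapped states negligible in each fibre of fixed (R_d, w) (`exists_measure_trapped_eq_zero`); Fubini
and a countable union conclude. This porosity argument plays the role of a stable manifold theorem.
-/

section Proof

open scoped Matrix.Norms.Elementwise

/-! ### Derivatives and norm bounds for matrix expressions. -/

section MatrixCalculus

variable {l m n : Type*}

set_option linter.unusedSectionVars false

variable [Fintype l] [Fintype m] [Fintype n]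

theorem HasDerivWithinAt.matrix_mul {A : ℝ → Matrix l m ℝ} {B : ℝ → Matrix m n ℝ}
    {A' : Matrix l m ℝ} {B' : Matrix m n ℝ} {s : Set ℝ} {t : ℝ}
    (hA : HasDerivWithinAt A A' s t) (hB : HasDerivWithinAt B B' s t) :
    HasDerivWithinAt (fun τ => A τ * B τ) (A' * B t + A t * B') s t := by
  refine hasDerivWithinAt_pi.2 fun i => hasDerivWithinAt_pi.2 fun j => ?_
  have h1 : ∀ k, HasDerivWithinAt (fun τ => A τ i k) (A' i k) s t := fun k =>
    hasDerivWithinAt_pi.1 (hasDerivWithinAt_pi.1 hA i) k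
  have h2 : ∀ k, HasDerivWithinAt (fun τ => B τ k j) (B' k j) s t := fun k =>
    hasDerivWithinAt_pi.1 (hasDerivWithinAt_pi.1 hB k) j
  have := HasDerivWithinAt.fun_sum (u := Finset.univ) fun k _ => (h1 k).mul (h2 k)
  simpa [Matrix.mul_apply, Finset.sum_add_distrib] using this

theorem HasDerivWithinAt.matrix_mulVec {A : ℝ → Matrix m n ℝ} {v : ℝ → n → ℝ}
    {A' : Matrix m n ℝ} {v' : n → ℝ} {s : Set ℝ} {t : ℝ}
    (hA : HasDerivWithinAt A A' s t) (hv : HasDerivWithinAt v v' s t) :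
    HasDerivWithinAt (fun τ => A τ *ᵥ v τ) (A' *ᵥ v t + A t *ᵥ v') s t := by
  refine hasDerivWithinAt_pi.2 fun i => ?_
  have h1 : ∀ k, HasDerivWithinAt (fun τ => A τ i k) (A' i k) s t := fun k =>
    hasDerivWithinAt_pi.1 (hasDerivWithinAt_pi.1 hA i) k
  have := HasDerivWithinAt.fun_sum (u := Finset.univ) fun k _ =>
    (h1 k).mul (hasDerivWithinAt_pi.1 hv k)
  simpa [Matrix.mulVec, dotProduct, Finset.sum_add_distrib] using this

theorem HasDerivWithinAt.const_mulVec (A : Matrix m n ℝ) {v : ℝ → n → ℝ}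
    {v' : n → ℝ} {s : Set ℝ} {t : ℝ} (hv : HasDerivWithinAt v v' s t) :
    HasDerivWithinAt (fun τ => A *ᵥ v τ) (A *ᵥ v') s t := by
  simpa using (hasDerivWithinAt_const t s A).matrix_mulVec hv

theorem HasDerivWithinAt.dotProduct {u v : ℝ → n → ℝ} {u' v' : n → ℝ} {s : Set ℝ} {t : ℝ}
    (hu : HasDerivWithinAt u u' s t) (hv : HasDerivWithinAt v v' s t) :
    HasDerivWithinAt (fun τ => u τ ⬝ᵥ v τ) (u' ⬝ᵥ v t + u t ⬝ᵥ v') s t := by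
  have := HasDerivWithinAt.fun_sum (u := Finset.univ) fun k _ =>
    (hasDerivWithinAt_pi.1 hu k).mul (hasDerivWithinAt_pi.1 hv k)
  simpa [_root_.dotProduct, Finset.sum_add_distrib] using this

theorem HasDerivWithinAt.matrix_transpose {A : ℝ → Matrix m n ℝ} {A' : Matrix m n ℝ}
    {s : Set ℝ} {t : ℝ} (hA : HasDerivWithinAt A A' s t) :
    HasDerivWithinAt (fun τ => (A τ)ᵀ) A'ᵀ s t :=
  hasDerivWithinAt_pi.2 fun i => hasDerivWithinAt_pi.2 fun j =>
    hasDerivWithinAt_pi.1 (hasDerivWithinAt_pi.1 hA j) i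

theorem hasDerivWithinAt_matrix {A : ℝ → Matrix m n ℝ} {A' : Matrix m n ℝ}
    {s : Set ℝ} {t : ℝ} : HasDerivWithinAt A A' s t ↔
      ∀ i j, HasDerivWithinAt (fun τ => A τ i j) (A' i j) s t :=
  hasDerivWithinAt_pi.trans (forall_congr' fun _ => hasDerivWithinAt_pi)

theorem Matrix.norm_mul_le_card (A : Matrix l m ℝ) (B : Matrix m n ℝ) :
    ‖A * B‖ ≤ Fintype.card m * ‖A‖ * ‖B‖ := by
  refine (Matrix.norm_le_iff (by positivity)).2 fun i j => ?_
  rw [Matrix.mul_apply]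
  refine (norm_sum_le _ _).trans ?_
  have : ∀ k ∈ (Finset.univ : Finset m), ‖A i k * B k j‖ ≤ ‖A‖ * ‖B‖ := fun k _ => by
    rw [norm_mul]
    exact mul_le_mul A.norm_entry_le_entrywise_sup_norm B.norm_entry_le_entrywise_sup_norm
      (norm_nonneg _) (norm_nonneg _)
  refine (Finset.sum_le_sum this).trans_eq ?_
  simp [mul_assoc]

theorem Matrix.norm_mulVec_le_card (A : Matrix m n ℝ) (v : n → ℝ) :
    ‖A *ᵥ v‖ ≤ Fintype.card n * ‖A‖ * ‖v‖ := by
  refine (pi_norm_le_iff_of_nonneg (by positivity)).2 fun i => ?_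
  refine (norm_sum_le _ _).trans ?_
  have : ∀ k ∈ (Finset.univ : Finset n), ‖A i k * v k‖ ≤ ‖A‖ * ‖v‖ := fun k _ => by
    rw [norm_mul]
    exact mul_le_mul A.norm_entry_le_entrywise_sup_norm (norm_le_pi_norm v k)
      (norm_nonneg _) (norm_nonneg _)
  refine (Finset.sum_le_sum this).trans_eq ?_
  simp [mul_assoc]

theorem abs_dotProduct_le_card (u v : n → ℝ) :
    |u ⬝ᵥ v| ≤ Fintype.card n * ‖u‖ * ‖v‖ := by
  refine (Finset.abs_sum_le_sum_abs _ _).trans ?_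
  have : ∀ k ∈ (Finset.univ : Finset n), |u k * v k| ≤ ‖u‖ * ‖v‖ := fun k _ => by
    rw [abs_mul]
    exact mul_le_mul (norm_le_pi_norm u k) (norm_le_pi_norm v k)
      (abs_nonneg _) (norm_nonneg _)
  refine (Finset.sum_le_sum this).trans_eq ?_
  simp [mul_assoc]

/-- The norm on `n → ℝ` is the sup norm, so estimates have to be traded against the Euclidean square
`v ⬝ᵥ v`; this lemma and `dotProduct_self_le_card` are the two directions. -/
theorem sq_norm_le_dotProduct_self (v : n → ℝ) : ‖v‖ ^ 2 ≤ v ⬝ᵥ v := by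
  have h : ∀ i, ‖v i‖ ≤ √(v ⬝ᵥ v) := fun i => by
    refine Real.le_sqrt_of_sq_le ?_
    rw [Real.norm_eq_abs, sq_abs, sq]
    exact Finset.single_le_sum (f := fun i => v i * v i) (fun k _ => mul_self_nonneg _)
      (Finset.mem_univ i)
  have h0 : 0 ≤ v ⬝ᵥ v := Finset.sum_nonneg fun k _ => mul_self_nonneg _
  calc ‖v‖ ^ 2 ≤ √(v ⬝ᵥ v) ^ 2 := by
        gcongr
        exact (pi_norm_le_iff_of_nonneg (Real.sqrt_nonneg _)).2 h
    _ = v ⬝ᵥ v := Real.sq_sqrt h0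

theorem dotProduct_self_le_card (v : n → ℝ) : v ⬝ᵥ v ≤ Fintype.card n * ‖v‖ ^ 2 :=
  (le_abs_self _).trans ((abs_dotProduct_le_card v v).trans_eq (by ring))

theorem dotProduct_mulVec_comm {A : Matrix n n ℝ} (hA : Aᵀ = A) (u v : n → ℝ) :
    u ⬝ᵥ A *ᵥ v = v ⬝ᵥ A *ᵥ u := by
  rw [Matrix.dotProduct_mulVec, ← Matrix.mulVec_transpose, hA, dotProduct_comm]

theorem dotProduct_mulVec_self_of_skew {A : Matrix n n ℝ} (hA : Aᵀ = -A) (v : n → ℝ) :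
    v ⬝ᵥ A *ᵥ v = 0 := by
  have h : v ⬝ᵥ A *ᵥ v = - (v ⬝ᵥ A *ᵥ v) := by
    conv_lhs => rw [Matrix.dotProduct_mulVec, ← Matrix.mulVec_transpose, hA, dotProduct_comm]
    rw [Matrix.neg_mulVec, dotProduct_neg]
  linarith

end MatrixCalculus

/-! ### Skew matrices and the cross product. -/

section Cross

theorem hat_mulVec (u v : Fin 3 → ℝ) : hat u *ᵥ v = u ⨯₃ v := by
  ext i
  fin_cases i <;> simp [hat, Matrix.mulVec, dotProduct, Fin.sum_univ_three, cross_apply] <;> ring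

theorem hat_transpose (u : Fin 3 → ℝ) : (hat u)ᵀ = -hat u := by
  ext i j
  fin_cases i <;> fin_cases j <;> simp [hat]

theorem norm_hat_le (u : Fin 3 → ℝ) : ‖hat u‖ ≤ ‖u‖ := by
  refine (Matrix.norm_le_iff (norm_nonneg _)).2 fun i j => ?_
  have := norm_le_pi_norm u
  fin_cases i <;> fin_cases j <;> simp [hat] <;> exact this _

theorem norm_cross_le (u v : Fin 3 → ℝ) : ‖u ⨯₃ v‖ ≤ 3 * ‖u‖ * ‖v‖ := by
  rw [← hat_mulVec]
  refine ((hat u).norm_mulVec_le_card v).trans ?_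
  have := norm_hat_le u
  simp only [Fintype.card_fin]
  push_cast
  gcongr

theorem hat_add (u v : Fin 3 → ℝ) : hat (u + v) = hat u + hat v := by
  ext i j
  fin_cases i <;> fin_cases j <;> simp [hat] <;> ring

theorem hat_smul (c : ℝ) (v : Fin 3 → ℝ) : hat (c • v) = c • hat v := by
  ext i j
  fin_cases i <;> fin_cases j <;> simp [hat]

theorem hat_sub (u v : Fin 3 → ℝ) : hat (u - v) = hat u - hat v := by
  ext i j
  fin_cases i <;> fin_cases j <;> simp [hat] <;> ring

/-- The triple product satisfies det(Ax, Av, Ay) = det A · det(x, v, y); this is that identity with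
x and y stripped off. -/
theorem transpose_mul_hat_mul (A : Matrix (Fin 3) (Fin 3) ℝ) (v : Fin 3 → ℝ) :
    Aᵀ * hat (A *ᵥ v) * A = A.det • hat v := by
  ext i j
  fin_cases i <;> fin_cases j <;>
    simp [hat, Matrix.mul_apply, Matrix.det_fin_three, Matrix.mulVec, dotProduct,
      Fin.sum_univ_three] <;> ring

/-- Conjugation by a rotation acts on skew matrices through the rotation of the axis. -/
theorem mul_hat_mul_transpose {R : Matrix (Fin 3) (Fin 3) ℝ} (hR : R * Rᵀ = 1) (hd : R.det = 1)
    (v : Fin 3 → ℝ) : R * hat v * Rᵀ = hat (R *ᵥ v) := by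
  have h := transpose_mul_hat_mul R v
  rw [hd, one_smul] at h
  rw [← h]
  calc R * (Rᵀ * hat (R *ᵥ v) * R) * Rᵀ = (R * Rᵀ) * hat (R *ᵥ v) * (R * Rᵀ) := by
        simp only [Matrix.mul_assoc]
    _ = hat (R *ᵥ v) := by rw [hR, Matrix.one_mul, Matrix.mul_one]

theorem gramSO3_eq : gramSO3 = (2 : ℝ) • (1 : Matrix (Fin 3) (Fin 3) ℝ) := by
  ext i j
  fin_cases i <;> fin_cases j <;>
    simp [gramSO3, hat, Matrix.trace, Matrix.mul_apply, Fin.sum_univ_three, Pi.single_apply] <;>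
    norm_num

theorem HasDerivWithinAt.hat {u : ℝ → Fin 3 → ℝ} {u' : Fin 3 → ℝ} {s : Set ℝ} {t : ℝ}
    (hu : HasDerivWithinAt u u' s t) : HasDerivWithinAt (fun τ => hat (u τ)) (hat u') s t := by
  have h1 := hasDerivWithinAt_pi.1 hu
  refine hasDerivWithinAt_matrix.2 fun i j => ?_
  fin_cases i <;> fin_cases j <;> simp only [_root_.hat] <;>
    first
    | exact hasDerivWithinAt_const _ _ _
    | exact h1 _
    | exact (h1 _).neg

theorem HasDerivWithinAt.cross {u v : ℝ → Fin 3 → ℝ} {u' v' : Fin 3 → ℝ} {s : Set ℝ} {t : ℝ}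
    (hu : HasDerivWithinAt u u' s t) (hv : HasDerivWithinAt v v' s t) :
    HasDerivWithinAt (fun τ => u τ ⨯₃ v τ) (u' ⨯₃ v t + u t ⨯₃ v') s t := by
  simpa only [hat_mulVec] using hu.hat.matrix_mulVec hv

end Cross

/-! ### A quadratic form that encodes observability. -/

section Observability

variable {k m : ℕ}

theorem exists_dotProduct_mulVec_self_le (A : Matrix (Fin k) (Fin m) ℝ) :
    ∃ K : ℝ, 0 < K ∧ ∀ d, (A *ᵥ d) ⬝ᵥ (A *ᵥ d) ≤ K * (d ⬝ᵥ d) := by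
  refine ⟨k * (m * ‖A‖) ^ 2 + 1, by positivity, fun d => ?_⟩
  have h1 := A.norm_mulVec_le_card d
  have h2 := dotProduct_self_le_card (A *ᵥ d)
  have h3 := sq_norm_le_dotProduct_self d
  simp only [Fintype.card_fin] at h1 h2
  calc (A *ᵥ d) ⬝ᵥ (A *ᵥ d) ≤ k * ‖A *ᵥ d‖ ^ 2 := h2
    _ ≤ k * (m * ‖A‖ * ‖d‖) ^ 2 := by gcongr
    _ = k * (m * ‖A‖) ^ 2 * ‖d‖ ^ 2 := by ring
    _ ≤ (k * (m * ‖A‖) ^ 2 + 1) * ‖d‖ ^ 2 := by gcongr; linarith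
    _ ≤ _ := by gcongr

theorem neg_dotProduct_le {n : Type*} [Fintype n] (x y : n → ℝ) {s : ℝ} (hs : 0 < s) :
    -(x ⬝ᵥ y) ≤ 1 / (4 * s) * (x ⬝ᵥ x) + s * (y ⬝ᵥ y) := by
  have h : 0 ≤ (x + (2 * s) • y) ⬝ᵥ (x + (2 * s) • y) :=
    Finset.sum_nonneg fun k _ => mul_self_nonneg _
  simp only [add_dotProduct, dotProduct_add, smul_dotProduct, dotProduct_smul, smul_eq_mul,
    dotProduct_comm y x] at h
  have h2 : 1 / (4 * s) * (x ⬝ᵥ x) + s * (y ⬝ᵥ y) + x ⬝ᵥ y = 1 / (4 * s) *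
      (x ⬝ᵥ x + 2 * s * (x ⬝ᵥ y) + (2 * s * (x ⬝ᵥ y) + 2 * s * (2 * s * (y ⬝ᵥ y)))) := by
    field_simp
    ring
  have : 0 ≤ 1 / (4 * s) * (x ⬝ᵥ x) + s * (y ⬝ᵥ y) + x ⬝ᵥ y := by
    rw [h2]; exact mul_nonneg (by positivity) (by linarith)
  linarith

/-- Along d' = S d, the derivative of −(CSⁿd)·(CSⁿ⁺¹d) is −|CSⁿ⁺¹d|² − (CSⁿd)·(CSⁿ⁺²d). Young's
inequality bounds the last product by q|CSⁿd|² plus a small multiple of |d|², and q times the form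
obtained for n absorbs q|CSⁿd|². The arbitrary ε is what keeps the induction alive. -/
theorem exists_observability_form_aux (S : Matrix (Fin m) (Fin m) ℝ)
    (C : Matrix (Fin k) (Fin m) ℝ) (n : ℕ) : ∀ ε : ℝ, 0 < ε →
    ∃ B : Matrix (Fin m) (Fin m) ℝ, ∃ K : ℝ, 0 ≤ K ∧ ∀ d,
      (S *ᵥ d) ⬝ᵥ (B *ᵥ d) + d ⬝ᵥ (B *ᵥ (S *ᵥ d)) ≤
        -((C * S ^ n) *ᵥ d ⬝ᵥ (C * S ^ n) *ᵥ d) + ε * (d ⬝ᵥ d) + K * (C *ᵥ d ⬝ᵥ C *ᵥ d) := by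
  induction n with
  | zero =>
    intro ε hε
    refine ⟨0, 1, zero_le_one, fun d => ?_⟩
    have h0 : 0 ≤ d ⬝ᵥ d := Finset.sum_nonneg fun k _ => mul_self_nonneg _
    have : 0 ≤ ε * (d ⬝ᵥ d) := by positivity
    simp
    linarith
  | succ n ih =>
    intro ε hε
    obtain ⟨G, hG, hGd⟩ := exists_dotProduct_mulVec_self_le (C * S ^ (n + 2))
    -- With this s the term in CSⁿ⁺² costs (ε/2)|d|². The induction hypothesis is taken at ε/(2q)
    -- because it gets multiplied by q, and so costs the other half.
    set s : ℝ := ε / (2 * G) with hs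
    have hs0 : 0 < s := by positivity
    set q : ℝ := 1 / (4 * s) with hq
    have hq0 : 0 < q := by positivity
    obtain ⟨B, K, hK, hB⟩ := ih (ε / (2 * q)) (by positivity)
    refine ⟨-((C * S ^ n)ᵀ * (C * S ^ (n + 1))) + q • B, q * K, by positivity, fun d => ?_⟩
    have e1 : ∀ x y : Fin m → ℝ, x ⬝ᵥ ((C * S ^ n)ᵀ * (C * S ^ (n + 1))) *ᵥ y =
        (C * S ^ n) *ᵥ x ⬝ᵥ (C * S ^ (n + 1)) *ᵥ y := fun x y => by
      rw [← Matrix.mulVec_mulVec, Matrix.dotProduct_mulVec, ← Matrix.mulVec_transpose,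
        Matrix.transpose_transpose]
    have e2 : (C * S ^ n) *ᵥ (S *ᵥ d) = (C * S ^ (n + 1)) *ᵥ d := by
      rw [Matrix.mulVec_mulVec, Matrix.mul_assoc, ← pow_succ]
    have e3 : (C * S ^ (n + 1)) *ᵥ (S *ᵥ d) = (C * S ^ (n + 2)) *ᵥ d := by
      rw [Matrix.mulVec_mulVec, Matrix.mul_assoc, ← pow_succ]
    have h1 := neg_dotProduct_le ((C * S ^ n) *ᵥ d) ((C * S ^ (n + 2)) *ᵥ d) hs0
    have h2 := hGd d
    have h3 := mul_le_mul_of_nonneg_left (hB d) hq0.le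
    have h4 : s * ((C * S ^ (n + 2)) *ᵥ d ⬝ᵥ (C * S ^ (n + 2)) *ᵥ d) ≤ ε / 2 * (d ⬝ᵥ d) := by
      calc _ ≤ s * (G * (d ⬝ᵥ d)) := by gcongr
        _ = _ := by rw [hs]; field_simp
    have h5 : q * (ε / (2 * q) * (d ⬝ᵥ d)) = ε / 2 * (d ⬝ᵥ d) := by field_simp
    simp only [Matrix.add_mulVec, Matrix.neg_mulVec, dotProduct_add, dotProduct_neg,
      Matrix.smul_mulVec, dotProduct_smul, smul_eq_mul, e1, e2, e3]
    rw [← hq] at h1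
    linarith

/-- By observability and compactness of the unit sphere, finitely many of the |CSⁿd|² already
dominate a multiple c' of |d|². Adding the corresponding auxiliary forms with total error at most
(c'/2)|d|² and rescaling by 2/c' gives B. The function d·Bd thus decreases along d' = S d except for
what Cd contributes. -/
theorem exists_observability_form (S : Matrix (Fin m) (Fin m) ℝ)
    (C : Matrix (Fin k) (Fin m) ℝ)
    (hobs : ∀ v : Fin m → ℝ, (∀ n : ℕ, C *ᵥ ((S ^ n) *ᵥ v) = 0) → v = 0) :
    ∃ B : Matrix (Fin m) (Fin m) ℝ, ∃ K : ℝ, 0 ≤ K ∧ ∀ d,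
      (S *ᵥ d) ⬝ᵥ (B *ᵥ d) + d ⬝ᵥ (B *ᵥ (S *ᵥ d)) ≤
        -(d ⬝ᵥ d) + K * (C *ᵥ d ⬝ᵥ C *ᵥ d) := by
  have hpos : ∀ x : Fin k → ℝ, 0 ≤ x ⬝ᵥ x := fun x =>
    Finset.sum_nonneg fun k _ => mul_self_nonneg _
  set g : ℕ → (Fin m → ℝ) → ℝ := fun n d => (C * S ^ n) *ᵥ d ⬝ᵥ (C * S ^ n) *ᵥ d with hg
  have hgc : ∀ n, Continuous (g n) := fun n => by
    simp only [hg]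
    exact ((Continuous.matrix_mulVec continuous_const continuous_id)).dotProduct
      (Continuous.matrix_mulVec continuous_const continuous_id)
  obtain ⟨t, ht⟩ := (isCompact_sphere (0 : Fin m → ℝ) 1).elim_finite_subcover
    (fun n => {d | 0 < g n d}) (fun n => isOpen_lt continuous_const (hgc n)) (by
      intro d hd
      by_contra hcon
      simp only [Set.mem_iUnion, Set.mem_ofPred_eq, not_exists, not_lt] at hcon
      have : d = 0 := hobs d fun n => by
        have := le_antisymm (hcon n) (hpos _)
        rw [dotProduct_self_eq_zero] at this
        rwa [Matrix.mulVec_mulVec]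
      simp [this] at hd)
  have hsum : ∀ d ∈ Metric.sphere (0 : Fin m → ℝ) 1, 0 < ∑ n ∈ t, g n d := fun d hd => by
    obtain ⟨n, hn, hd'⟩ := Set.mem_iUnion₂.1 (ht hd)
    exact Finset.sum_pos' (fun n _ => hpos _) ⟨n, hn, hd'⟩
  obtain ⟨c, hc, hcd⟩ := (isCompact_sphere (0 : Fin m → ℝ) 1).exists_forall_le'
    (continuous_finsetSum t fun n _ => hgc n).continuousOn hsum
  -- Passing from the sup norm to d·d costs a factor m; dividing by m + 1 instead also covers m = 0.
  have hcoer : ∀ d, c / (m + 1) * (d ⬝ᵥ d) ≤ ∑ n ∈ t, g n d := fun d => by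
    by_cases hd : d = 0
    · simp [hd, hg]
    have hn : 0 < ‖d‖ := norm_pos_iff.2 hd
    have h1 := hcd (‖d‖⁻¹ • d) (by simp [norm_smul, hn.ne'])
    have h2 : ∑ n ∈ t, g n (‖d‖⁻¹ • d) = (‖d‖⁻¹) ^ 2 * ∑ n ∈ t, g n d := by
      rw [Finset.mul_sum]
      refine Finset.sum_congr rfl fun n _ => ?_
      simp only [hg, Matrix.mulVec_smul, smul_dotProduct, dotProduct_smul, smul_eq_mul]
      ring
    rw [h2] at h1
    have h3 : c * ‖d‖ ^ 2 ≤ ∑ n ∈ t, g n d := by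
      rw [inv_pow, inv_mul_eq_div, le_div_iff₀ (by positivity)] at h1
      exact h1
    have h4 := dotProduct_self_le_card d
    rw [Fintype.card_fin] at h4
    calc c / (m + 1) * (d ⬝ᵥ d) ≤ c / (m + 1) * (m * ‖d‖ ^ 2) := by gcongr
      _ = c * ‖d‖ ^ 2 * (m / (m + 1)) := by ring
      _ ≤ c * ‖d‖ ^ 2 * 1 := by
          gcongr
          rw [div_le_one (by positivity)]; linarith
      _ ≤ _ := by linarith
  set c' : ℝ := c / (m + 1) with hc'
  have hc0 : 0 < c' := by positivity
  have hex := fun n => exists_observability_form_aux S C n (c' / (2 * (t.card + 1)))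
    (by positivity)
  choose B K hK hB using hex
  refine ⟨(2 / c') • ∑ n ∈ t, B n, 2 / c' * ∑ n ∈ t, K n, mul_nonneg (by positivity)
    (Finset.sum_nonneg fun n _ => hK n), fun d => ?_⟩
  have h1 := Finset.sum_le_sum fun n (_ : n ∈ t) => hB n d
  simp only [Finset.sum_add_distrib, Finset.sum_neg_distrib, Finset.sum_const, nsmul_eq_mul,
    ← Finset.sum_mul] at h1
  have h2 := hcoer d
  have h0 : 0 ≤ d ⬝ᵥ d := Finset.sum_nonneg fun k _ => mul_self_nonneg _
  have h3 : (t.card : ℝ) * (c' / (2 * (t.card + 1)) * (d ⬝ᵥ d)) ≤ c' / 2 * (d ⬝ᵥ d) := by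
    calc (t.card : ℝ) * (c' / (2 * (t.card + 1)) * (d ⬝ᵥ d))
        = c' / 2 * (d ⬝ᵥ d) * (t.card / (t.card + 1)) := by field_simp
      _ ≤ c' / 2 * (d ⬝ᵥ d) * 1 := by
          gcongr
          rw [div_le_one (by positivity)]; linarith
      _ = _ := mul_one _
  simp only [Matrix.smul_mulVec, dotProduct_smul, smul_eq_mul, Matrix.sum_mulVec, dotProduct_sum]
  rw [← mul_add]
  calc _ ≤ 2 / c' * (-(c' / 2 * (d ⬝ᵥ d)) + (∑ n ∈ t, K n) * (C *ᵥ d ⬝ᵥ C *ᵥ d)) := by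
        refine mul_le_mul_of_nonneg_left ?_ (by positivity)
        simp only [hg] at h2
        linarith
    _ = _ := by field_simp

end Observability

/-! ### The scalar inequality behind strict decrease. -/

section Strict

-- Here A, V, D, H stand for the norms of a, v, d and Rᵀ C d, and κ for the relative size of the
-- perturbation. The constants form a hierarchy: μ = m/(2K) lets half of mH² absorb μKH²; then ε is
-- small enough that g/2 absorbs all the terms in A² + V² produced by Young's inequality; κ comes
-- last. The constant μ is fixed before ε₀ because the bound that coercivity imposes on ε depends on
-- μ.
set_option maxHeartbeats 1000000 in
theorem strict_decrease_scalar {g m K : ℝ} (hg : 0 < g) (hm : 0 < m) (hK : 0 < K) :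
    ∃ μ > 0, ∀ ε₀ > 0, ∃ ε > 0, ε ≤ ε₀ ∧ ∃ κ > 0, ∃ c > 0, ∀ A V D H : ℝ, 0 ≤ A → 0 ≤ V → 0 ≤ D →
      0 ≤ H → H ≤ K * D →
      -g * (A ^ 2 + V ^ 2) + K * κ * (A + V + D) ^ 2 +
        ε * (-m * H ^ 2 + K * (A + V + κ * (A + V + D)) * H
          + K * V * (D + A + V + κ * (A + V + D))
          + μ * (-D ^ 2 + K * H ^ 2 + K * D * (A + V + κ * (A + V + D)))) ≤
        -c * (A ^ 2 + V ^ 2 + D ^ 2) := by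
  set μ : ℝ := m / (2 * K) with hμ
  have hμ0 : 0 < μ := by positivity
  refine ⟨μ, hμ0, fun ε₀ hε₀ => ?_⟩
  -- One summand for each cross term: (A+V)H, VD, V(A+V) and D(A+V), in this order.
  set L : ℝ := 2 * K ^ 2 / m + K ^ 2 / μ + 2 * K + 2 * μ * K ^ 2 with hL
  have hL0 : 0 < L := by positivity
  set ε : ℝ := min ε₀ (g / (2 * L)) with hε
  have hε0 : 0 < ε := lt_min hε₀ (by positivity)
  have hεL : ε * L ≤ g / 2 := by
    calc ε * L ≤ g / (2 * L) * L := by gcongr; exact min_le_right _ _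
      _ = g / 2 := by field_simp
  -- All terms carrying κ add up to at most κL'(A² + V² + D²); the 3 comes from (A+V+D)² ≤ 3(A² + V²
  -- + D²).
  set L' : ℝ := 3 * (K + ε * (K * (K + 1 + μ))) with hL'
  have hL'0 : 0 < L' := by positivity
  set c₀ : ℝ := min (g / 2) (ε * μ / 2) with hc₀
  have hc₀0 : 0 < c₀ := lt_min (by positivity) (by positivity)
  refine ⟨ε, hε0, min_le_left _ _, c₀ / (2 * L'), by positivity, c₀ / 2, by positivity, ?_⟩
  intro A V D H hA hV hD hH hHD
  set κ : ℝ := c₀ / (2 * L') with hκ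
  have hκ0 : 0 < κ := by positivity
  have hκL : κ * L' = c₀ / 2 := by rw [hκ]; field_simp
  have i1 : (A + V) ^ 2 ≤ 2 * (A ^ 2 + V ^ 2) := by nlinarith [sq_nonneg (A - V)]
  have i2 : (A + V + D) ^ 2 ≤ 3 * (A ^ 2 + V ^ 2 + D ^ 2) := by
    nlinarith [sq_nonneg (A - V), sq_nonneg (A - D), sq_nonneg (V - D)]
  have j1 : K * (A + V) * H ≤ m / 4 * H ^ 2 + 2 * K ^ 2 / m * (A ^ 2 + V ^ 2) := by
    have : K * (A + V) * H ≤ m / 4 * H ^ 2 + K ^ 2 / m * (A + V) ^ 2 := by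
      have h : m / 4 * H ^ 2 + K ^ 2 / m * (A + V) ^ 2 - K * (A + V) * H =
        1 / (4 * m) * (m * H - 2 * K * (A + V)) ^ 2 := by field_simp; ring
      have : 0 ≤ 1 / (4 * m) * (m * H - 2 * K * (A + V)) ^ 2 := by positivity
      linarith
    calc _ ≤ _ := this
      _ ≤ m / 4 * H ^ 2 + K ^ 2 / m * (2 * (A ^ 2 + V ^ 2)) := by gcongr
      _ = _ := by ring
  have j2 : K * V * D ≤ μ / 4 * D ^ 2 + K ^ 2 / μ * (A ^ 2 + V ^ 2) := by
    have h : μ / 4 * D ^ 2 + K ^ 2 / μ * V ^ 2 - K * V * D =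
        1 / (4 * μ) * (μ * D - 2 * K * V) ^ 2 := by field_simp; ring
    have h1 : 0 ≤ 1 / (4 * μ) * (μ * D - 2 * K * V) ^ 2 := by positivity
    have h2 : 0 ≤ K ^ 2 / μ * A ^ 2 := by positivity
    linarith
  have j3 : K * V * (A + V) ≤ 2 * K * (A ^ 2 + V ^ 2) := by
    have : V * (A + V) ≤ 2 * (A ^ 2 + V ^ 2) := by
      linarith [sq_nonneg (A - V), sq_nonneg A, sq_nonneg V]
    calc _ = K * (V * (A + V)) := by ring
      _ ≤ K * (2 * (A ^ 2 + V ^ 2)) := by gcongr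
      _ = _ := by ring
  have j4 : μ * (K * D * (A + V)) ≤ μ / 4 * D ^ 2 + 2 * μ * K ^ 2 * (A ^ 2 + V ^ 2) := by
    have h : K * D * (A + V) ≤ D ^ 2 / 4 + K ^ 2 * (A + V) ^ 2 := by
      nlinarith [sq_nonneg (D / 2 - K * (A + V))]
    calc _ ≤ μ * (D ^ 2 / 4 + K ^ 2 * (2 * (A ^ 2 + V ^ 2))) := by
          gcongr; exact h.trans (by gcongr)
      _ = _ := by ring
  have j5 : κ * (A + V + D) * (K * H + K * V + μ * K * D) ≤
      κ * (K * (K + 1 + μ)) * (A + V + D) ^ 2 := by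
    have : K * H + K * V + μ * K * D ≤ K * (K + 1 + μ) * (A + V + D) := by
      have : K * H ≤ K * (K * D) := by gcongr
      have h1 : 0 ≤ K * (K + 1 + μ) * A := by positivity
      have h2 : 0 ≤ K * (K + μ) * V := by positivity
      have h3 : 0 ≤ K * D := by positivity
      linarith
    calc _ ≤ κ * (A + V + D) * (K * (K + 1 + μ) * (A + V + D)) := by gcongr
      _ = _ := by ring
  have j6 : μ * (K * H ^ 2) = m / 2 * H ^ 2 := by rw [hμ]; field_simp
  have hH2 : 0 ≤ m / 4 * H ^ 2 := by positivity
  have tot : -m * H ^ 2 + K * (A + V + κ * (A + V + D)) * H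
          + K * V * (D + A + V + κ * (A + V + D))
          + μ * (-D ^ 2 + K * H ^ 2 + K * D * (A + V + κ * (A + V + D))) ≤
      L * (A ^ 2 + V ^ 2) - μ / 2 * D ^ 2 + κ * (K * (K + 1 + μ)) * (A + V + D) ^ 2 := by
    rw [hL]
    linarith
  have tot2 := mul_le_mul_of_nonneg_left tot hε0.le
  have e1 : K * κ * (A + V + D) ^ 2 + ε * (κ * (K * (K + 1 + μ)) * (A + V + D) ^ 2) ≤
      c₀ / 2 * (A ^ 2 + V ^ 2 + D ^ 2) := by
    calc _ = κ * (K + ε * (K * (K + 1 + μ))) * (A + V + D) ^ 2 := by ring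
      _ ≤ κ * (K + ε * (K * (K + 1 + μ))) * (3 * (A ^ 2 + V ^ 2 + D ^ 2)) := by gcongr
      _ = κ * L' * (A ^ 2 + V ^ 2 + D ^ 2) := by rw [hL']; ring
      _ = _ := by rw [hκL]
  have e2 : ε * L * (A ^ 2 + V ^ 2) ≤ g / 2 * (A ^ 2 + V ^ 2) := by gcongr
  have e3 : c₀ * (A ^ 2 + V ^ 2) ≤ g / 2 * (A ^ 2 + V ^ 2) := by
    gcongr; exact min_le_left _ _
  have e4 : c₀ * D ^ 2 ≤ ε * μ / 2 * D ^ 2 := by gcongr; exact min_le_right _ _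
  linarith

end Strict

/-! ### The strict Lyapunov form of the linearised error dynamics. -/

theorem exists_norm_sq_le_of_pos {n : Type*} [Fintype n] {A : Matrix n n ℝ}
    (hA : ∀ v, v ≠ 0 → 0 < v ⬝ᵥ A *ᵥ v) : ∃ c > 0, ∀ v, c * ‖v‖ ^ 2 ≤ v ⬝ᵥ A *ᵥ v := by
  obtain ⟨c, hc, hcd⟩ := (isCompact_sphere (0 : n → ℝ) 1).exists_forall_le'
    (f := fun v => v ⬝ᵥ A *ᵥ v) (a := 0)
    (continuous_id.dotProduct (Continuous.matrix_mulVec continuous_const continuous_id)).continuousOn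
    (fun v hv => hA v (by rintro rfl; simp at hv))
  refine ⟨c, hc, fun v => ?_⟩
  by_cases hv : v = 0
  · simp [hv]
  have hn : 0 < ‖v‖ := norm_pos_iff.2 hv
  have h1 := hcd (‖v‖⁻¹ • v) (by simp [norm_smul, hn.ne'])
  simp only [Matrix.mulVec_smul, smul_dotProduct, dotProduct_smul, smul_eq_mul] at h1
  rw [← mul_assoc, ← mul_inv, inv_mul_eq_div, le_div_iff₀ (by positivity)] at h1
  rwa [sq]

theorem Matrix.norm_le_one_of_mul_transpose {n : Type*} [Fintype n] [DecidableEq n]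
    {R : Matrix n n ℝ} (hR : R * Rᵀ = 1) : ‖R‖ ≤ 1 :=
  (Matrix.norm_le_iff zero_le_one).2 fun i j =>
    entry_norm_bound_of_unitary (𝕜 := ℝ) (U := R) ((Matrix.mem_orthogonalGroup_iff _ _).2 hR) i j

namespace TrackingData

variable {m ν : ℕ} (p : TrackingData m ν)

/-- The quadratic form `V + ε (cross terms)` in the error coordinates near a critical attitude. -/
noncomputable def lyap (N Ni : Matrix (Fin 3) (Fin 3) ℝ) (B : Matrix (Fin m) (Fin m) ℝ) (ε μ : ℝ)
    (R : Matrix (Fin 3) (Fin 3) ℝ) (a v : Fin 3 → ℝ) (d : Fin m → ℝ) : ℝ :=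
  -(1 / p.kp) * (a ⬝ᵥ Ni *ᵥ a) + 1 / 2 * (v ⬝ᵥ p.J *ᵥ v) + 1 / (2 * p.kI) * (d ⬝ᵥ d)
    + ε * (v ⬝ᵥ N *ᵥ (Rᵀ *ᵥ (p.C *ᵥ d)) + μ * (d ⬝ᵥ B *ᵥ d))

/-- The derivative of `lyap` along a curve with velocities `R', a', v', d'`. -/
noncomputable def lyapDeriv (N Ni : Matrix (Fin 3) (Fin 3) ℝ) (B : Matrix (Fin m) (Fin m) ℝ)
    (ε μ : ℝ) (R R' : Matrix (Fin 3) (Fin 3) ℝ) (a v : Fin 3 → ℝ) (d : Fin m → ℝ)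
    (a' v' : Fin 3 → ℝ) (d' : Fin m → ℝ) : ℝ :=
  -(1 / p.kp) * (a' ⬝ᵥ Ni *ᵥ a + a ⬝ᵥ Ni *ᵥ a') + 1 / 2 * (v' ⬝ᵥ p.J *ᵥ v + v ⬝ᵥ p.J *ᵥ v')
    + 1 / (2 * p.kI) * (d' ⬝ᵥ d + d ⬝ᵥ d')
    + ε * (v' ⬝ᵥ N *ᵥ (Rᵀ *ᵥ (p.C *ᵥ d)) +
        v ⬝ᵥ N *ᵥ (R'ᵀ *ᵥ (p.C *ᵥ d) + Rᵀ *ᵥ (p.C *ᵥ d'))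
      + μ * (d' ⬝ᵥ B *ᵥ d + d ⬝ᵥ B *ᵥ d'))

theorem hasDerivWithinAt_lyap (N Ni : Matrix (Fin 3) (Fin 3) ℝ) (B : Matrix (Fin m) (Fin m) ℝ)
    (ε μ : ℝ) {R : ℝ → Matrix (Fin 3) (Fin 3) ℝ} {a v : ℝ → Fin 3 → ℝ} {d : ℝ → Fin m → ℝ}
    {R' : Matrix (Fin 3) (Fin 3) ℝ} {a' v' : Fin 3 → ℝ} {d' : Fin m → ℝ} {s : Set ℝ} {t : ℝ}
    (hR : HasDerivWithinAt R R' s t) (ha : HasDerivWithinAt a a' s t)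
    (hv : HasDerivWithinAt v v' s t) (hd : HasDerivWithinAt d d' s t) :
    HasDerivWithinAt (fun τ => p.lyap N Ni B ε μ (R τ) (a τ) (v τ) (d τ))
      (p.lyapDeriv N Ni B ε μ (R t) R' (a t) (v t) (d t) a' v' d') s t := by
  unfold lyap lyapDeriv
  exact ((((ha.dotProduct (ha.const_mulVec Ni)).const_mul _).add
    ((hv.dotProduct (hv.const_mulVec p.J)).const_mul _)).add
    ((hd.dotProduct hd).const_mul _)).add
    (((hv.dotProduct ((hR.matrix_transpose.matrix_mulVec (hd.const_mulVec p.C)).const_mulVec N)).add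
      ((hd.dotProduct (hd.const_mulVec B)).const_mul _)).const_mul _)

/-- The part of `lyap` without ε is a second-order model of the energy: the potential changes at the
rate −(2/k_p) ξ·a while a' = Nξ, so it behaves like −(1/k_p) a·N⁻¹a. Its couplings therefore cancel
as they do for the energy, and only damping and the remainders r₁, r₂, r₃ survive. In the ε part,
the term −Nζ of v' produces −|Nζ|². The sign of N plays no role. -/
theorem lyapDeriv_eq {N Ni : Matrix (Fin 3) (Fin 3) ℝ} (B : Matrix (Fin m) (Fin m) ℝ) (ε μ : ℝ)
    (hJ : p.Jᵀ = p.J) (hJi : p.J * p.J⁻¹ = 1) (hS : p.Sᵀ = -p.S) (hN : Nᵀ = N)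
    (hNi : N * Ni = 1) (hkp : 0 < p.kp) (hkI : 0 < p.kI) (R R' : Matrix (Fin 3) (Fin 3) ℝ)
    (a v : Fin 3 → ℝ) (d : Fin m → ℝ) (r₁ r₂ : Fin 3 → ℝ) (r₃ : Fin m → ℝ) :
    p.lyapDeriv N Ni B ε μ R R' a v d
      (N *ᵥ (Rᵀ *ᵥ (p.C *ᵥ d) + a + v) + r₁)
      (p.J⁻¹ *ᵥ ((2 / p.kp) • a - p.kD • v) - N *ᵥ (Rᵀ *ᵥ (p.C *ᵥ d)) + r₂)
      (p.S *ᵥ d + p.kI • (p.Cᵀ *ᵥ (R *ᵥ (N *ᵥ (p.J *ᵥ v) + (2 / p.kp) • a))) + r₃) =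
    -(2 / p.kp) * (a ⬝ᵥ a) - p.kD * (v ⬝ᵥ v)
      + (-(1 / p.kp) * (r₁ ⬝ᵥ Ni *ᵥ a + a ⬝ᵥ Ni *ᵥ r₁) + v ⬝ᵥ p.J *ᵥ r₂
        + 1 / p.kI * (d ⬝ᵥ r₃))
      + ε * ((p.J⁻¹ *ᵥ ((2 / p.kp) • a - p.kD • v) + r₂) ⬝ᵥ N *ᵥ (Rᵀ *ᵥ (p.C *ᵥ d))
          - (N *ᵥ (Rᵀ *ᵥ (p.C *ᵥ d))) ⬝ᵥ (N *ᵥ (Rᵀ *ᵥ (p.C *ᵥ d)))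
        + v ⬝ᵥ N *ᵥ (R'ᵀ *ᵥ (p.C *ᵥ d) + Rᵀ *ᵥ (p.C *ᵥ
            (p.S *ᵥ d + p.kI • (p.Cᵀ *ᵥ (R *ᵥ (N *ᵥ (p.J *ᵥ v) + (2 / p.kp) • a))) + r₃)))
        + μ * ((p.S *ᵥ d) ⬝ᵥ (B *ᵥ d) + d ⬝ᵥ (B *ᵥ (p.S *ᵥ d))
          + (p.kI • (p.Cᵀ *ᵥ (R *ᵥ (N *ᵥ (p.J *ᵥ v) + (2 / p.kp) • a))) + r₃) ⬝ᵥ (B *ᵥ d)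
          + d ⬝ᵥ B *ᵥ (p.kI • (p.Cᵀ *ᵥ (R *ᵥ (N *ᵥ (p.J *ᵥ v) + (2 / p.kp) • a))) + r₃))) := by
  set ζ := Rᵀ *ᵥ (p.C *ᵥ d) with hζ
  set u := N *ᵥ (p.J *ᵥ v) + (2 / p.kp) • a with hu
  have hNi' : Ni * N = 1 := mul_eq_one_comm.1 hNi
  have e1 : ∀ w, (N *ᵥ w) ⬝ᵥ Ni *ᵥ a = w ⬝ᵥ a := fun w => by
    rw [dotProduct_comm, dotProduct_mulVec_comm hN, Matrix.mulVec_mulVec, hNi, Matrix.one_mulVec]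
  have e2 : ∀ w, a ⬝ᵥ Ni *ᵥ (N *ᵥ w) = a ⬝ᵥ w := fun w => by
    rw [Matrix.mulVec_mulVec, hNi', Matrix.one_mulVec]
  have e3 : ∀ w, w ⬝ᵥ p.J *ᵥ v = v ⬝ᵥ p.J *ᵥ w := fun w => dotProduct_mulVec_comm hJ _ _
  have e4 : ∀ w, p.J *ᵥ (p.J⁻¹ *ᵥ w) = w := fun w => by
    rw [Matrix.mulVec_mulVec, hJi, Matrix.one_mulVec]
  have e5 : d ⬝ᵥ p.Cᵀ *ᵥ (R *ᵥ u) = ζ ⬝ᵥ u := by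
    rw [hζ, Matrix.dotProduct_mulVec, Matrix.vecMul_transpose, Matrix.dotProduct_mulVec,
      Matrix.mulVec_transpose]
  have e6 : ζ ⬝ᵥ N *ᵥ (p.J *ᵥ v) = v ⬝ᵥ p.J *ᵥ (N *ᵥ ζ) := by
    rw [dotProduct_mulVec_comm hN, dotProduct_comm, e3]
  have e7 : d ⬝ᵥ p.S *ᵥ d = 0 := dotProduct_mulVec_self_of_skew hS d
  have e8 : (p.S *ᵥ d) ⬝ᵥ d = 0 := by rw [dotProduct_comm, e7]
  have e9 : (p.Cᵀ *ᵥ (R *ᵥ u)) ⬝ᵥ d = ζ ⬝ᵥ u := by rw [dotProduct_comm, e5]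
  unfold lyapDeriv
  rw [← hζ]
  have k1 : ζ ⬝ᵥ u = v ⬝ᵥ p.J *ᵥ (N *ᵥ ζ) + 2 / p.kp * (ζ ⬝ᵥ a) := by
    rw [hu, dotProduct_add, e6, dotProduct_smul, smul_eq_mul]
  simp only [Matrix.mulVec_add, Matrix.mulVec_sub, dotProduct_add, add_dotProduct, dotProduct_sub,
    sub_dotProduct, Matrix.mulVec_smul, dotProduct_smul, smul_dotProduct, smul_eq_mul, e1, e2, e3,
    e4, e5, e7, e8, e9, k1]
  have q1 : p.kp ≠ 0 := hkp.ne'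
  have q2 : p.kI ≠ 0 := hkI.ne'
  have c1 : v ⬝ᵥ a = a ⬝ᵥ v := dotProduct_comm _ _
  have c2 : ζ ⬝ᵥ a = a ⬝ᵥ ζ := dotProduct_comm _ _
  have c3 : r₃ ⬝ᵥ d = d ⬝ᵥ r₃ := dotProduct_comm _ _
  rw [c1, c2, c3]
  field_simp
  ring

theorem exists_mulVec_bound {k l : ℕ} (A : Matrix (Fin k) (Fin l) ℝ) :
    ∃ L : ℝ, ∀ L' ≥ L, ∀ v, ‖A *ᵥ v‖ ≤ L' * ‖v‖ :=
  ⟨l * ‖A‖, fun L' hL' v => (A.norm_mulVec_le_card v).trans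
    (by rw [Fintype.card_fin]; gcongr)⟩

set_option maxHeartbeats 2000000 in
/-- The form `lyap` is a strict Lyapunov function, uniformly in the attitude and robustly under
small perturbations of the linearised error dynamics. -/
theorem exists_strict_lyap {N Ni : Matrix (Fin 3) (Fin 3) ℝ} (hJ : p.J.PosDef)
    (hS : p.Sᵀ = -p.S) (hobs : p.Observable) (hN : Nᵀ = N) (hNi : N * Ni = 1)
    (hkp : 0 < p.kp) (hkI : 0 < p.kI) (hkD : 0 < p.kD) (ρ : ℝ) :
    ∃ (B : Matrix (Fin m) (Fin m) ℝ) (ε μ : ℝ), ∃ c > 0, ∃ κ > 0, ∃ K > 0,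
      (∀ R : Matrix (Fin 3) (Fin 3) ℝ, ‖R‖ ≤ 1 → ∀ a v d,
        -(1 / p.kp) * (a ⬝ᵥ Ni *ᵥ a) + c * (‖v‖ ^ 2 + ‖d‖ ^ 2) ≤ p.lyap N Ni B ε μ R a v d ∧
        p.lyap N Ni B ε μ R a v d ≤
          -(1 / p.kp) * (a ⬝ᵥ Ni *ᵥ a) + K * (‖v‖ ^ 2 + ‖d‖ ^ 2)) ∧
      ∀ R : Matrix (Fin 3) (Fin 3) ℝ, R * Rᵀ = 1 → ∀ Ω : Fin 3 → ℝ, ‖Ω‖ ≤ ρ →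
        ∀ a v d r₁ r₂ r₃, ‖r₁‖ ≤ κ * (‖a‖ + ‖v‖ + ‖d‖) → ‖r₂‖ ≤ κ * (‖a‖ + ‖v‖ + ‖d‖) →
        ‖r₃‖ ≤ κ * (‖a‖ + ‖v‖ + ‖d‖) →
        p.lyapDeriv N Ni B ε μ R (R * hat Ω) a v d
          (N *ᵥ (Rᵀ *ᵥ (p.C *ᵥ d) + a + v) + r₁)
          (p.J⁻¹ *ᵥ ((2 / p.kp) • a - p.kD • v) - N *ᵥ (Rᵀ *ᵥ (p.C *ᵥ d)) + r₂)
          (p.S *ᵥ d + p.kI • (p.Cᵀ *ᵥ (R *ᵥ (N *ᵥ (p.J *ᵥ v) + (2 / p.kp) • a))) + r₃) ≤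
        -c * (‖a‖ ^ 2 + ‖v‖ ^ 2 + ‖d‖ ^ 2) := by
  have hJt : p.Jᵀ = p.J := by simpa [Matrix.conjTranspose_eq_transpose_of_trivial] using hJ.1.eq
  have hJi : p.J * p.J⁻¹ = 1 := Matrix.mul_nonsing_inv _ (Matrix.isUnit_iff_isUnit_det _ |>.1 hJ.isUnit)
  have hNi' : Ni * N = 1 := mul_eq_one_comm.1 hNi
  obtain ⟨B, KB, hKB, hB⟩ := exists_observability_form p.S p.C hobs
  obtain ⟨j, hj, hjv⟩ := exists_norm_sq_le_of_pos (A := p.J) fun v hv => by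
    simpa using hJ.dotProduct_mulVec_pos hv
  obtain ⟨L₁, h₁⟩ := exists_mulVec_bound N
  obtain ⟨L₂, h₂⟩ := exists_mulVec_bound Ni
  obtain ⟨L₃, h₃⟩ := exists_mulVec_bound p.J
  obtain ⟨L₄, h₄⟩ := exists_mulVec_bound p.J⁻¹
  obtain ⟨L₅, h₅⟩ := exists_mulVec_bound p.S
  obtain ⟨L₆, h₆⟩ := exists_mulVec_bound p.C
  obtain ⟨L₇, h₇⟩ := exists_mulVec_bound p.Cᵀ
  obtain ⟨L₈, h₈⟩ := exists_mulVec_bound B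
  -- A single L ≥ 1 bounds all operators and constants, so that every estimate below costs a power
  -- of L; 4L⁹ dominates them all.
  obtain ⟨L, hL⟩ : ∃ L : ℝ, ∀ x ∈ ({L₁, L₂, L₃, L₄, L₅, L₆, L₇, L₈, 3, (m : ℝ), KB, p.kI, p.kD,
      1 / p.kp, 2 / p.kp, 1 / p.kI, ρ} : Finset ℝ), x ≤ L := Finset.exists_le _
  simp only [Finset.mem_insert, Finset.mem_singleton, forall_eq_or_imp, forall_eq] at hL
  obtain ⟨a₁, a₂, a₃, a₄, a₅, a₆, a₇, a₈, l3, lm, lB, lI, lD, lp, lp2, lI1, lρ⟩ := hL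
  replace h₁ := h₁ L a₁
  replace h₂ := h₂ L a₂
  replace h₃ := h₃ L a₃
  replace h₄ := h₄ L a₄
  replace h₅ := h₅ L a₅
  replace h₆ := h₆ L a₆
  replace h₇ := h₇ L a₇
  replace h₈ := h₈ L a₈
  have L1 : 1 ≤ L := by linarith
  have L0 : 0 < L := by linarith
  have hRb : ∀ R : Matrix (Fin 3) (Fin 3) ℝ, ‖R‖ ≤ 1 → ∀ v, ‖R *ᵥ v‖ ≤ L * ‖v‖ := fun R hR v => by
    refine (R.norm_mulVec_le_card v).trans ?_
    rw [Fintype.card_fin]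
    gcongr
    push_cast
    linarith
  have hd3 : ∀ u v : Fin 3 → ℝ, |u ⬝ᵥ v| ≤ L * ‖u‖ * ‖v‖ := fun u v => by
    refine (abs_dotProduct_le_card u v).trans ?_
    rw [Fintype.card_fin]
    gcongr
    exact_mod_cast l3
  have hdm : ∀ u v : Fin m → ℝ, |u ⬝ᵥ v| ≤ L * ‖u‖ * ‖v‖ := fun u v => by
    refine (abs_dotProduct_le_card u v).trans ?_
    rw [Fintype.card_fin]
    gcongr
  have pw : ∀ i j : ℕ, i ≤ j → L ^ i ≤ L ^ j := fun i j h => pow_le_pow_right₀ L1 h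
  set g : ℝ := min (2 / p.kp) p.kD with hg
  have hg0 : 0 < g := lt_min (by positivity) hkD
  set K : ℝ := 4 * L ^ 9 with hK
  have hK0 : 0 < K := by positivity
  obtain ⟨μ, hμ, hscal⟩ := strict_decrease_scalar (m := 1 / L ^ 2) hg0 (by positivity) hK0
  -- The diagonal part in (v, d) is coercive with constant s and the cross terms are bounded by G; ε
  -- ≤ s/(2G) keeps half of the coercivity.
  set s : ℝ := min (j / 2) (1 / (2 * p.kI)) with hs
  have hs0 : 0 < s := lt_min (by positivity) (by positivity)
  set G : ℝ := L ^ 4 + μ * L ^ 2 with hG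
  have hG0 : 0 < G := by positivity
  obtain ⟨ε, hε, hεle, κ, hκ, c, hc, hmain⟩ := hscal (s / (2 * G)) (by positivity)
  have hεG : ε * G ≤ s / 2 := by
    calc ε * G ≤ s / (2 * G) * G := by gcongr
      _ = s / 2 := by field_simp
  refine ⟨B, ε, μ, min c (s / 2), lt_min hc (by positivity), κ, hκ, L ^ 2 + L ^ 2 + s / 2,
    by positivity, ?_, ?_⟩
  · intro R hR a v d
    have hRt : ‖Rᵀ‖ ≤ 1 := by rwa [Matrix.norm_transpose]
    have b1 : |v ⬝ᵥ N *ᵥ (Rᵀ *ᵥ (p.C *ᵥ d)) + μ * (d ⬝ᵥ B *ᵥ d)| ≤ G * (‖v‖ ^ 2 + ‖d‖ ^ 2) := by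
      have i1 : |v ⬝ᵥ N *ᵥ (Rᵀ *ᵥ (p.C *ᵥ d))| ≤ L ^ 4 * (‖v‖ * ‖d‖) := by
        calc _ ≤ L * ‖v‖ * ‖N *ᵥ (Rᵀ *ᵥ (p.C *ᵥ d))‖ := hd3 _ _
          _ ≤ L * ‖v‖ * (L * (L * (L * ‖d‖))) := by
              gcongr
              refine (h₁ _).trans ?_
              gcongr
              refine (hRb _ hRt _).trans ?_
              gcongr
              exact h₆ d
          _ = _ := by ring
      have i2 : |d ⬝ᵥ B *ᵥ d| ≤ L ^ 2 * ‖d‖ ^ 2 := by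
        calc _ ≤ L * ‖d‖ * ‖B *ᵥ d‖ := hdm _ _
          _ ≤ L * ‖d‖ * (L * ‖d‖) := by gcongr; exact h₈ d
          _ = _ := by ring
      calc _ ≤ |v ⬝ᵥ N *ᵥ (Rᵀ *ᵥ (p.C *ᵥ d))| + μ * |d ⬝ᵥ B *ᵥ d| := by
            refine (abs_add_le _ _).trans_eq ?_
            rw [abs_mul, abs_of_pos hμ]
        _ ≤ L ^ 4 * (‖v‖ ^ 2 + ‖d‖ ^ 2) + μ * (L ^ 2 * (‖v‖ ^ 2 + ‖d‖ ^ 2)) := by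
            gcongr
            · refine i1.trans ?_
              gcongr
              linarith [two_mul_le_add_sq ‖v‖ ‖d‖, mul_nonneg (norm_nonneg v) (norm_nonneg d)]
            · refine i2.trans ?_
              gcongr
              linarith [sq_nonneg ‖v‖]
        _ = _ := by rw [hG]; ring
    have b2 : |ε * (v ⬝ᵥ N *ᵥ (Rᵀ *ᵥ (p.C *ᵥ d)) + μ * (d ⬝ᵥ B *ᵥ d))| ≤
        s / 2 * (‖v‖ ^ 2 + ‖d‖ ^ 2) := by
      rw [abs_mul, abs_of_pos hε]
      calc _ ≤ ε * (G * (‖v‖ ^ 2 + ‖d‖ ^ 2)) := by gcongr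
        _ = ε * G * (‖v‖ ^ 2 + ‖d‖ ^ 2) := by ring
        _ ≤ _ := by gcongr
    obtain ⟨b3, b4⟩ := abs_le.1 b2
    have b5 : s * ‖v‖ ^ 2 ≤ 1 / 2 * (v ⬝ᵥ p.J *ᵥ v) := by
      calc s * ‖v‖ ^ 2 ≤ j / 2 * ‖v‖ ^ 2 := by gcongr; exact min_le_left _ _
        _ ≤ _ := by linarith [hjv v]
    have b6 : s * ‖d‖ ^ 2 ≤ 1 / (2 * p.kI) * (d ⬝ᵥ d) := by
      calc s * ‖d‖ ^ 2 ≤ 1 / (2 * p.kI) * ‖d‖ ^ 2 := by gcongr; exact min_le_right _ _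
        _ ≤ _ := by gcongr; exact sq_norm_le_dotProduct_self d
    have b7 : 1 / 2 * (v ⬝ᵥ p.J *ᵥ v) ≤ L ^ 2 * ‖v‖ ^ 2 := by
      have := (le_abs_self _).trans (hd3 v (p.J *ᵥ v))
      have h' : L * ‖v‖ * ‖p.J *ᵥ v‖ ≤ L * ‖v‖ * (L * ‖v‖) := by gcongr; exact h₃ v
      have : 0 ≤ L ^ 2 * ‖v‖ ^ 2 := by positivity
      linarith
    have b8 : 1 / (2 * p.kI) * (d ⬝ᵥ d) ≤ L ^ 2 * ‖d‖ ^ 2 := by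
      have q1 : d ⬝ᵥ d ≤ L * ‖d‖ * ‖d‖ := (le_abs_self _).trans (hdm d d)
      have q2 : 1 / (2 * p.kI) ≤ L := by
        refine le_trans ?_ lI1
        gcongr
        linarith
      calc _ ≤ L * (L * ‖d‖ * ‖d‖) := by
            gcongr
            exact (sq_nonneg _).trans (sq_norm_le_dotProduct_self d)
        _ = _ := by ring
    have b9 : 0 ≤ L ^ 2 * ‖v‖ ^ 2 := by positivity
    have b10 : 0 ≤ L ^ 2 * ‖d‖ ^ 2 := by positivity
    have b11 : min c (s / 2) * (‖v‖ ^ 2 + ‖d‖ ^ 2) ≤ s / 2 * (‖v‖ ^ 2 + ‖d‖ ^ 2) := by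
      gcongr; exact min_le_right _ _
    unfold lyap
    constructor <;> linarith
  · intro R hR Ω hΩ a v d r₁ r₂ r₃ hr₁ hr₂ hr₃
    have hRn : ‖R‖ ≤ 1 := Matrix.norm_le_one_of_mul_transpose hR
    have hRt : ‖Rᵀ‖ ≤ 1 := by rwa [Matrix.norm_transpose]
    rw [p.lyapDeriv_eq B ε μ hJt hJi hS hN hNi hkp hkI]
    set ζ := Rᵀ *ᵥ (p.C *ᵥ d) with hζ
    set x := p.J⁻¹ *ᵥ ((2 / p.kp) • a - p.kD • v) with hx
    set y := p.kI • (p.Cᵀ *ᵥ (R *ᵥ (N *ᵥ (p.J *ᵥ v) + (2 / p.kp) • a))) with hy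
    have A0 := norm_nonneg a
    have V0 := norm_nonneg v
    have D0 := norm_nonneg d
    have H0 := norm_nonneg ζ
    set n := ‖a‖ + ‖v‖ + ‖d‖ with hn
    have n0 : 0 ≤ n := by positivity
    have κn : 0 ≤ κ * n := by positivity
    have hH : ‖ζ‖ ≤ L ^ 2 * ‖d‖ := by
      calc ‖ζ‖ ≤ L * ‖p.C *ᵥ d‖ := hRb _ hRt _
        _ ≤ L * (L * ‖d‖) := by gcongr; exact h₆ d
        _ = _ := by ring
    have hxb : ‖x‖ ≤ L ^ 2 * (‖a‖ + ‖v‖) := by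
      calc ‖x‖ ≤ L * ‖(2 / p.kp) • a - p.kD • v‖ := h₄ _
        _ ≤ L * (L * ‖a‖ + L * ‖v‖) := by
            gcongr
            refine (norm_sub_le _ _).trans ?_
            rw [norm_smul, norm_smul, Real.norm_of_nonneg hkD.le,
              Real.norm_of_nonneg (by positivity)]
            gcongr
        _ = _ := by ring
    have hyb : ‖y‖ ≤ L ^ 5 * (‖a‖ + ‖v‖) := by
      have q : ‖N *ᵥ (p.J *ᵥ v) + (2 / p.kp) • a‖ ≤ L ^ 2 * (‖a‖ + ‖v‖) := by
        calc _ ≤ L * (L * ‖v‖) + L * ‖a‖ := by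
              refine (norm_add_le _ _).trans ?_
              rw [norm_smul, Real.norm_of_nonneg (by positivity : 0 ≤ 2 / p.kp)]
              gcongr
              refine (h₁ _).trans ?_
              gcongr
              exact h₃ v
          _ ≤ L * (L * ‖v‖) + L * (L * ‖a‖) := by
              gcongr
              nlinarith
          _ = _ := by ring
      calc ‖y‖ = p.kI * ‖p.Cᵀ *ᵥ (R *ᵥ (N *ᵥ (p.J *ᵥ v) + (2 / p.kp) • a))‖ := by
            rw [hy, norm_smul, Real.norm_of_nonneg hkI.le]
        _ ≤ L * (L * (L * (L ^ 2 * (‖a‖ + ‖v‖)))) := by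
            gcongr
            refine (h₇ _).trans ?_
            gcongr
            refine (hRb _ hRn _).trans ?_
            gcongr
        _ = _ := by ring
    have p29 := pw 2 9 (by norm_num)
    have p39 := pw 3 9 (by norm_num)
    have p49 := pw 4 9 (by norm_num)
    have p79 := pw 7 9 (by norm_num)
    -- the remainder of the main part
    have m1 : -(1 / p.kp) * (r₁ ⬝ᵥ Ni *ᵥ a + a ⬝ᵥ Ni *ᵥ r₁) + v ⬝ᵥ p.J *ᵥ r₂
        + 1 / p.kI * (d ⬝ᵥ r₃) ≤ K * κ * n ^ 2 := by
      have i1 : |r₁ ⬝ᵥ Ni *ᵥ a| ≤ L ^ 2 * (κ * n) * n := by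
        calc _ ≤ L * ‖r₁‖ * ‖Ni *ᵥ a‖ := hd3 _ _
          _ ≤ L * (κ * n) * (L * n) := by
              gcongr
              refine (h₂ a).trans ?_
              gcongr; linarith
          _ = _ := by ring
      have i2 : |a ⬝ᵥ Ni *ᵥ r₁| ≤ L ^ 2 * (κ * n) * n := by
        calc _ ≤ L * ‖a‖ * ‖Ni *ᵥ r₁‖ := hd3 _ _
          _ ≤ L * n * (L * (κ * n)) := by
              gcongr
              · linarith
              refine (h₂ _).trans ?_
              gcongr
          _ = _ := by ring
      have i3 : |v ⬝ᵥ p.J *ᵥ r₂| ≤ L ^ 2 * (κ * n) * n := by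
        calc _ ≤ L * ‖v‖ * ‖p.J *ᵥ r₂‖ := hd3 _ _
          _ ≤ L * n * (L * (κ * n)) := by
              gcongr
              · linarith
              refine (h₃ _).trans ?_
              gcongr
          _ = _ := by ring
      have i4 : |d ⬝ᵥ r₃| ≤ L * (κ * n) * n := by
        calc _ ≤ L * ‖d‖ * ‖r₃‖ := hdm _ _
          _ ≤ L * n * (κ * n) := by
              gcongr
              linarith
          _ = _ := by ring
      have i5 : -(1 / p.kp) * (r₁ ⬝ᵥ Ni *ᵥ a + a ⬝ᵥ Ni *ᵥ r₁) ≤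
          L * (2 * (L ^ 2 * (κ * n) * n)) := by
        refine (le_abs_self _).trans ?_
        rw [abs_mul, abs_neg, abs_of_pos (by positivity : 0 < 1 / p.kp)]
        gcongr
        refine (abs_add_le _ _).trans ?_
        linarith
      have i6 : 1 / p.kI * (d ⬝ᵥ r₃) ≤ L * (L * (κ * n) * n) := by
        refine (le_abs_self _).trans ?_
        rw [abs_mul, abs_of_pos (by positivity : 0 < 1 / p.kI)]
        gcongr
      have i7 := (le_abs_self _).trans i3
      have i8 : 0 ≤ κ * n * n := by positivity
      calc _ ≤ 2 * L ^ 3 * (κ * n * n) + L ^ 2 * (κ * n * n) + L ^ 2 * (κ * n * n) := by linarith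
        _ ≤ 2 * L ^ 9 * (κ * n * n) + L ^ 9 * (κ * n * n) + L ^ 9 * (κ * n * n) := by gcongr
        _ = _ := by rw [hK]; ring
    have m2 : (x + r₂) ⬝ᵥ N *ᵥ ζ - (N *ᵥ ζ) ⬝ᵥ (N *ᵥ ζ) ≤
        -(1 / L ^ 2) * ‖ζ‖ ^ 2 + K * (‖a‖ + ‖v‖ + κ * n) * ‖ζ‖ := by
      have i1 : (x + r₂) ⬝ᵥ N *ᵥ ζ ≤ K * (‖a‖ + ‖v‖ + κ * n) * ‖ζ‖ := by
        calc _ ≤ L * ‖x + r₂‖ * ‖N *ᵥ ζ‖ := (le_abs_self _).trans (hd3 _ _)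
          _ ≤ L * (L ^ 2 * (‖a‖ + ‖v‖ + κ * n)) * (L * ‖ζ‖) := by
              gcongr
              · refine (norm_add_le _ _).trans ?_
                have : 1 * (κ * n) ≤ L ^ 2 * (κ * n) := by
                  gcongr; exact one_le_pow₀ L1
                linarith
              · exact h₁ ζ
          _ = L ^ 4 * (‖a‖ + ‖v‖ + κ * n) * ‖ζ‖ := by ring
          _ ≤ _ := by
              gcongr
              have := pow_pos L0 9
              linarith
      have i2 : 1 / L ^ 2 * ‖ζ‖ ^ 2 ≤ (N *ᵥ ζ) ⬝ᵥ (N *ᵥ ζ) := by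
        have q : ‖ζ‖ ≤ L * ‖N *ᵥ ζ‖ := by
          have := h₂ (N *ᵥ ζ)
          rwa [Matrix.mulVec_mulVec, hNi', Matrix.one_mulVec] at this
        calc 1 / L ^ 2 * ‖ζ‖ ^ 2 ≤ 1 / L ^ 2 * (L * ‖N *ᵥ ζ‖) ^ 2 := by gcongr
          _ = ‖N *ᵥ ζ‖ ^ 2 := by field_simp
          _ ≤ _ := sq_norm_le_dotProduct_self _
      linarith
    have m3 : v ⬝ᵥ N *ᵥ ((R * hat Ω)ᵀ *ᵥ (p.C *ᵥ d) + Rᵀ *ᵥ (p.C *ᵥ (p.S *ᵥ d + y + r₃))) ≤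
        K * ‖v‖ * (‖d‖ + ‖a‖ + ‖v‖ + κ * n) := by
      have i1 : ‖(R * hat Ω)ᵀ *ᵥ (p.C *ᵥ d)‖ ≤ L ^ 4 * ‖d‖ := by
        rw [Matrix.transpose_mul, ← Matrix.mulVec_mulVec, ← hζ, hat_transpose, Matrix.neg_mulVec,
          hat_mulVec, norm_neg]
        calc _ ≤ 3 * ‖Ω‖ * ‖ζ‖ := norm_cross_le _ _
          _ ≤ L * L * (L ^ 2 * ‖d‖) := by
              gcongr
              linarith
          _ = _ := by ring
      have i2 : ‖p.S *ᵥ d + y + r₃‖ ≤ L ^ 5 * (‖d‖ + ‖a‖ + ‖v‖ + κ * n) := by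
        have q1 : ‖p.S *ᵥ d‖ ≤ L ^ 5 * ‖d‖ := by
          refine (h₅ d).trans ?_
          gcongr
          calc L = L ^ 1 := by ring
            _ ≤ L ^ 5 := pw 1 5 (by norm_num)
        have q2 : 1 * (κ * n) ≤ L ^ 5 * (κ * n) := by
          gcongr; exact one_le_pow₀ L1
        have := (norm_add_le (p.S *ᵥ d + y) r₃).trans (add_le_add_left (norm_add_le _ _) _)
        linarith
      calc _ ≤ L * ‖v‖ * ‖N *ᵥ ((R * hat Ω)ᵀ *ᵥ (p.C *ᵥ d) +
              Rᵀ *ᵥ (p.C *ᵥ (p.S *ᵥ d + y + r₃)))‖ := (le_abs_self _).trans (hd3 _ _)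
        _ ≤ L * ‖v‖ * (L * (L ^ 4 * ‖d‖ +
              L * (L * (L ^ 5 * (‖d‖ + ‖a‖ + ‖v‖ + κ * n))))) := by
            gcongr
            refine (h₁ _).trans ?_
            gcongr
            refine (norm_add_le _ _).trans ?_
            gcongr
            refine (hRb _ hRt _).trans ?_
            gcongr
            refine (h₆ _).trans ?_
            gcongr
        _ ≤ L * ‖v‖ * (L * (L ^ 7 * (‖d‖ + ‖a‖ + ‖v‖ + κ * n) +
              L * (L * (L ^ 5 * (‖d‖ + ‖a‖ + ‖v‖ + κ * n))))) := by
            gcongr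
            · norm_num
            · linarith
        _ = 2 * L ^ 9 * ‖v‖ * (‖d‖ + ‖a‖ + ‖v‖ + κ * n) := by ring
        _ ≤ _ := by
            gcongr
            have := pow_pos L0 9
            linarith
    have m4 : (p.S *ᵥ d) ⬝ᵥ (B *ᵥ d) + d ⬝ᵥ (B *ᵥ (p.S *ᵥ d)) + (y + r₃) ⬝ᵥ (B *ᵥ d)
        + d ⬝ᵥ B *ᵥ (y + r₃) ≤
        -‖d‖ ^ 2 + K * ‖ζ‖ ^ 2 + K * ‖d‖ * (‖a‖ + ‖v‖ + κ * n) := by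
      have i1 : ‖y + r₃‖ ≤ L ^ 5 * (‖a‖ + ‖v‖ + κ * n) := by
        have q2 : 1 * (κ * n) ≤ L ^ 5 * (κ * n) := by
          gcongr; exact one_le_pow₀ L1
        have := norm_add_le y r₃
        linarith
      have i2 : (y + r₃) ⬝ᵥ (B *ᵥ d) ≤ L ^ 7 * ‖d‖ * (‖a‖ + ‖v‖ + κ * n) := by
        calc _ ≤ L * ‖y + r₃‖ * ‖B *ᵥ d‖ := (le_abs_self _).trans (hdm _ _)
          _ ≤ L * (L ^ 5 * (‖a‖ + ‖v‖ + κ * n)) * (L * ‖d‖) := by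
              gcongr; exact h₈ d
          _ = _ := by ring
      have i3 : d ⬝ᵥ B *ᵥ (y + r₃) ≤ L ^ 7 * ‖d‖ * (‖a‖ + ‖v‖ + κ * n) := by
        calc _ ≤ L * ‖d‖ * ‖B *ᵥ (y + r₃)‖ := (le_abs_self _).trans (hdm _ _)
          _ ≤ L * ‖d‖ * (L * (L ^ 5 * (‖a‖ + ‖v‖ + κ * n))) := by
              gcongr
              refine (h₈ _).trans ?_
              gcongr
          _ = _ := by ring
      -- Orthogonality of R makes the Euclidean lengths of Cd and ζ equal, so observability through
      -- C can be read off ζ.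
      have i4 : p.C *ᵥ d ⬝ᵥ p.C *ᵥ d = ζ ⬝ᵥ ζ := by
        rw [hζ]
        generalize p.C *ᵥ d = w
        rw [Matrix.dotProduct_mulVec (Rᵀ *ᵥ w) Rᵀ w, Matrix.vecMul_transpose,
          Matrix.mulVec_mulVec, hR, Matrix.one_mulVec]
      have i5 : KB * (ζ ⬝ᵥ ζ) ≤ K * ‖ζ‖ ^ 2 := by
        calc KB * (ζ ⬝ᵥ ζ) ≤ L * (L * ‖ζ‖ * ‖ζ‖) := by
              gcongr
              · exact (sq_nonneg _).trans (sq_norm_le_dotProduct_self ζ)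
              · exact (le_abs_self _).trans (hd3 _ _)
          _ = L ^ 2 * ‖ζ‖ ^ 2 := by ring
          _ ≤ _ := by
              gcongr
              have := pow_pos L0 9
              linarith
      have i6 := hB d
      rw [i4] at i6
      have i7 := sq_norm_le_dotProduct_self d
      have i8 : 2 * (L ^ 7 * ‖d‖ * (‖a‖ + ‖v‖ + κ * n)) ≤ K * ‖d‖ * (‖a‖ + ‖v‖ + κ * n) := by
        calc _ = 2 * L ^ 7 * ‖d‖ * (‖a‖ + ‖v‖ + κ * n) := by ring
          _ ≤ _ := by
              gcongr
              have := pow_pos L0 9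
              linarith
      linarith
    have m5 : -(2 / p.kp) * (a ⬝ᵥ a) - p.kD * (v ⬝ᵥ v) ≤ -g * (‖a‖ ^ 2 + ‖v‖ ^ 2) := by
      have q1 : g * ‖a‖ ^ 2 ≤ 2 / p.kp * (a ⬝ᵥ a) := by
        gcongr
        · exact min_le_left _ _
        · exact sq_norm_le_dotProduct_self a
      have q2 : g * ‖v‖ ^ 2 ≤ p.kD * (v ⬝ᵥ v) := by
        gcongr
        · exact min_le_right _ _
        · exact sq_norm_le_dotProduct_self v
      linarith
    have hH' : ‖ζ‖ ≤ K * ‖d‖ := by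
      refine hH.trans ?_
      gcongr
      have := pow_pos L0 9
      linarith
    have fin := hmain ‖a‖ ‖v‖ ‖d‖ ‖ζ‖ A0 V0 D0 H0 hH'
    rw [← hn] at fin
    have m4' := mul_le_mul_of_nonneg_left m4 hμ.le
    have tot := mul_le_mul_of_nonneg_left (add_le_add (add_le_add m2 m3) m4') hε.le
    have cfin : -c * (‖a‖ ^ 2 + ‖v‖ ^ 2 + ‖d‖ ^ 2) ≤
        -min c (s / 2) * (‖a‖ ^ 2 + ‖v‖ ^ 2 + ‖d‖ ^ 2) := by
      gcongr
      exact min_le_left _ _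
    linarith

end TrackingData

/-! ### The attitude error, its gain and the critical attitudes. -/

theorem hat_cross (u v : Fin 3 → ℝ) :
    hat (u ⨯₃ v) = Matrix.vecMulVec v u - Matrix.vecMulVec u v := by
  ext i j
  fin_cases i <;> fin_cases j <;> simp [hat, cross_apply, Matrix.vecMulVec_apply] <;> ring

theorem hat_sum {ι : Type*} (s : Finset ι) (f : ι → Fin 3 → ℝ) :
    hat (∑ i ∈ s, f i) = ∑ i ∈ s, hat (f i) := by
  classical
  induction s using Finset.induction_on with
  | empty => ext i j; fin_cases i <;> fin_cases j <;> simp [hat]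
  | insert a s ha ih => rw [Finset.sum_insert ha, Finset.sum_insert ha, hat_add, ih]

theorem hat_zero : hat 0 = 0 := by
  ext i j; fin_cases i <;> fin_cases j <;> simp [hat]

namespace TrackingData

variable {m ν : ℕ} (p : TrackingData m ν)

/-- The velocity correction `α` as a function of the attitude error `P = Rᵀ R_d X_rᵀ`. -/
noncomputable def attErr (P : Matrix (Fin 3) (Fin 3) ℝ) : Fin 3 → ℝ :=
  (p.kp / 2) • ∑ i, p.yr i ⨯₃ (P *ᵥ p.yr i)

/-- The matrix through which the attitude error velocity drives `attErr`. -/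
noncomputable def attGain (P : Matrix (Fin 3) (Fin 3) ℝ) : Matrix (Fin 3) (Fin 3) ℝ :=
  P * p.Y - (P * p.Y).trace • 1

theorem Y_transpose : p.Yᵀ = p.Y := by
  simp [Y, Matrix.transpose_sum, Matrix.transpose_vecMulVec]

theorem mul_Y (P : Matrix (Fin 3) (Fin 3) ℝ) :
    P * p.Y = (p.kp / 2) • ∑ i, Matrix.vecMulVec (P *ᵥ p.yr i) (p.yr i) := by
  simp [Y, Matrix.mul_sum, Matrix.mul_vecMulVec]

/-- Since (u × w)_× = w uᵀ − u wᵀ, the attitude error is the axial vector of PY − (PY)ᵀ; it vanishes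
exactly when PY is symmetric. -/
theorem hat_attErr (P : Matrix (Fin 3) (Fin 3) ℝ) :
    hat (p.attErr P) = P * p.Y - (P * p.Y)ᵀ := by
  rw [mul_Y, attErr, hat_smul, hat_sum]
  simp [Matrix.transpose_sum, Matrix.transpose_vecMulVec, hat_cross, smul_sub]

theorem attErr_one : p.attErr 1 = 0 := by
  simp [attErr]

theorem attErr_sub (P P' : Matrix (Fin 3) (Fin 3) ℝ) :
    p.attErr (P - P') = p.attErr P - p.attErr P' := by
  simp [attErr, Matrix.sub_mulVec, smul_sub]

/-- From u_× w_× = w uᵀ − (w·u) I. This identifies the sum that occurs in the torque and in β with a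
matrix whose spectrum can be read off PY. -/
theorem attGain_eq (P : Matrix (Fin 3) (Fin 3) ℝ) :
    p.attGain P = (p.kp / 2) • ∑ i, hat (p.yr i) * hat (P *ᵥ p.yr i) := by
  have h : ∀ u v : Fin 3 → ℝ, hat u * hat v = Matrix.vecMulVec v u - (v ⬝ᵥ u) • 1 := fun u v => by
    ext i j
    fin_cases i <;> fin_cases j <;>
      simp [hat, Matrix.vecMulVec_apply, Matrix.mul_apply, Fin.sum_univ_three, dotProduct] <;> ring
  rw [attGain, mul_Y]
  simp [h, smul_sub, Matrix.trace_sum, Matrix.trace_vecMulVec]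
  rw [← Finset.sum_smul, smul_smul]

/-- `attErr` moves with velocity `attGain P ξ` when the attitude moves with velocity `-ξ_× P`. -/
theorem attErr_hat_mul (P : Matrix (Fin 3) (Fin 3) ℝ) (ξ : Fin 3 → ℝ) :
    p.attErr (-(hat ξ) * P) = p.attGain P *ᵥ ξ := by
  rw [attGain_eq, attErr, Matrix.smul_mulVec, Matrix.sum_mulVec]
  congr 1
  refine Finset.sum_congr rfl fun i _ => ?_
  rw [← Matrix.mulVec_mulVec, ← Matrix.mulVec_mulVec, Matrix.neg_mulVec, hat_mulVec, hat_mulVec,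
    hat_mulVec, cross_anticomm]

/-- Three distinct eigenvalues use up the three indices of the list of eigenvalues of a symmetric
matrix, so the list is injective. It is nonnegative because Y is a nonnegative combination of
squares y yᵀ. -/
theorem exists_diagonalization_Y (hkp : 0 < p.kp) (hY : p.MeasurementAssumption) :
    ∃ (U : Matrix (Fin 3) (Fin 3) ℝ) (l : Fin 3 → ℝ), U * Uᵀ = 1 ∧ Uᵀ * U = 1 ∧
      p.Y = U * Matrix.diagonal l * Uᵀ ∧ Function.Injective l ∧ ∀ i, 0 ≤ l i := by
  obtain ⟨-, a, b, c, hab, hbc, ha, hb, hc⟩ := hY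
  have hH : p.Y.IsHermitian := by
    rw [Matrix.IsHermitian, Matrix.conjTranspose_eq_transpose_of_trivial, Y_transpose]
  have hmem : ∀ x, Module.End.HasEigenvalue (Matrix.toLin' p.Y) x → ∃ i, hH.eigenvalues i = x := by
    intro x hx
    have := hx.mem_spectrum
    rw [Matrix.spectrum_toLin', hH.spectrum_real_eq_range_eigenvalues] at this
    exact this
  obtain ⟨i, hi⟩ := hmem a ha
  obtain ⟨j, hj⟩ := hmem b hb
  obtain ⟨k, hk⟩ := hmem c hc
  have hU := hH.eigenvectorUnitary.2
  set U : Matrix (Fin 3) (Fin 3) ℝ := hH.eigenvectorUnitary.1 with hUdef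
  have hst : star U = Uᵀ := by
    rw [Matrix.star_eq_conjTranspose, Matrix.conjTranspose_eq_transpose_of_trivial]
  have hU1 : U * Uᵀ = 1 := by rw [← hst]; exact (Matrix.mem_unitaryGroup_iff).1 hU
  have hU2 : Uᵀ * U = 1 := mul_eq_one_comm.1 hU1
  have hYU : p.Y = U * Matrix.diagonal hH.eigenvalues * Uᵀ := by
    have := hH.spectral_theorem
    rw [Unitary.conjStarAlgAut_apply] at this
    refine this.trans ?_
    rw [← hst]
    rfl
  refine ⟨U, hH.eigenvalues, hU1, hU2, hYU, ?_, ?_⟩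
  · have hij : i ≠ j := by rintro rfl; linarith
    have hjk : j ≠ k := by rintro rfl; linarith
    have hik : i ≠ k := by rintro rfl; linarith
    have hcov : ∀ x, x = i ∨ x = j ∨ x = k := by
      clear hi hj hk
      revert i j k
      decide
    intro x y hxy
    rcases hcov x with rfl | rfl | rfl <;> rcases hcov y with rfl | rfl | rfl <;>
      first
      | rfl
      | (exfalso; linarith)
  · intro i
    have h1 : Uᵀ * p.Y * U = Matrix.diagonal hH.eigenvalues := by
      calc Uᵀ * p.Y * U = Uᵀ * (U * Matrix.diagonal hH.eigenvalues * Uᵀ) * U :=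
            congrArg (fun M => Uᵀ * M * U) hYU
        _ = (Uᵀ * U) * Matrix.diagonal hH.eigenvalues * (Uᵀ * U) := by
            simp only [Matrix.mul_assoc]
        _ = _ := by rw [hU2, Matrix.one_mul, Matrix.mul_one]
    have h2 := congrFun (congrFun h1 i) i
    rw [Matrix.diagonal_apply_eq] at h2
    rw [← h2, Y]
    simp only [Matrix.mul_smul, Matrix.smul_mul, Matrix.mul_sum, Matrix.sum_mul,
      Matrix.mul_vecMulVec, Matrix.vecMulVec_mul, Matrix.smul_apply, Matrix.sum_apply,
      Matrix.vecMulVec_apply, smul_eq_mul]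
    refine mul_nonneg (by positivity) (Finset.sum_nonneg fun j _ => ?_)
    rw [← Matrix.mulVec_transpose]
    exact mul_self_nonneg _

/-- In an eigenbasis of Y write Λ for Y and Q for P. Symmetry of QΛ and orthogonality of Q make Q
commute with Λ², whose entries are distinct since those of Λ are distinct and nonnegative. So Q is
diagonal with entries s_i = ±1 of product 1: the identity or a half turn. The gain is diagonal in
the same basis, with entries minus the sum of the other two s_j l_j. For the identity these are
−(l_j + l_k) < 0, as at most one l vanishes. For the half turn with axis k, the entry at k is l_i +
l_j > 0 and the other two are differences of distinct eigenvalues. -/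
theorem critical_attitude (hkp : 0 < p.kp) (hY : p.MeasurementAssumption)
    {P : Matrix (Fin 3) (Fin 3) ℝ} (hP : P * Pᵀ = 1) (hdet : P.det = 1) (hcrit : p.attErr P = 0) :
    (p.attGain P)ᵀ = p.attGain P ∧ IsUnit (p.attGain P).det ∧
      (P = 1 → ∀ v, v ≠ 0 → v ⬝ᵥ p.attGain P *ᵥ v < 0) ∧
      (P ≠ 1 → ∃ (u : Fin 3 → ℝ) (τ : ℝ), u ≠ 0 ∧ 0 < τ ∧ p.attGain P *ᵥ u = τ • u) := by
  obtain ⟨U, l, hU1, hU2, hYU, hinj, hl⟩ := p.exists_diagonalization_Y hkp hY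
  have hsym : (P * p.Y)ᵀ = P * p.Y := by
    have := p.hat_attErr P
    rw [hcrit, hat_zero] at this
    exact (sub_eq_zero.1 this.symm).symm
  set Λ := Matrix.diagonal l with hΛ
  set Q := Uᵀ * P * U with hQ
  have hPQ : P = U * Q * Uᵀ := by
    calc P = (U * Uᵀ) * P * (U * Uᵀ) := by rw [hU1, Matrix.one_mul, Matrix.mul_one]
      _ = _ := by rw [hQ]; simp only [Matrix.mul_assoc]
  have hQQ : Q * Qᵀ = 1 := by
    calc Q * Qᵀ = Uᵀ * (P * ((U * Uᵀ) * Pᵀ)) * U := by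
          rw [hQ]; simp only [Matrix.transpose_mul, Matrix.transpose_transpose, Matrix.mul_assoc]
      _ = 1 := by rw [hU1, Matrix.one_mul, hP, Matrix.mul_one, hU2]
  have hQQ' : Qᵀ * Q = 1 := mul_eq_one_comm.1 hQQ
  have hdU : U.det * U.det = 1 := by
    have := congrArg Matrix.det hU1
    rwa [Matrix.det_mul, Matrix.det_transpose, Matrix.det_one] at this
  have hdQ : Q.det = 1 := by
    rw [hQ, Matrix.det_mul, Matrix.det_mul, Matrix.det_transpose, hdet, mul_one, hdU]
  have hPY : P * p.Y = U * (Q * Λ) * Uᵀ := by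
    rw [hPQ, hYU]
    calc U * Q * Uᵀ * (U * Λ * Uᵀ) = U * Q * (Uᵀ * U) * Λ * Uᵀ := by
          simp only [Matrix.mul_assoc]
      _ = _ := by rw [hU2, Matrix.mul_one]; simp only [Matrix.mul_assoc]
  have hΛt : Λᵀ = Λ := Matrix.diagonal_transpose _
  have hS : Λ * Qᵀ = Q * Λ := by
    have h1 : Uᵀ * (P * p.Y) * U = Q * Λ := by
      rw [hPY]
      calc Uᵀ * (U * (Q * Λ) * Uᵀ) * U = (Uᵀ * U) * (Q * Λ) * (Uᵀ * U) := by
            simp only [Matrix.mul_assoc]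
        _ = _ := by rw [hU2, Matrix.one_mul, Matrix.mul_one]
    have h2 : (Uᵀ * (P * p.Y) * U)ᵀ = Uᵀ * (P * p.Y) * U := by
      rw [Matrix.transpose_mul, Matrix.transpose_mul, Matrix.transpose_transpose, hsym,
        ← Matrix.mul_assoc]
    rw [h1, Matrix.transpose_mul, hΛt] at h2
    exact h2
  have hS2 : Λ * Q = Qᵀ * Λ := by
    calc Λ * Q = Qᵀ * Q * Λ * Q := by rw [hQQ', Matrix.one_mul]
      _ = Qᵀ * (Q * Λ) * Q := by simp only [Matrix.mul_assoc]
      _ = Qᵀ * Λ * (Qᵀ * Q) := by rw [← hS]; simp only [Matrix.mul_assoc]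
      _ = _ := by rw [hQQ', Matrix.mul_one]
  have hcomm : Q * (Λ * Λ) = Λ * Λ * Q := by
    calc Q * (Λ * Λ) = Q * Λ * Λ := (Matrix.mul_assoc Q Λ Λ).symm
      _ = Λ * (Qᵀ * Λ) := by rw [← hS, Matrix.mul_assoc Λ Qᵀ Λ]
      _ = _ := by rw [← hS2, Matrix.mul_assoc Λ Λ Q]
  have hoff : ∀ i j, i ≠ j → Q i j = 0 := by
    intro i j hij
    have h := congrFun (congrFun hcomm i) j
    rw [hΛ, Matrix.diagonal_mul_diagonal, Matrix.mul_diagonal, Matrix.diagonal_mul] at h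
    by_contra hne
    have h2 : l j * l j = l i * l i := by
      have : Q i j * (l j * l j - l i * l i) = 0 := by linarith
      rcases mul_eq_zero.1 this with h | h
      · exact absurd h hne
      · linarith
    exact hij (hinj ((mul_self_inj (hl j) (hl i)).1 h2).symm)
  obtain ⟨s, hs⟩ : ∃ s : Fin 3 → ℝ, Q = Matrix.diagonal s := ⟨fun i => Q i i, by
    ext i j
    by_cases h : i = j
    · subst h; simp
    · rw [Matrix.diagonal_apply_ne _ h, hoff i j h]⟩
  have hs1 : ∀ i, s i = 1 ∨ s i = -1 := by
    intro i
    have h := congrFun (congrFun hQQ i) i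
    rw [hs, Matrix.diagonal_transpose, Matrix.diagonal_mul_diagonal, Matrix.diagonal_apply_eq,
      Matrix.one_apply_eq] at h
    exact mul_self_eq_one_iff.1 h
  have hs3 : s 0 * s 1 * s 2 = 1 := by
    rw [hs, Matrix.det_diagonal, Fin.prod_univ_three] at hdQ
    exact hdQ
  set σ : ℝ := s 0 * l 0 + s 1 * l 1 + s 2 * l 2 with hσ
  set q : Fin 3 → ℝ := fun i => s i * l i - σ with hq
  have hG : p.attGain P = U * Matrix.diagonal q * Uᵀ := by
    have htr : (P * p.Y).trace = σ := by
      rw [hPY, Matrix.trace_mul_comm, ← Matrix.mul_assoc, hU2, Matrix.one_mul, hs, hΛ,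
        Matrix.diagonal_mul_diagonal, Matrix.trace_diagonal, Fin.sum_univ_three]
    rw [attGain, htr, hPY, hs, hΛ, Matrix.diagonal_mul_diagonal]
    have : Matrix.diagonal q = Matrix.diagonal (fun i => s i * l i) - σ • 1 := by
      rw [Matrix.smul_one_eq_diagonal, Matrix.diagonal_sub]
    rw [this, Matrix.mul_sub, Matrix.sub_mul, Matrix.mul_smul, Matrix.smul_mul, Matrix.mul_one, hU1]
  have l01 : l 0 ≠ l 1 := fun h => absurd (hinj h) (by decide)
  have l02 : l 0 ≠ l 2 := fun h => absurd (hinj h) (by decide)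
  have l12 : l 1 ≠ l 2 := fun h => absurd (hinj h) (by decide)
  have p01 : 0 < l 0 + l 1 := by
    rcases (hl 0).lt_or_eq with h | h
    · linarith [hl 1]
    · have := lt_of_le_of_ne (hl 1) (fun h' => l01 (h.symm.trans h')); linarith
  have p02 : 0 < l 0 + l 2 := by
    rcases (hl 0).lt_or_eq with h | h
    · linarith [hl 2]
    · have := lt_of_le_of_ne (hl 2) (fun h' => l02 (h.symm.trans h')); linarith
  have p12 : 0 < l 1 + l 2 := by
    rcases (hl 1).lt_or_eq with h | h
    · linarith [hl 2]
    · have := lt_of_le_of_ne (hl 2) (fun h' => l12 (h.symm.trans h')); linarith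
  have hqne : q 0 ≠ 0 ∧ q 1 ≠ 0 ∧ q 2 ≠ 0 := by
    have d01 := sub_ne_zero.2 l01
    have d02 := sub_ne_zero.2 l02
    have d12 := sub_ne_zero.2 l12
    simp only [hq, hσ]
    rcases hs1 0 with h0 | h0 <;> rcases hs1 1 with h1 | h1 <;> rcases hs1 2 with h2 | h2 <;>
      rw [h0, h1, h2] at hs3 ⊢ <;> first | (norm_num at hs3; done) | skip
    · exact ⟨by linarith, by linarith, by linarith⟩
    · exact ⟨by linarith, fun h => d02 (by linarith), fun h => d01 (by linarith)⟩
    · exact ⟨fun h => d12 (by linarith), by linarith, fun h => d01 (by linarith)⟩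
    · exact ⟨fun h => d12 (by linarith), fun h => d02 (by linarith), by linarith⟩
  refine ⟨?_, ?_, ?_, ?_⟩
  · rw [hG, Matrix.transpose_mul, Matrix.transpose_mul, Matrix.transpose_transpose,
      Matrix.diagonal_transpose, Matrix.mul_assoc]
  · rw [hG, Matrix.det_mul, Matrix.det_mul, Matrix.det_transpose, Matrix.det_diagonal,
      Fin.prod_univ_three, isUnit_iff_ne_zero]
    have : U.det ≠ 0 := fun h => by simp [h] at hdU
    exact mul_ne_zero (mul_ne_zero this (mul_ne_zero (mul_ne_zero hqne.1 hqne.2.1) hqne.2.2)) this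
  · intro hP1 v hv
    have hQ1 : Q = 1 := by rw [hQ, hP1, Matrix.mul_one, hU2]
    have hs' : ∀ i, s i = 1 := fun i => by
      have := congrFun (congrFun (hs.symm.trans hQ1) i) i
      simpa using this
    have hqneg : ∀ i, q i < 0 := by
      intro i
      fin_cases i <;> simp [hq, hσ, hs'] <;> linarith
    set w := Uᵀ *ᵥ v with hw
    have hwne : w ≠ 0 := fun h => hv (by
      calc v = U *ᵥ w := by rw [hw, Matrix.mulVec_mulVec, hU1, Matrix.one_mulVec]
        _ = 0 := by rw [h, Matrix.mulVec_zero])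
    have e : v ⬝ᵥ p.attGain P *ᵥ v = ∑ i, q i * (w i * w i) := by
      rw [hG, ← Matrix.mulVec_mulVec, ← Matrix.mulVec_mulVec, Matrix.dotProduct_mulVec,
        ← Matrix.mulVec_transpose, ← hw, dotProduct]
      refine Finset.sum_congr rfl fun i _ => ?_
      rw [Matrix.mulVec_diagonal]
      ring
    rw [e]
    obtain ⟨i, hi⟩ := Function.ne_iff.1 hwne
    refine Finset.sum_neg' (fun j _ => mul_nonpos_of_nonpos_of_nonneg (hqneg j).le
      (mul_self_nonneg _)) ⟨i, Finset.mem_univ _, mul_neg_of_neg_of_pos (hqneg i)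
      (mul_self_pos.2 hi)⟩
  · intro hP1
    have key : ∀ k, 0 < q k → ∃ (u : Fin 3 → ℝ) (τ : ℝ), u ≠ 0 ∧ 0 < τ ∧ p.attGain P *ᵥ u = τ • u := by
      intro k hk
      refine ⟨U *ᵥ Pi.single k 1, q k, fun h => ?_, hk, ?_⟩
      · have h' := congrArg (Uᵀ *ᵥ ·) h
        simp only [Matrix.mulVec_mulVec, hU2, Matrix.one_mulVec, Matrix.mulVec_zero] at h'
        have := congrFun h' k
        simp at this
      · rw [hG, Matrix.mulVec_mulVec, Matrix.mul_assoc, hU2, Matrix.mul_one,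
          ← Matrix.mulVec_mulVec, Matrix.diagonal_mulVec_single, mul_one, ← Matrix.mulVec_smul,
          ← Pi.single_smul, smul_eq_mul, mul_one]
    rcases hs1 0 with h0 | h0 <;> rcases hs1 1 with h1 | h1 <;> rcases hs1 2 with h2 | h2 <;>
      rw [h0, h1, h2] at hs3 <;> first | (norm_num at hs3; done) | skip
    · exfalso
      apply hP1
      have : s = fun _ => 1 := by ext i; fin_cases i <;> assumption
      rw [hPQ, hs, this, Matrix.diagonal_one, Matrix.mul_one, hU1]
    · exact key 0 (by simp only [hq, hσ, h0, h1, h2]; linarith)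
    · exact key 1 (by simp only [hq, hσ, h0, h1, h2]; linarith)
    · exact key 2 (by simp only [hq, hσ, h0, h1, h2]; linarith)

end TrackingData

/-! ### Error coordinates on the state space and their dynamics. -/

namespace SO3

theorem mul_transpose_self (A : SO3) :
    (A : Matrix (Fin 3) (Fin 3) ℝ) * (A : Matrix (Fin 3) (Fin 3) ℝ)ᵀ = 1 :=
  (Matrix.mem_orthogonalGroup_iff _ _).1 (Matrix.mem_specialOrthogonalGroup_iff.1 A.2).1

theorem transpose_mul_self (A : SO3) :
    (A : Matrix (Fin 3) (Fin 3) ℝ)ᵀ * (A : Matrix (Fin 3) (Fin 3) ℝ) = 1 :=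
  mul_eq_one_comm.1 A.mul_transpose_self

theorem det_eq_one (A : SO3) : (A : Matrix (Fin 3) (Fin 3) ℝ).det = 1 :=
  (Matrix.mem_specialOrthogonalGroup_iff.1 A.2).2

theorem norm_le_one (A : SO3) : ‖(A : Matrix (Fin 3) (Fin 3) ℝ)‖ ≤ 1 :=
  Matrix.norm_le_one_of_mul_transpose A.mul_transpose_self

/-- The pseudometric underlying the metric of `SO(3)`. -/
noncomputable abbrev pseudoMetricSpace : PseudoMetricSpace SO3 :=
  SO3.instMetricSpace.toPseudoMetricSpace

attribute [local instance] pseudoMetricSpace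

theorem dist_eq (A B : SO3) : dist A B =
    ‖(A : Matrix (Fin 3) (Fin 3) ℝ) - (B : Matrix (Fin 3) (Fin 3) ℝ)‖ := by
  rw [← dist_eq_norm]; rfl

end SO3

namespace BodyState

variable {m : ℕ} (z : BodyState m)

theorem R_mul_transpose : z.R * z.Rᵀ = 1 := SO3.mul_transpose_self z.1

theorem transpose_mul_R : z.Rᵀ * z.R = 1 := SO3.transpose_mul_self z.1

theorem Rd_mul_transpose : z.Rd * z.Rdᵀ = 1 := SO3.mul_transpose_self z.2.1

theorem det_R : z.R.det = 1 := SO3.det_eq_one z.1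

theorem det_Rd : z.Rd.det = 1 := SO3.det_eq_one z.2.1

end BodyState

namespace TrackingData

variable {m ν : ℕ} (p : TrackingData m ν)

/-- The attitude error `P = Rᵀ R_d X_rᵀ`. -/
def attP (z : BodyState m) : Matrix (Fin 3) (Fin 3) ℝ :=
  z.Rᵀ * z.Rd * (p.Xr : Matrix (Fin 3) (Fin 3) ℝ)ᵀ

/-- The error velocity `ξ = Rᵀ C (δ - w) + α + Ω̃`, which equals `Ω - Rᵀ °Ω_d`. -/
noncomputable def errVel (z : BodyState m) : Fin 3 → ℝ :=
  z.Rᵀ *ᵥ (p.C *ᵥ (z.δ - z.w)) + p.attErr (p.attP z) + p.Ωtilde z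

theorem attP_mul_transpose (z : BodyState m) : p.attP z * (p.attP z)ᵀ = 1 := by
  have h1 := p.Xr.transpose_mul_self
  calc p.attP z * (p.attP z)ᵀ = z.Rᵀ * (z.Rd * (((p.Xr : Matrix (Fin 3) (Fin 3) ℝ)ᵀ *
        (p.Xr : Matrix (Fin 3) (Fin 3) ℝ)) * z.Rdᵀ)) * z.R := by
        rw [attP]
        simp only [Matrix.transpose_mul, Matrix.transpose_transpose, Matrix.mul_assoc]
    _ = 1 := by
        rw [h1, Matrix.one_mul, z.Rd_mul_transpose, Matrix.mul_one, z.transpose_mul_R]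

theorem det_attP (z : BodyState m) : (p.attP z).det = 1 := by
  rw [attP, Matrix.det_mul, Matrix.det_mul, Matrix.det_transpose, Matrix.det_transpose, z.det_R,
    z.det_Rd, p.Xr.det_eq_one]
  norm_num

theorem y_eq (z : BodyState m) (i : Fin ν) : p.y z i = p.attP z *ᵥ p.yr i := by
  rw [y, yr, attP, Matrix.mulVec_mulVec, Matrix.mul_assoc, Matrix.mul_assoc,
    p.Xr.transpose_mul_self, Matrix.mul_one]

theorem yr_sub_err (z : BodyState m) (i : Fin ν) :
    p.yr i - p.err z i = p.attP z *ᵥ p.yr i := by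
  rw [err, sub_sub_cancel, y_eq]

theorem err_cross (z : BodyState m) (i : Fin ν) :
    p.err z i ⨯₃ p.yr i = p.yr i ⨯₃ (p.attP z *ᵥ p.yr i) := by
  rw [err, y_eq, map_sub, LinearMap.sub_apply, cross_self, zero_sub, cross_anticomm]

theorem α_eq (z : BodyState m) : p.α z = p.attErr (p.attP z) := by
  simp only [α, attErr, err_cross]

theorem sum_err_cross (hkp : 0 < p.kp) (z : BodyState m) :
    ∑ i, p.err z i ⨯₃ p.yr i = (2 / p.kp) • p.attErr (p.attP z) := by
  simp only [attErr, err_cross, smul_smul]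
  rw [div_mul_div_cancel₀' (by norm_num), div_self hkp.ne', one_smul]

theorem Ωc_eq (z : BodyState m) : p.Ωc z = z.Rᵀ *ᵥ p.Δ z + p.attErr (p.attP z) := by
  rw [Ωc, ← α_eq]; rfl

theorem errVel_eq (z : BodyState m) : p.errVel z = z.Ω - z.Rᵀ *ᵥ p.Ωd z := by
  rw [errVel, Ωtilde, Ωc_eq, Δ, Ωd, Matrix.mulVec_sub, Matrix.mulVec_sub]
  abel

theorem attErr_smul (c : ℝ) (P : Matrix (Fin 3) (Fin 3) ℝ) :
    p.attErr (c • P) = c • p.attErr P := by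
  simp only [attErr, Matrix.smul_mulVec, map_smul, ← Finset.smul_sum]
  rw [smul_comm]

theorem sum_hat_mul_hat (z : BodyState m) (u : Fin 3 → ℝ) :
    (p.kp / 2) • ∑ i, (hat (p.yr i) * hat (p.yr i - p.err z i)) *ᵥ u =
      p.attGain (p.attP z) *ᵥ u := by
  simp only [attGain_eq, yr_sub_err, Matrix.smul_mulVec, Matrix.sum_mulVec]

theorem β_eq (hkp : 0 < p.kp) (hJ : p.Jᵀ = p.J) (z : BodyState m) :
    p.β z = (p.kI / 2) • (z.R *ᵥ ((p.attGain (p.attP z))ᵀ *ᵥ (p.J *ᵥ p.Ωtilde z)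
      + (2 / p.kp) • p.attErr (p.attP z))) := by
  have h1 : (p.attGain (p.attP z))ᵀ =
      (p.kp / 2) • ∑ i, hat (p.attP z *ᵥ p.yr i) * hat (p.yr i) := by
    rw [attGain_eq]
    simp [Matrix.transpose_sum, Matrix.transpose_mul, hat_transpose]
  have h2 : z.R *ᵥ (p.attGain (p.attP z))ᵀ *ᵥ p.J *ᵥ p.Ωtilde z =
      (p.kp / 2) • ∑ i, (z.R * hat (p.attP z *ᵥ p.yr i) * hat (p.yr i) * p.J) *ᵥ p.Ωtilde z := by
    rw [h1, Matrix.smul_mulVec, Matrix.mulVec_smul, Matrix.sum_mulVec, Matrix.mulVec_sum]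
    simp only [Matrix.mulVec_mulVec, Matrix.mul_assoc]
  rw [β, ← sum_err_cross p hkp, Matrix.mulVec_add, h2, Finset.sum_add_distrib, Finset.smul_sum,
    Matrix.mulVec_sum, hJ]
  simp only [yr_sub_err]

/-- The factor 2 of the Gram matrix cancels the ½ in front of k_I. -/
theorem δdot_eq (hkp : 0 < p.kp) (hJ : p.Jᵀ = p.J) (z : BodyState m) :
    p.δdot z = p.S *ᵥ z.δ + p.kI • (p.Cᵀ *ᵥ (z.R *ᵥ ((p.attGain (p.attP z))ᵀ *ᵥ
      (p.J *ᵥ p.Ωtilde z) + (2 / p.kp) • p.attErr (p.attP z)))) := by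
  rw [δdot, gramSO3_eq, β_eq p hkp hJ, Matrix.smul_mulVec, Matrix.one_mulVec, smul_smul,
    Matrix.mulVec_smul]
  congr 2
  ring

/-- The angular acceleration of the closed loop. -/
noncomputable def angAcc (z : BodyState m) : Fin 3 → ℝ :=
  p.J⁻¹ *ᵥ (-(z.Ω ⨯₃ (p.J *ᵥ z.Ω)) + p.Γ z)

theorem angAcc_eq (hkp : 0 < p.kp) (hJi : p.J⁻¹ * p.J = 1) (z : BodyState m) :
    p.angAcc z = -(z.Ω ⨯₃ (z.Rᵀ *ᵥ p.Δ z)) + z.Rᵀ *ᵥ (p.C *ᵥ p.δdot z)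
      + p.attGain (p.attP z) *ᵥ (p.attErr (p.attP z) + p.Ωtilde z)
      + p.J⁻¹ *ᵥ ((2 / p.kp) • p.attErr (p.attP z) - p.kD • p.Ωtilde z) := by
  have e : ∀ u, p.J⁻¹ *ᵥ (p.J *ᵥ u) = u := fun u => by
    rw [Matrix.mulVec_mulVec, hJi, Matrix.one_mulVec]
  rw [angAcc, Γ, sum_hat_mul_hat, sum_err_cross p hkp, α_eq]
  simp only [Matrix.mulVec_add, Matrix.mulVec_sub, Matrix.mulVec_neg, e]
  abel

/-- Curves that follow the closed loop at the time-dependent speed `c`. -/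
def IsScaledSolution (c : ℝ → ℝ) (z : ℝ → BodyState m) : Prop :=
  ∀ t ∈ Set.Ici (0 : ℝ),
    HasDerivWithinAt (fun s => (z s).R) (c t • ((z t).R * hat (z t).Ω)) (Set.Ici 0) t ∧
    HasDerivWithinAt (fun s => (z s).Rd) (c t • (hat (p.Ωd (z t)) * (z t).Rd)) (Set.Ici 0) t ∧
    HasDerivWithinAt (fun s => (z s).δ) (c t • p.δdot (z t)) (Set.Ici 0) t ∧
    HasDerivWithinAt (fun s => (z s).w) (c t • (p.S *ᵥ (z t).w)) (Set.Ici 0) t ∧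
    HasDerivWithinAt (fun s => (z s).Ω) (c t • p.angAcc (z t)) (Set.Ici 0) t

/-- Unit speed and J invertible give back the closed loop. A general speed is admitted because
solutions of a truncated field move at the speed of the cutoff, and the same computations are needed
for them. -/
theorem mem_solutions_iff (hJi : p.J⁻¹ * p.J = 1) (z : ℝ → BodyState m) :
    z ∈ p.solutions ↔ p.IsScaledSolution (fun _ => 1) z := by
  refine forall₂_congr fun t ht => ?_
  simp only [one_smul, hasDerivWithinAt_matrix]
  refine and_congr_right fun _ => and_congr_right fun _ => and_congr_right fun _ =>
    and_congr_right fun _ => ⟨?_, fun h => ⟨_, h, ?_⟩⟩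
  · rintro ⟨a, ha, h⟩
    convert ha using 1
    rw [angAcc, ← h, Matrix.mulVec_mulVec, hJi, Matrix.one_mulVec]
  · rw [angAcc, Matrix.mulVec_mulVec, mul_eq_one_comm.1 hJi, Matrix.one_mulVec]

namespace IsScaledSolution

variable {p} {c : ℝ → ℝ} {z : ℝ → BodyState m} (hz : p.IsScaledSolution c z)
include hz

/-- Conjugation by R carries the reference velocity to the body frame, where the two angular
velocities subtract; P turns with their difference. -/
theorem hasDeriv_attP {t : ℝ} (ht : t ∈ Set.Ici (0 : ℝ)) :
    HasDerivWithinAt (fun s => p.attP (z s)) (c t • (-(hat (p.errVel (z t))) * p.attP (z t)))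
      (Set.Ici 0) t := by
  obtain ⟨hR, hRd, -, -, -⟩ := hz t ht
  have h := (hR.matrix_transpose.matrix_mul hRd).matrix_mul
    (hasDerivWithinAt_const t (Set.Ici 0) (p.Xr : Matrix (Fin 3) (Fin 3) ℝ)ᵀ)
  refine h.congr_deriv ?_
  have e1 : (z t).Rᵀ * (hat (p.Ωd (z t)) * (z t).Rd) =
      hat ((z t).Rᵀ *ᵥ p.Ωd (z t)) * ((z t).Rᵀ * (z t).Rd) := by
    have h1 := mul_hat_mul_transpose (R := (z t).Rᵀ) (by
      rw [Matrix.transpose_transpose]; exact (z t).transpose_mul_R)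
      (by rw [Matrix.det_transpose]; exact (z t).det_R) (p.Ωd (z t))
    rw [Matrix.transpose_transpose] at h1
    rw [← h1]
    calc _ = (z t).Rᵀ * (hat (p.Ωd (z t)) * (((z t).R * (z t).Rᵀ) * (z t).Rd)) := by
          rw [(z t).R_mul_transpose, Matrix.one_mul]
      _ = _ := by simp only [Matrix.mul_assoc]
  rw [errVel_eq, hat_sub, Matrix.mul_smul, e1, Matrix.transpose_smul, Matrix.transpose_mul,
    hat_transpose, Matrix.mul_zero, add_zero, Matrix.smul_mul, ← smul_add, Matrix.smul_mul, attP]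
  congr 1
  simp only [Matrix.neg_mul, neg_sub, Matrix.sub_mul, Matrix.add_mul, Matrix.mul_assoc]
  abel

theorem hasDeriv_attErr {t : ℝ} (ht : t ∈ Set.Ici (0 : ℝ)) :
    HasDerivWithinAt (fun s => p.attErr (p.attP (z s)))
      (c t • (p.attGain (p.attP (z t)) *ᵥ p.errVel (z t))) (Set.Ici 0) t := by
  have hP := hz.hasDeriv_attP ht
  have h := HasDerivWithinAt.fun_sum (u := Finset.univ) fun i _ =>
    (hasDerivWithinAt_const t (Set.Ici (0 : ℝ)) (p.yr i)).cross
      (hP.matrix_mulVec (hasDerivWithinAt_const t (Set.Ici (0 : ℝ)) (p.yr i)))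
  refine (h.const_smul (p.kp / 2)).congr_deriv ?_
  rw [← attErr_hat_mul, ← attErr_smul, attErr]
  simp

/-- The torque feeds forward the derivatives of RᵀΔ and of α, except for the part of α' that
contains C(δ − w), since w is not available to the controller. This missing part is the term −Mζ. -/
theorem hasDeriv_Ωtilde (hkp : 0 < p.kp) (hJi : p.J⁻¹ * p.J = 1) {t : ℝ}
    (ht : t ∈ Set.Ici (0 : ℝ)) :
    HasDerivWithinAt (fun s => p.Ωtilde (z s))
      (c t • (p.J⁻¹ *ᵥ ((2 / p.kp) • p.attErr (p.attP (z t)) - p.kD • p.Ωtilde (z t))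
        - p.attGain (p.attP (z t)) *ᵥ ((z t).Rᵀ *ᵥ (p.C *ᵥ ((z t).δ - (z t).w)))))
      (Set.Ici 0) t := by
  obtain ⟨hR, -, hδ, -, hΩ⟩ := hz t ht
  have h := hΩ.sub ((hR.matrix_transpose.matrix_mulVec (hδ.const_mulVec p.C)).add
    (hz.hasDeriv_attErr ht))
  have h' := h.congr_of_mem (f₁ := fun s => p.Ωtilde (z s)) (fun s _ => by
    rw [Ωtilde, Ωc_eq]
    rfl) ht
  refine h'.congr_deriv ?_
  rw [angAcc_eq p hkp hJi, errVel, Matrix.transpose_smul, Matrix.transpose_mul, hat_transpose,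
    Matrix.smul_mulVec, Matrix.mulVec_smul, Matrix.mulVec_smul, ← Matrix.mulVec_mulVec,
    Matrix.neg_mulVec, hat_mulVec, ← smul_add, ← smul_add, ← smul_sub]
  congr 1
  simp only [Matrix.mulVec_add, Δ]
  abel

theorem hasDeriv_regErr (hkp : 0 < p.kp) (hJ : p.Jᵀ = p.J) {t : ℝ} (ht : t ∈ Set.Ici (0 : ℝ)) :
    HasDerivWithinAt (fun s => (z s).δ - (z s).w)
      (c t • (p.S *ᵥ ((z t).δ - (z t).w) + p.kI • (p.Cᵀ *ᵥ ((z t).R *ᵥ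
        ((p.attGain (p.attP (z t)))ᵀ *ᵥ (p.J *ᵥ p.Ωtilde (z t))
          + (2 / p.kp) • p.attErr (p.attP (z t))))))) (Set.Ici 0) t := by
  obtain ⟨-, -, hδ, hw, -⟩ := hz t ht
  refine (hδ.sub hw).congr_deriv ?_
  rw [δdot_eq p hkp hJ, ← smul_sub, Matrix.mulVec_sub]
  congr 1
  abel

end IsScaledSolution

/-! ### The energy and its dissipation. -/

/-- The attitude part of the Lyapunov function. -/
noncomputable def attPot (P : Matrix (Fin 3) (Fin 3) ℝ) : ℝ :=
  1 / 2 * ∑ i, (p.yr i - P *ᵥ p.yr i) ⬝ᵥ (p.yr i - P *ᵥ p.yr i)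

/-- The Lyapunov function of the closed loop. -/
noncomputable def energy (z : BodyState m) : ℝ :=
  p.attPot (p.attP z) + 1 / 2 * (p.Ωtilde z ⬝ᵥ p.J *ᵥ p.Ωtilde z)
    + 1 / (2 * p.kI) * ((z.δ - z.w) ⬝ᵥ (z.δ - z.w))

theorem attPot_nonneg (P : Matrix (Fin 3) (Fin 3) ℝ) : 0 ≤ p.attPot P :=
  mul_nonneg (by norm_num) (Finset.sum_nonneg fun _ _ =>
    Finset.sum_nonneg fun _ _ => mul_self_nonneg _)

/-- The innovation β is designed so that d contributes ζ·(Mᵀ J v + (2/k_p) a), which cancels −v·JMζ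
from v' and −(2/k_p) ζ·a from the potential. The two products a·v cancel as well, and S drops out by
skewness, leaving the damping of a and v. -/
theorem IsScaledSolution.hasDeriv_energy {p : TrackingData m ν} {c : ℝ → ℝ} {z : ℝ → BodyState m}
    (hz : p.IsScaledSolution c z) (hkp : 0 < p.kp) (hkI : 0 < p.kI) (hJ : p.Jᵀ = p.J)
    (hJi : p.J⁻¹ * p.J = 1) (hS : p.Sᵀ = -p.S) {t : ℝ} (ht : t ∈ Set.Ici (0 : ℝ)) :
    HasDerivWithinAt (fun s => p.energy (z s))
      (c t * (-(2 / p.kp) * (p.attErr (p.attP (z t)) ⬝ᵥ p.attErr (p.attP (z t)))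
        - p.kD * (p.Ωtilde (z t) ⬝ᵥ p.Ωtilde (z t)))) (Set.Ici 0) t := by
  have hP := hz.hasDeriv_attP ht
  have hv := hz.hasDeriv_Ωtilde hkp hJi ht
  have hd := hz.hasDeriv_regErr hkp hJ ht
  have he : ∀ i, HasDerivWithinAt (fun s => p.yr i - p.attP (z s) *ᵥ p.yr i)
      (c t • (p.errVel (z t) ⨯₃ (p.attP (z t) *ᵥ p.yr i))) (Set.Ici 0) t := fun i => by
    have := (hasDerivWithinAt_const t (Set.Ici (0 : ℝ)) (p.yr i)).sub
      (hP.matrix_mulVec (hasDerivWithinAt_const t (Set.Ici (0 : ℝ)) (p.yr i)))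
    refine this.congr_deriv ?_
    rw [Matrix.mulVec_zero, add_zero, zero_sub, Matrix.smul_mulVec, ← smul_neg,
      ← Matrix.mulVec_mulVec, Matrix.neg_mulVec, neg_neg, hat_mulVec]
  have h := (((HasDerivWithinAt.fun_sum (u := Finset.univ) fun i _ =>
    (he i).dotProduct (he i)).const_mul (1 / 2 : ℝ)).add
    ((hv.dotProduct (hv.const_mulVec p.J)).const_mul (1 / 2 : ℝ))).add
    ((hd.dotProduct hd).const_mul (1 / (2 * p.kI)))
  refine h.congr_deriv ?_
  set P := p.attP (z t)
  set a := p.attErr P with ha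
  set v := p.Ωtilde (z t) with hv
  set d := (z t).δ - (z t).w with hd
  set M := p.attGain P
  set ζ := (z t).Rᵀ *ᵥ (p.C *ᵥ d) with hζ
  set u := Mᵀ *ᵥ (p.J *ᵥ v) + (2 / p.kp) • a with hu
  have e1 : ∑ i, ((c t • (p.errVel (z t) ⨯₃ (P *ᵥ p.yr i))) ⬝ᵥ (p.yr i - P *ᵥ p.yr i) +
      (p.yr i - P *ᵥ p.yr i) ⬝ᵥ (c t • (p.errVel (z t) ⨯₃ (P *ᵥ p.yr i)))) =
      c t * (-(4 / p.kp) * (p.errVel (z t) ⬝ᵥ a)) := by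
    have : ∀ i, (c t • (p.errVel (z t) ⨯₃ (P *ᵥ p.yr i))) ⬝ᵥ (p.yr i - P *ᵥ p.yr i) +
      (p.yr i - P *ᵥ p.yr i) ⬝ᵥ (c t • (p.errVel (z t) ⨯₃ (P *ᵥ p.yr i))) =
      -(2 * c t) * (p.errVel (z t) ⬝ᵥ (p.yr i ⨯₃ (P *ᵥ p.yr i))) := fun i => by
      rw [dotProduct_comm (c t • _), dotProduct_smul, smul_eq_mul, sub_dotProduct, dot_cross_self,
        sub_zero, triple_product_permutation, ← cross_anticomm, dotProduct_neg]
      ring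
    simp only [this]
    rw [← Finset.mul_sum, ← dotProduct_sum, ha, attErr, dotProduct_smul, smul_eq_mul]
    field_simp
    ring
  have e2 : ∀ w, w ⬝ᵥ p.J *ᵥ v = v ⬝ᵥ p.J *ᵥ w := fun w => dotProduct_mulVec_comm hJ _ _
  have e3 : ∀ w, p.J *ᵥ (p.J⁻¹ *ᵥ w) = w := fun w => by
    rw [Matrix.mulVec_mulVec, mul_eq_one_comm.1 hJi, Matrix.one_mulVec]
  have e4 : d ⬝ᵥ p.Cᵀ *ᵥ ((z t).R *ᵥ u) = ζ ⬝ᵥ u := by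
    rw [hζ, Matrix.dotProduct_mulVec, Matrix.vecMul_transpose, Matrix.dotProduct_mulVec,
      Matrix.mulVec_transpose]
  have e5 : ζ ⬝ᵥ u = v ⬝ᵥ p.J *ᵥ (M *ᵥ ζ) + 2 / p.kp * (ζ ⬝ᵥ a) := by
    rw [hu, dotProduct_add, dotProduct_smul, smul_eq_mul, Matrix.dotProduct_mulVec,
      Matrix.vecMul_transpose, e2]
  have e6 : d ⬝ᵥ p.S *ᵥ d = 0 := dotProduct_mulVec_self_of_skew hS d
  have hξ : p.errVel (z t) = ζ + a + v := rfl
  rw [e1, hξ]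
  simp only [dotProduct_smul, smul_eq_mul, add_dotProduct, dotProduct_add, e2,
    dotProduct_comm _ d, e4, e6, Matrix.mulVec_smul, Matrix.mulVec_sub, dotProduct_sub, e3, e5]
  rw [dotProduct_comm v a]
  field_simp
  ring

end TrackingData

-- Global solutions and Gronwall bounds for bounded Lipschitz fields.

attribute [local instance] SO3.pseudoMetricSpace

section ODE

variable {E : Type*} [NormedAddCommGroup E] [NormedSpace ℝ E] {F : E → E} {K : NNReal}

theorem HasDerivWithinAt.prod_fst {G : Type*} [NormedAddCommGroup G] [NormedSpace ℝ G]
    {f : ℝ → E × G} {f' : E × G} {s : Set ℝ} {t : ℝ} (h : HasDerivWithinAt f f' s t) :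
    HasDerivWithinAt (fun τ => (f τ).1) f'.1 s t :=
  HasFDerivAt.comp_hasDerivWithinAt (f := f) t hasFDerivAt_fst h

theorem HasDerivWithinAt.prod_snd {G : Type*} [NormedAddCommGroup G] [NormedSpace ℝ G]
    {f : ℝ → E × G} {f' : E × G} {s : Set ℝ} {t : ℝ} (h : HasDerivWithinAt f f' s t) :
    HasDerivWithinAt (fun τ => (f τ).2) f'.2 s t :=
  HasFDerivAt.comp_hasDerivWithinAt (f := f) t hasFDerivAt_snd h

theorem eq_of_hasDerivWithinAt_zero {f : ℝ → E}
    (hf : ∀ t ∈ Set.Ici (0 : ℝ), HasDerivWithinAt f 0 (Set.Ici 0) t) {s t : ℝ}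
    (hs : s ∈ Set.Ici (0 : ℝ)) (ht : t ∈ Set.Ici (0 : ℝ)) : f s = f t := by
  have := (convex_Ici (0 : ℝ)).norm_image_sub_le_of_norm_hasDerivWithin_le (C := 0) hf
    (fun _ _ => by simp) ht hs
  rw [zero_mul] at this
  exact sub_eq_zero.1 (norm_le_zero_iff.1 this)

/-- For a field bounded by L, Picard–Lindelöf works on [−T, T] for every T with a ball of radius LT,
so no continuation argument is needed; uniqueness glues the windows. -/
theorem exists_global_solution [CompleteSpace E] (hF : LipschitzWith K F) {L : ℝ}
    (hL : ∀ x, ‖F x‖ ≤ L) (t₀ : ℝ) (x₀ : E) :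
    ∃ x : ℝ → E, x t₀ = x₀ ∧ ∀ t, HasDerivAt x (F (x t)) t := by
  have hL0 : 0 ≤ L := (norm_nonneg _).trans (hL x₀)
  have hloc : ∀ T : ℝ, 0 < T → ∃ x : ℝ → E, x 0 = x₀ ∧
      ∀ t ∈ Set.Ioo (-T) T, HasDerivAt x (F (x t)) t := by
    intro T hT
    have h0 : (0 : ℝ) ∈ Set.Icc (-T) T := ⟨by linarith, hT.le⟩
    have hP : IsPicardLindelof (fun _ => F) (⟨0, h0⟩ : Set.Icc (-T) T) x₀
        (⟨L * T, by positivity⟩ : NNReal) 0 ⟨L, hL0⟩ K :=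
      { lipschitzOnWith := fun _ _ => hF.lipschitzOnWith
        continuousOn := fun _ _ => continuousOn_const
        norm_le := fun _ _ x _ => hL x
        mul_max_le := by simp only [sub_zero, zero_sub, neg_neg, max_self, NNReal.coe_zero]; exact le_rfl }
    obtain ⟨x, hx0, hx⟩ := hP.exists_eq_forall_mem_Icc_hasDerivWithinAt₀
    exact ⟨x, hx0, fun t ht => (hx t ⟨ht.1.le, ht.2.le⟩).hasDerivAt (Icc_mem_nhds ht.1 ht.2)⟩
  have hglob : ∃ x : ℝ → E, x 0 = x₀ ∧ ∀ t, HasDerivAt x (F (x t)) t := by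
    choose! γ hγ0 hγ using hloc
    have huniq : ∀ T T' : ℝ, 0 < T → T ≤ T' → Set.EqOn (γ T) (γ T') (Set.Ioo (-T) T) := by
      intro T T' hT hTT'
      refine ODE_solution_unique_of_mem_Ioo (v := fun _ => F) (s := fun _ => Set.univ) (K := K)
        (t₀ := 0) (fun _ _ => hF.lipschitzOnWith) ⟨by linarith, hT⟩
        (fun t ht => ⟨hγ T hT t ht, trivial⟩)
        (fun t ht => ⟨hγ T' (hT.trans_le hTT') t ⟨by linarith [ht.1], by linarith [ht.2]⟩, trivial⟩)
        ?_
      rw [hγ0 T hT, hγ0 T' (hT.trans_le hTT')]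
    -- The value at t is read off the window of half-width |t| + 1; near t all these windows agree
    -- with the one of half-width |t| + 2.
    refine ⟨fun t => γ (|t| + 1) t, by simpa using hγ0 (|0| + 1) (by positivity), fun t => ?_⟩
    have hpos : 0 < |t| + 2 := by positivity
    have hmem : t ∈ Set.Ioo (-(|t| + 2)) (|t| + 2) :=
      abs_lt.1 (by linarith)
    have heq : (fun s => γ (|s| + 1) s) =ᶠ[𝓝 t] γ (|t| + 2) := by
      have : ∀ᶠ s in 𝓝 t, |s| < |t| + 1 :=
        (continuous_abs.tendsto t).eventually (gt_mem_nhds (by linarith))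
      filter_upwards [this] with s hs
      exact huniq (|s| + 1) (|t| + 2) (by positivity) (by linarith)
        (abs_lt.1 (by linarith))
    have h := (hγ (|t| + 2) hpos t hmem).congr_of_eventuallyEq heq
    rwa [← heq.self_of_nhds] at h
  obtain ⟨x, hx0, hx⟩ := hglob
  refine ⟨fun t => x (t - t₀), by simp [hx0], fun t => ?_⟩
  simpa using (hx (t - t₀)).comp_sub_const t t₀

theorem dist_le_exp_forward (hF : LipschitzWith K F) {x y : ℝ → E}
    (hx : ∀ t ∈ Set.Ici (0 : ℝ), HasDerivWithinAt x (F (x t)) (Set.Ici 0) t)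
    (hy : ∀ t ∈ Set.Ici (0 : ℝ), HasDerivWithinAt y (F (y t)) (Set.Ici 0) t) {t : ℝ} (ht : 0 ≤ t) :
    dist (x t) (y t) ≤ dist (x 0) (y 0) * Real.exp (K * t) := by
  have := dist_le_of_trajectories_ODE (v := fun _ => F) (a := 0) (b := t) (fun _ => hF)
    (fun s hs => (hx s hs.1).continuousWithinAt.mono Set.Icc_subset_Ici_self)
    (fun s hs => (hx s hs.1).mono (Set.Ici_subset_Ici.2 hs.1))
    (fun s hs => (hy s hs.1).continuousWithinAt.mono Set.Icc_subset_Ici_self)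
    (fun s hs => (hy s hs.1).mono (Set.Ici_subset_Ici.2 hs.1)) le_rfl t ⟨ht, le_rfl⟩
  simpa using this

/-- Gronwall's inequality for the reversed curves s ↦ u(t − s), which solve the equation with field
−F. -/
theorem dist_le_exp_backward (hF : LipschitzWith K F) {x y : ℝ → E}
    (hx : ∀ t ∈ Set.Ici (0 : ℝ), HasDerivWithinAt x (F (x t)) (Set.Ici 0) t)
    (hy : ∀ t ∈ Set.Ici (0 : ℝ), HasDerivWithinAt y (F (y t)) (Set.Ici 0) t) {t : ℝ} (ht : 0 ≤ t) :
    dist (x 0) (y 0) ≤ dist (x t) (y t) * Real.exp (K * t) := by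
  have key : ∀ u : ℝ → E, (∀ t ∈ Set.Ici (0 : ℝ), HasDerivWithinAt u (F (u t)) (Set.Ici 0) t) →
      ContinuousOn (fun s => u (t - s)) (Set.Icc 0 t) ∧
      ∀ s ∈ Set.Ico 0 t, HasDerivWithinAt (fun s => u (t - s)) (-F (u (t - s))) (Set.Ici s) s := by
    intro u hu
    constructor
    · refine ContinuousOn.comp (t := Set.Ici 0)
        (fun s hs => (hu s hs).continuousWithinAt) (by fun_prop) ?_
      intro s hs
      exact sub_nonneg.2 hs.2
    · intro s hs
      have hpos : 0 < t - s := sub_pos.2 hs.2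
      have h1 := (hu (t - s) hpos.le).hasDerivAt (Ici_mem_nhds hpos)
      exact (h1.comp_const_sub t s).hasDerivWithinAt
  have hF' : LipschitzWith K (fun x => -F x) := hF.neg
  have := dist_le_of_trajectories_ODE (v := fun _ x => -F x) (a := 0) (b := t) (fun _ => hF')
    (key x hx).1 (key x hx).2 (key y hy).1 (key y hy).2 le_rfl t ⟨ht, le_rfl⟩
  simpa using this

end ODE

/-! ### The closed loop as a smooth field on a Euclidean space. -/

section Smooth

variable {E : Type*} [NormedAddCommGroup E] [NormedSpace ℝ E] {r : WithTop ℕ∞}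
variable {k l n : ℕ}

theorem contDiff_matrix {A : E → Matrix (Fin k) (Fin l) ℝ} :
    ContDiff ℝ r A ↔ ∀ i j, ContDiff ℝ r (fun x => A x i j) :=
  contDiff_pi.trans (forall_congr' fun _ => contDiff_pi)

theorem ContDiff.matrix_mul {A : E → Matrix (Fin k) (Fin l) ℝ} {B : E → Matrix (Fin l) (Fin n) ℝ}
    (hA : ContDiff ℝ r A) (hB : ContDiff ℝ r B) : ContDiff ℝ r (fun x => A x * B x) := by
  refine contDiff_matrix.2 fun i j => ?_
  simp only [Matrix.mul_apply]
  exact ContDiff.sum fun q _ => (contDiff_matrix.1 hA i q).mul (contDiff_matrix.1 hB q j)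

theorem ContDiff.matrix_mulVec {A : E → Matrix (Fin k) (Fin l) ℝ} {v : E → Fin l → ℝ}
    (hA : ContDiff ℝ r A) (hv : ContDiff ℝ r v) : ContDiff ℝ r (fun x => A x *ᵥ v x) := by
  refine contDiff_pi.2 fun i => ?_
  simp only [Matrix.mulVec, dotProduct]
  exact ContDiff.sum fun q _ => (contDiff_matrix.1 hA i q).mul (contDiff_pi.1 hv q)

theorem ContDiff.matrix_transpose {A : E → Matrix (Fin k) (Fin l) ℝ}
    (hA : ContDiff ℝ r A) : ContDiff ℝ r (fun x => (A x)ᵀ) :=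
  contDiff_matrix.2 fun i j => contDiff_matrix.1 hA j i

theorem ContDiff.hat {v : E → Fin 3 → ℝ} (hv : ContDiff ℝ r v) :
    ContDiff ℝ r (fun x => hat (v x)) := by
  have h := contDiff_pi.1 hv
  refine contDiff_matrix.2 fun i j => ?_
  fin_cases i <;> fin_cases j <;> simp only [_root_.hat] <;>
    first
    | exact contDiff_const
    | exact h _
    | exact (h _).neg

theorem ContDiff.cross {u v : E → Fin 3 → ℝ} (hu : ContDiff ℝ r u) (hv : ContDiff ℝ r v) :
    ContDiff ℝ r (fun x => u x ⨯₃ v x) := by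
  simpa only [hat_mulVec] using hu.hat.matrix_mulVec hv

end Smooth

/-- The Euclidean space in which the state space of the closed loop is embedded. -/
abbrev AmbientState (m : ℕ) : Type :=
  Matrix (Fin 3) (Fin 3) ℝ × Matrix (Fin 3) (Fin 3) ℝ × (Fin m → ℝ) × (Fin m → ℝ) × (Fin 3 → ℝ)

/-- The inclusion of the state space in the ambient space. -/
def BodyState.toAmbient {m : ℕ} (z : BodyState m) : AmbientState m :=
  (z.R, z.Rd, z.δ, z.w, z.Ω)

theorem BodyState.isometry_toAmbient {m : ℕ} :
    Isometry (BodyState.toAmbient : BodyState m → AmbientState m) := by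
  refine Isometry.of_dist_eq fun x y => ?_
  simp only [Prod.dist_eq, toAmbient, R, Rd, δ, w, Ω]
  rw [SO3.dist_eq, SO3.dist_eq, dist_eq_norm, dist_eq_norm]

namespace TrackingData

variable {m ν : ℕ} (p : TrackingData m ν)

section Field

/-- The attitude error in the ambient space. -/
def ambP (x : AmbientState m) : Matrix (Fin 3) (Fin 3) ℝ :=
  x.1ᵀ * x.2.1 * (p.Xr : Matrix (Fin 3) (Fin 3) ℝ)ᵀ

/-- The velocity error in the ambient space. -/
noncomputable def ambV (x : AmbientState m) : Fin 3 → ℝ :=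
  x.2.2.2.2 - (x.1ᵀ *ᵥ (p.C *ᵥ x.2.2.1) + p.attErr (p.ambP x))

/-- The regulator field in the ambient space. -/
noncomputable def ambδ (x : AmbientState m) : Fin m → ℝ :=
  p.S *ᵥ x.2.2.1 + p.kI • (p.Cᵀ *ᵥ (x.1 *ᵥ ((p.attGain (p.ambP x))ᵀ *ᵥ
      (p.J *ᵥ p.ambV x) + (2 / p.kp) • p.attErr (p.ambP x))))

/-- The closed-loop vector field in the ambient space. -/
noncomputable def field (x : AmbientState m) : AmbientState m :=
  (x.1 * hat x.2.2.2.2, hat (p.C *ᵥ x.2.2.2.1) * x.2.1, p.ambδ x, p.S *ᵥ x.2.2.2.1,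
    -(x.2.2.2.2 ⨯₃ (x.1ᵀ *ᵥ (p.C *ᵥ x.2.2.1))) + x.1ᵀ *ᵥ (p.C *ᵥ p.ambδ x)
      + p.attGain (p.ambP x) *ᵥ (p.attErr (p.ambP x) + p.ambV x)
      + p.J⁻¹ *ᵥ ((2 / p.kp) • p.attErr (p.ambP x) - p.kD • p.ambV x))

theorem contDiff_field : ContDiff ℝ 1 p.field := by
  have hR : ContDiff ℝ 1 (fun x : AmbientState m => x.1) := contDiff_fst
  have hRd : ContDiff ℝ 1 (fun x : AmbientState m => x.2.1) := contDiff_fst.comp contDiff_snd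
  have hδ : ContDiff ℝ 1 (fun x : AmbientState m => x.2.2.1) :=
    contDiff_fst.comp (contDiff_snd.comp contDiff_snd)
  have hw : ContDiff ℝ 1 (fun x : AmbientState m => x.2.2.2.1) :=
    contDiff_fst.comp (contDiff_snd.comp (contDiff_snd.comp contDiff_snd))
  have hΩ : ContDiff ℝ 1 (fun x : AmbientState m => x.2.2.2.2) :=
    contDiff_snd.comp (contDiff_snd.comp (contDiff_snd.comp contDiff_snd))
  have hP : ContDiff ℝ 1 (p.ambP) := (hR.matrix_transpose.matrix_mul hRd).matrix_mul contDiff_const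
  have ha : ContDiff ℝ 1 (fun x : AmbientState m => p.attErr (p.ambP x)) := by
    unfold attErr
    exact ContDiff.const_smul _ (ContDiff.sum fun i _ =>
      contDiff_const.cross (hP.matrix_mulVec contDiff_const))
  have hG : ContDiff ℝ 1 (fun x : AmbientState m => p.attGain (p.ambP x)) := by
    simp only [attGain_eq]
    exact ContDiff.const_smul _ (ContDiff.sum fun i _ =>
      contDiff_const.matrix_mul (hP.matrix_mulVec contDiff_const).hat)
  have hRC : ContDiff ℝ 1 (fun x : AmbientState m => x.1ᵀ *ᵥ (p.C *ᵥ x.2.2.1)) :=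
    hR.matrix_transpose.matrix_mulVec (contDiff_const.matrix_mulVec hδ)
  have hV : ContDiff ℝ 1 (p.ambV) := hΩ.sub (hRC.add ha)
  have hδ' : ContDiff ℝ 1 (p.ambδ) :=
    (contDiff_const.matrix_mulVec hδ).add (ContDiff.const_smul _ (contDiff_const.matrix_mulVec
      (hR.matrix_mulVec ((hG.matrix_transpose.matrix_mulVec (contDiff_const.matrix_mulVec hV)).add
        (ContDiff.const_smul _ ha)))))
  exact (hR.matrix_mul hΩ.hat).prodMk (((contDiff_const.matrix_mulVec hw).hat.matrix_mul hRd).prodMk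
    (hδ'.prodMk ((contDiff_const.matrix_mulVec hw).prodMk
      ((((hΩ.cross hRC).neg.add (hR.matrix_transpose.matrix_mulVec
        (contDiff_const.matrix_mulVec hδ'))).add (hG.matrix_mulVec (ha.add hV))).add
        (contDiff_const.matrix_mulVec ((ContDiff.const_smul _ ha).sub (ContDiff.const_smul _ hV)))))))

theorem field_toAmbient (hkp : 0 < p.kp) (hJ : p.Jᵀ = p.J) (hJi : p.J⁻¹ * p.J = 1)
    (z : BodyState m) : p.field z.toAmbient =
      (z.R * hat z.Ω, hat (p.Ωd z) * z.Rd, p.δdot z, p.S *ᵥ z.w, p.angAcc z) := by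
  have hV : p.ambV z.toAmbient = p.Ωtilde z := by
    rw [Ωtilde, Ωc_eq]; rfl
  have hδ : p.ambδ z.toAmbient = p.δdot z := by
    rw [δdot_eq p hkp hJ, ← hV]; rfl
  rw [angAcc_eq p hkp hJi, ← hδ, ← hV]
  rfl

theorem isScaledSolution_iff (hkp : 0 < p.kp) (hJ : p.Jᵀ = p.J) (hJi : p.J⁻¹ * p.J = 1)
    (c : ℝ → ℝ) (z : ℝ → BodyState m) :
    p.IsScaledSolution c z ↔ ∀ t ∈ Set.Ici (0 : ℝ),
      HasDerivWithinAt (fun s => (z s).toAmbient) (c t • p.field (z t).toAmbient) (Set.Ici 0) t := by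
  refine forall₂_congr fun t ht => ?_
  rw [field_toAmbient p hkp hJ hJi]
  constructor
  · rintro ⟨h1, h2, h3, h4, h5⟩
    exact h1.prodMk (h2.prodMk (h3.prodMk (h4.prodMk h5)))
  · intro h
    exact ⟨h.prod_fst, h.prod_snd.prod_fst, h.prod_snd.prod_snd.prod_fst,
      h.prod_snd.prod_snd.prod_snd.prod_fst, h.prod_snd.prod_snd.prod_snd.prod_snd⟩

end Field

end TrackingData

/-! ### Invariance and compactness of the state space. -/

theorem Matrix.det_eq_one_of_path {A : ℝ → Matrix (Fin 3) (Fin 3) ℝ}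
    (hc : ContinuousOn A (Set.Ici 0)) (hA : ∀ t ∈ Set.Ici (0 : ℝ), A t * (A t)ᵀ = 1) {t₀ : ℝ}
    (ht₀ : t₀ ∈ Set.Ici (0 : ℝ)) (h₀ : (A t₀).det = 1) :
    ∀ t ∈ Set.Ici (0 : ℝ), (A t).det = 1 := by
  have hdc : ContinuousOn (fun t => (A t).det) (Set.Ici 0) :=
    (Continuous.matrix_det continuous_id).comp_continuousOn hc
  have hsq : Set.EqOn ((fun t => (A t).det) ^ 2) 1 (Set.Ici 0) := fun t ht => by
    have := congrArg Matrix.det (hA t ht)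
    rw [Matrix.det_mul, Matrix.det_transpose, Matrix.det_one] at this
    simpa [sq] using this
  rcases isPreconnected_Ici.eq_one_or_eq_neg_one_of_sq_eq hdc hsq with h | h
  · exact fun t ht => h ht
  · have := h ht₀
    simp [h₀] at this
    norm_num at this

namespace TrackingData

variable {m ν : ℕ} (p : TrackingData m ν)

/-- The flow of a rescaling of the closed-loop field leaves the state space invariant. -/
theorem exists_lift {c : ℝ → ℝ} {x : ℝ → AmbientState m}
    (hx : ∀ t ∈ Set.Ici (0 : ℝ), HasDerivWithinAt x (c t • p.field (x t)) (Set.Ici 0) t)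
    {t₀ : ℝ} (ht₀ : t₀ ∈ Set.Ici (0 : ℝ)) {y : BodyState m} (hy : x t₀ = y.toAmbient) :
    ∃ z : ℝ → BodyState m, ∀ t ∈ Set.Ici (0 : ℝ), (z t).toAmbient = x t := by
  have hR : ∀ t ∈ Set.Ici (0 : ℝ), HasDerivWithinAt (fun t => (x t).1)
      (c t • ((x t).1 * hat (x t).2.2.2.2)) (Set.Ici 0) t := fun t ht => (hx t ht).prod_fst
  have hRd : ∀ t ∈ Set.Ici (0 : ℝ), HasDerivWithinAt (fun t => (x t).2.1)
      (c t • (hat (p.C *ᵥ (x t).2.2.2.1) * (x t).2.1)) (Set.Ici 0) t :=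
    fun t ht => (hx t ht).prod_snd.prod_fst
  have hR1 : ∀ t ∈ Set.Ici (0 : ℝ), (x t).1 * (x t).1ᵀ = 1 := by
    intro t ht
    have h : ∀ t ∈ Set.Ici (0 : ℝ),
        HasDerivWithinAt (fun t => (x t).1 * (x t).1ᵀ) 0 (Set.Ici 0) t := fun t ht => by
      refine ((hR t ht).matrix_mul (hR t ht).matrix_transpose).congr_deriv ?_
      rw [Matrix.transpose_smul, Matrix.transpose_mul, hat_transpose, Matrix.smul_mul,
        Matrix.mul_smul, ← smul_add, Matrix.neg_mul, Matrix.mul_neg, ← Matrix.mul_assoc,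
        add_neg_cancel, smul_zero]
    rw [show (x t).1 * (x t).1ᵀ = (x t₀).1 * (x t₀).1ᵀ from eq_of_hasDerivWithinAt_zero h ht ht₀, hy]
    exact y.R_mul_transpose
  have hRd1 : ∀ t ∈ Set.Ici (0 : ℝ), (x t).2.1 * (x t).2.1ᵀ = 1 := by
    intro t ht
    -- The reference is driven from the left, so the product that is conserved identically is R_dᵀ
    -- R_d, not R_d R_dᵀ.
    have h : ∀ t ∈ Set.Ici (0 : ℝ),
        HasDerivWithinAt (fun t => (x t).2.1ᵀ * (x t).2.1) 0 (Set.Ici 0) t := fun t ht => by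
      refine ((hRd t ht).matrix_transpose.matrix_mul (hRd t ht)).congr_deriv ?_
      rw [Matrix.transpose_smul, Matrix.transpose_mul, hat_transpose, Matrix.smul_mul,
        Matrix.mul_smul, ← smul_add, Matrix.mul_neg, Matrix.neg_mul, ← Matrix.mul_assoc,
        neg_add_cancel, smul_zero]
    refine mul_eq_one_comm.1 ?_
    rw [show (x t).2.1ᵀ * (x t).2.1 = (x t₀).2.1ᵀ * (x t₀).2.1 from
      eq_of_hasDerivWithinAt_zero h ht ht₀, hy]
    exact mul_eq_one_comm.1 y.Rd_mul_transpose
  have hdR := Matrix.det_eq_one_of_path (fun t ht => (hR t ht).continuousWithinAt) hR1 ht₀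
    (by rw [hy]; exact y.det_R)
  have hdRd := Matrix.det_eq_one_of_path (fun t ht => (hRd t ht).continuousWithinAt) hRd1 ht₀
    (by rw [hy]; exact y.det_Rd)
  have hmem : ∀ A : Matrix (Fin 3) (Fin 3) ℝ, A * Aᵀ = 1 → A.det = 1 →
      A ∈ Matrix.specialOrthogonalGroup (Fin 3) ℝ := fun A h1 h2 =>
    Matrix.mem_specialOrthogonalGroup_iff.2 ⟨(Matrix.mem_orthogonalGroup_iff _ _).2 h1, h2⟩
  have : ∀ t, ∃ z : BodyState m, t ∈ Set.Ici (0 : ℝ) → z.toAmbient = x t := fun t => by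
    by_cases ht : t ∈ Set.Ici (0 : ℝ)
    · exact ⟨(⟨(x t).1, hmem _ (hR1 t ht) (hdR t ht)⟩, ⟨(x t).2.1, hmem _ (hRd1 t ht) (hdRd t ht)⟩,
        (x t).2.2), fun _ => rfl⟩
    · exact ⟨y, fun h => absurd h ht⟩
  choose z hz using this
  exact ⟨z, hz⟩

section Continuity

theorem continuous_R : Continuous (BodyState.R : BodyState m → _) :=
  continuous_subtype_val.comp continuous_fst

theorem continuous_Rd : Continuous (BodyState.Rd : BodyState m → _) :=
  continuous_subtype_val.comp (continuous_fst.comp continuous_snd)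

theorem continuous_δ : Continuous (BodyState.δ : BodyState m → _) :=
  continuous_fst.comp (continuous_snd.comp continuous_snd)

theorem continuous_w : Continuous (BodyState.w : BodyState m → _) :=
  continuous_fst.comp (continuous_snd.comp (continuous_snd.comp continuous_snd))

theorem continuous_Ω : Continuous (BodyState.Ω : BodyState m → _) :=
  continuous_snd.comp (continuous_snd.comp (continuous_snd.comp continuous_snd))

theorem continuous_cross {X : Type*} [TopologicalSpace X] {u v : X → Fin 3 → ℝ}
    (hu : Continuous u) (hv : Continuous v) : Continuous (fun x => u x ⨯₃ v x) := by
  have h1 : ∀ i, Continuous fun x => u x i := fun i => (continuous_apply i).comp hu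
  have h2 : ∀ i, Continuous fun x => v x i := fun i => (continuous_apply i).comp hv
  refine continuous_pi fun i => ?_
  fin_cases i <;> simp only [cross_apply] <;>
    exact ((h1 _).mul (h2 _)).sub ((h1 _).mul (h2 _))

theorem continuous_attP : Continuous (p.attP : BodyState m → _) :=
  (continuous_R.matrix_transpose.matrix_mul continuous_Rd).matrix_mul continuous_const

theorem continuous_attErr : Continuous p.attErr := by
  unfold attErr
  exact (continuous_finsetSum _ fun i _ => continuous_cross continuous_const
    (continuous_id.matrix_mulVec continuous_const)).const_smul (p.kp / 2)

theorem continuous_attPot : Continuous p.attPot := by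
  unfold attPot
  refine continuous_const.mul (continuous_finsetSum _ fun i _ => ?_)
  have : Continuous fun P : Matrix (Fin 3) (Fin 3) ℝ => p.yr i - P *ᵥ p.yr i :=
    continuous_const.sub (continuous_id.matrix_mulVec continuous_const)
  exact this.dotProduct this

theorem continuous_Ωtilde : Continuous (p.Ωtilde : BodyState m → _) := by
  have : (p.Ωtilde : BodyState m → _) = fun z => z.Ω - (z.Rᵀ *ᵥ (p.C *ᵥ z.δ) + p.attErr (p.attP z)) := by
    ext1 z
    rw [Ωtilde, Ωc_eq]; rfl
  rw [this]
  exact continuous_Ω.sub ((continuous_R.matrix_transpose.matrix_mulVec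
    (continuous_const.matrix_mulVec continuous_δ)).add (p.continuous_attErr.comp p.continuous_attP))

theorem continuous_energy : Continuous (p.energy : BodyState m → _) := by
  unfold energy
  have h := p.continuous_Ωtilde (m := m)
  have hd : Continuous fun z : BodyState m => z.δ - z.w := continuous_δ.sub continuous_w
  exact ((p.continuous_attPot.comp p.continuous_attP).add
    (continuous_const.mul (h.dotProduct (continuous_const.matrix_mulVec h)))).add
    (continuous_const.mul (hd.dotProduct hd))

end Continuity

theorem isCompact_norm_le (ρ : ℝ) : IsCompact {z : BodyState m | ‖z.toAmbient‖ ≤ ρ} := by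
  have h : {z : BodyState m | ‖z.toAmbient‖ ≤ ρ} =
      BodyState.toAmbient ⁻¹' Metric.closedBall (0 : AmbientState m) ρ := by
    ext z; simp
  have hcl : IsClosed {z : BodyState m | ‖z.toAmbient‖ ≤ ρ} := by
    rw [h]
    exact Metric.isClosed_closedBall.preimage BodyState.isometry_toAmbient.continuous
  by_cases hne : ({z : BodyState m | ‖z.toAmbient‖ ≤ ρ}).Nonempty
  · obtain ⟨z₀, hz₀⟩ := hne
    refine (isCompact_closedBall z₀ (ρ + ρ)).of_isClosed_subset hcl fun z hz => ?_
    rw [Metric.mem_closedBall, ← BodyState.isometry_toAmbient.dist_eq]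
    exact (dist_le_norm_add_norm _ _).trans (add_le_add hz hz₀)
  · rw [Set.not_nonempty_iff_eq_empty.1 hne]
    exact isCompact_empty

theorem norm_toAmbient_le {z : BodyState m} {ρ : ℝ} (h1 : 1 ≤ ρ) (hδ : ‖z.δ‖ ≤ ρ) (hw : ‖z.w‖ ≤ ρ)
    (hΩ : ‖z.Ω‖ ≤ ρ) : ‖z.toAmbient‖ ≤ ρ := by
  refine norm_prod_le_iff.2 ⟨(SO3.norm_le_one z.1).trans h1, norm_prod_le_iff.2
    ⟨(SO3.norm_le_one z.2.1).trans h1, norm_prod_le_iff.2 ⟨hδ, norm_prod_le_iff.2 ⟨hw, hΩ⟩⟩⟩⟩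

theorem norm_w_le (z : BodyState m) : ‖z.w‖ ≤ ‖z.toAmbient‖ :=
  (norm_fst_le (z.w, z.Ω)).trans ((norm_snd_le (z.δ, z.w, z.Ω)).trans
    ((norm_snd_le (z.Rd, z.δ, z.w, z.Ω)).trans (norm_snd_le z.toAmbient)))

/-- An upper bound on the states with bounded energy and bounded exosystem state. -/
theorem exists_norm_le_of_energy_le (hJ : p.J.PosDef) (hkI : 0 < p.kI) (E ρ : ℝ) :
    ∃ ρ' : ℝ, 1 ≤ ρ' ∧ ∀ z : BodyState m, p.energy z ≤ E → ‖z.w‖ ≤ ρ →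
      ‖z.toAmbient‖ ≤ ρ' ∧ ‖p.Ωtilde z‖ ≤ ρ' ∧ ‖z.δ - z.w‖ ≤ ρ' ∧ ‖p.attErr (p.attP z)‖ ≤ ρ' := by
  obtain ⟨j, hj, hjv⟩ := exists_norm_sq_le_of_pos (A := p.J) fun v hv => by
    simpa using hJ.dotProduct_mulVec_pos hv
  obtain ⟨A, hA⟩ := (isCompact_closedBall (0 : Matrix (Fin 3) (Fin 3) ℝ) 1).exists_bound_of_continuousOn
    p.continuous_attErr.continuousOn
  set V := √(2 * E / j) with hV
  set D := √(2 * p.kI * E) with hD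
  obtain ⟨L, hL⟩ := exists_mulVec_bound p.C
  set L' := max L 0 with hL'
  have hL0 : 0 ≤ L' := le_max_right _ _
  have hCv := hL L' (le_max_left _ _)
  refine ⟨|D| + |ρ| + |V| + |A| + 3 * (L' * (|D| + |ρ|)) + 1, ?_, fun z hz hw => ?_⟩
  · have : 0 ≤ |D| + |ρ| + |V| + |A| + 3 * (L' * (|D| + |ρ|)) := by positivity
    linarith
  have hpot := p.attPot_nonneg (p.attP z)
  have h1 := hjv (p.Ωtilde z)
  have h2 := sq_norm_le_dotProduct_self (z.δ - z.w)
  have h1' : 0 ≤ p.Ωtilde z ⬝ᵥ p.J *ᵥ p.Ωtilde z := le_trans (by positivity) h1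
  have h2' : 0 ≤ (z.δ - z.w) ⬝ᵥ (z.δ - z.w) := le_trans (by positivity) h2
  have h2'' : 0 ≤ 1 / (2 * p.kI) * ((z.δ - z.w) ⬝ᵥ (z.δ - z.w)) := by positivity
  unfold energy at hz
  have hv : ‖p.Ωtilde z‖ ≤ V := by
    refine Real.le_sqrt_of_sq_le ?_
    rw [le_div_iff₀ hj]
    linarith
  have hd : ‖z.δ - z.w‖ ≤ D := by
    refine Real.le_sqrt_of_sq_le (h2.trans ?_)
    have : 1 / (2 * p.kI) * ((z.δ - z.w) ⬝ᵥ (z.δ - z.w)) ≤ E := by linarith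
    rw [one_div, inv_mul_le_iff₀ (by positivity)] at this
    exact this
  have hPn : ‖p.attP z‖ ≤ 1 := Matrix.norm_le_one_of_mul_transpose (p.attP_mul_transpose z)
  have ha : ‖p.attErr (p.attP z)‖ ≤ A := hA _ (by simpa using hPn)
  have hV' := le_abs_self V
  have hA' := le_abs_self A
  have hD' := le_abs_self D
  have hρ' := le_abs_self ρ
  have n1 := abs_nonneg V
  have n2 := abs_nonneg A
  have n3 := abs_nonneg D
  have n4 := abs_nonneg ρ
  have n5 : 0 ≤ 3 * (L' * (|D| + |ρ|)) := by positivity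
  have hδ : ‖z.δ‖ ≤ |D| + |ρ| := by
    have : z.δ = (z.δ - z.w) + z.w := by abel
    rw [this]
    exact (norm_add_le _ _).trans (by linarith)
  have hΩ : ‖z.Ω‖ ≤ |V| + 3 * (L' * (|D| + |ρ|)) + |A| := by
    have e : z.Ω = p.Ωtilde z + (z.Rᵀ *ᵥ (p.C *ᵥ z.δ) + p.attErr (p.attP z)) := by
      rw [Ωtilde, Ωc_eq, Δ]; abel
    have e2 : ‖z.Rᵀ *ᵥ (p.C *ᵥ z.δ)‖ ≤ 3 * (L' * (|D| + |ρ|)) := by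
      refine (Matrix.norm_mulVec_le_card _ _).trans ?_
      have : ‖z.Rᵀ‖ ≤ 1 := by rw [Matrix.norm_transpose]; exact SO3.norm_le_one z.1
      have h3 : ‖p.C *ᵥ z.δ‖ ≤ L' * (|D| + |ρ|) := (hCv _).trans (by gcongr)
      simp only [Fintype.card_fin, Nat.cast_ofNat]
      calc 3 * ‖z.Rᵀ‖ * ‖p.C *ᵥ z.δ‖ ≤ 3 * 1 * (L' * (|D| + |ρ|)) := by gcongr
        _ = _ := by ring
    rw [e]
    refine (norm_add_le _ _).trans ?_
    have := norm_add_le (z.Rᵀ *ᵥ (p.C *ᵥ z.δ)) (p.attErr (p.attP z))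
    linarith
  exact ⟨norm_toAmbient_le (by linarith) (by linarith) (by linarith) (by linarith),
    by linarith, by linarith, by linarith⟩

end TrackingData

/-! ### Boundedness, existence and two-sided Lipschitz dependence of solutions. -/

namespace TrackingData

variable {m ν : ℕ} {p : TrackingData m ν}

/-- The standing assumptions on the tracking problem. -/
structure IsAdmissible (p : TrackingData m ν) : Prop where
  posDef : p.J.PosDef
  skew : p.Sᵀ = -p.S
  observable : p.Observable
  kp_pos : 0 < p.kp
  kI_pos : 0 < p.kI
  kD_pos : 0 < p.kD
  measurement : p.MeasurementAssumption

namespace IsAdmissible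

variable (hp : p.IsAdmissible)
include hp

theorem J_transpose : p.Jᵀ = p.J := by
  simpa using hp.posDef.isHermitian.eq

theorem J_inv_mul : p.J⁻¹ * p.J = 1 :=
  Matrix.nonsing_inv_mul _ ((Matrix.isUnit_iff_isUnit_det _).1 hp.posDef.isUnit)

theorem hasDerivWithinAt_of_mem_solutions {z : ℝ → BodyState m} (hz : z ∈ p.solutions) {t : ℝ}
    (ht : t ∈ Set.Ici (0 : ℝ)) :
    HasDerivWithinAt (fun s => (z s).toAmbient) (p.field (z t).toAmbient) (Set.Ici 0) t := by
  have := (p.isScaledSolution_iff hp.kp_pos hp.J_transpose hp.J_inv_mul _ z).1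
    ((p.mem_solutions_iff hp.J_inv_mul z).1 hz) t ht
  rwa [one_smul] at this

theorem continuousOn_of_mem_solutions {z : ℝ → BodyState m} (hz : z ∈ p.solutions) :
    ContinuousOn z (Set.Ici 0) := by
  have h : ContinuousOn (fun s => (z s).toAmbient) (Set.Ici 0) := fun t ht =>
    (hp.hasDerivWithinAt_of_mem_solutions hz ht).continuousWithinAt
  exact (BodyState.isometry_toAmbient (m := m)).isUniformInducing.isInducing.continuousOn_iff.2 h

theorem dotProduct_w_eq {c : ℝ → ℝ} {z : ℝ → BodyState m} (hz : p.IsScaledSolution c z) {t : ℝ}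
    (ht : t ∈ Set.Ici (0 : ℝ)) : (z t).w ⬝ᵥ (z t).w = (z 0).w ⬝ᵥ (z 0).w := by
  refine eq_of_hasDerivWithinAt_zero (f := fun t => (z t).w ⬝ᵥ (z t).w) (fun t ht => ?_) ht
    Set.self_mem_Ici
  obtain ⟨-, -, -, hw, -⟩ := hz t ht
  refine (hw.dotProduct hw).congr_deriv ?_
  rw [smul_dotProduct, dotProduct_smul, dotProduct_comm, dotProduct_mulVec_self_of_skew hp.skew]
  simp

/-- The Euclidean length of w is conserved as S is skew; √m is the price of the sup norm. -/
theorem norm_w_le {c : ℝ → ℝ} {z : ℝ → BodyState m} (hz : p.IsScaledSolution c z) {t : ℝ}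
    (ht : t ∈ Set.Ici (0 : ℝ)) : ‖(z t).w‖ ≤ √m * ‖(z 0).w‖ := by
  refine abs_le_of_sq_le_sq' ?_ (by positivity) |>.2
  have h1 := sq_norm_le_dotProduct_self (z t).w
  have h2 := dotProduct_self_le_card (z 0).w
  rw [hp.dotProduct_w_eq hz ht] at h1
  rw [mul_pow, Real.sq_sqrt (by positivity)]
  simpa using h1.trans h2

theorem antitoneOn_energy {c : ℝ → ℝ} {z : ℝ → BodyState m} (hz : p.IsScaledSolution c z)
    (hc : ∀ t, 0 ≤ c t) : AntitoneOn (fun t => p.energy (z t)) (Set.Ici 0) := by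
  have hd := fun t (ht : t ∈ Set.Ici (0 : ℝ)) =>
    hz.hasDeriv_energy hp.kp_pos hp.kI_pos hp.J_transpose hp.J_inv_mul hp.skew ht
  refine antitoneOn_of_hasDerivWithinAt_nonpos (convex_Ici 0)
    (fun t ht => (hd t ht).continuousWithinAt)
    (fun t ht => (hd t (interior_subset ht)).mono interior_subset) fun t _ => ?_
  have h1 : 0 ≤ p.attErr (p.attP (z t)) ⬝ᵥ p.attErr (p.attP (z t)) :=
    (sq_nonneg _).trans (sq_norm_le_dotProduct_self _)
  have h2 : 0 ≤ p.Ωtilde (z t) ⬝ᵥ p.Ωtilde (z t) :=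
    (sq_nonneg _).trans (sq_norm_le_dotProduct_self _)
  have h3 : 0 ≤ 2 / p.kp * (p.attErr (p.attP (z t)) ⬝ᵥ p.attErr (p.attP (z t))) :=
    mul_nonneg (div_nonneg zero_le_two hp.kp_pos.le) h1
  have h4 := mul_nonneg hp.kD_pos.le h2
  exact mul_nonpos_of_nonneg_of_nonpos (hc t) (by linarith)

/-- Trajectories that start with bounded energy and bounded exosystem state stay bounded. -/
theorem exists_bound_of_energy_le (E ρ : ℝ) : ∃ ρ' : ℝ, 1 ≤ ρ' ∧
    ∀ (c : ℝ → ℝ) (z : ℝ → BodyState m), (∀ t, 0 ≤ c t) → p.IsScaledSolution c z →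
      p.energy (z 0) ≤ E → ‖(z 0).w‖ ≤ ρ → ∀ t ∈ Set.Ici (0 : ℝ),
      ‖(z t).toAmbient‖ ≤ ρ' ∧ ‖p.Ωtilde (z t)‖ ≤ ρ' ∧ ‖(z t).δ - (z t).w‖ ≤ ρ' ∧
        ‖p.attErr (p.attP (z t))‖ ≤ ρ' := by
  obtain ⟨ρ', h1, h⟩ := p.exists_norm_le_of_energy_le (m := m) hp.posDef hp.kI_pos E (√m * ρ)
  refine ⟨ρ', h1, fun c z hc hz hE hw t ht => h _ ?_ ?_⟩
  · exact (hp.antitoneOn_energy hz hc Set.self_mem_Ici ht ht).trans hE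
  · exact (hp.norm_w_le hz ht).trans (by gcongr)

theorem exists_bound (ρ : ℝ) : ∃ ρ' : ℝ, 1 ≤ ρ' ∧
    ∀ (c : ℝ → ℝ) (z : ℝ → BodyState m), (∀ t, 0 ≤ c t) → p.IsScaledSolution c z →
      ‖(z 0).toAmbient‖ ≤ ρ → ∀ t ∈ Set.Ici (0 : ℝ),
      ‖(z t).toAmbient‖ ≤ ρ' ∧ ‖p.Ωtilde (z t)‖ ≤ ρ' ∧ ‖(z t).δ - (z t).w‖ ≤ ρ' ∧
        ‖p.attErr (p.attP (z t))‖ ≤ ρ' := by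
  obtain ⟨E, hE⟩ := (isCompact_norm_le (m := m) ρ).exists_bound_of_continuousOn
    p.continuous_energy.continuousOn
  obtain ⟨ρ', h1, h⟩ := hp.exists_bound_of_energy_le E ρ
  exact ⟨ρ', h1, fun c z hc hz h0 => h c z hc hz ((le_abs_self _).trans (hE _ h0))
    ((TrackingData.norm_w_le _).trans h0)⟩

end IsAdmissible

/-- A smooth truncation of the closed-loop field outside a ball. -/
theorem exists_truncated_field (p : TrackingData m ν) (ρ : ℝ) :
    ∃ χ : AmbientState m → ℝ, (∀ x, 0 ≤ χ x) ∧ (∀ x, ‖x‖ ≤ ρ → χ x = 1) ∧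
      ∃ (K : NNReal) (L : ℝ), LipschitzWith K (fun x => χ x • p.field x) ∧
        ∀ x, ‖χ x • p.field x‖ ≤ L := by
  let χ : ContDiffBump (0 : AmbientState m) := ⟨max ρ 1, max ρ 1 + 1, by positivity, by linarith⟩
  have hs : HasCompactSupport (fun x => χ x • p.field x) := χ.hasCompactSupport.smul_right
  have hc : ContDiff ℝ 1 (fun x => χ x • p.field x) := χ.contDiff.smul p.contDiff_field
  obtain ⟨K, hK⟩ := hc.lipschitzWith_of_hasCompactSupport hs one_ne_zero
  obtain ⟨L, hL⟩ := hs.exists_bound_of_continuous hc.continuous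
  refine ⟨χ, fun x => χ.nonneg, fun x hx => χ.one_of_mem_closedBall ?_, K, L, hK, hL⟩
  rw [mem_closedBall_zero_iff]
  exact hx.trans (le_max_left _ _)

namespace IsAdmissible

variable (hp : p.IsAdmissible)
include hp

theorem hasDerivWithinAt_truncated {χ : AmbientState m → ℝ} {ρ : ℝ}
    (hχ : ∀ x, ‖x‖ ≤ ρ → χ x = 1) {z : ℝ → BodyState m} (hz : z ∈ p.solutions)
    (hb : ∀ t ∈ Set.Ici (0 : ℝ), ‖(z t).toAmbient‖ ≤ ρ) : ∀ t ∈ Set.Ici (0 : ℝ),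
    HasDerivWithinAt (fun s => (z s).toAmbient) (χ (z t).toAmbient • p.field (z t).toAmbient)
      (Set.Ici 0) t := fun t ht => by
  rw [hχ _ (hb t ht), one_smul]
  exact hp.hasDerivWithinAt_of_mem_solutions hz ht

/-- A solution of the truncated field follows the closed loop at speed χ ≥ 0, so the a priori bound
`hb` for all nonnegative speeds applies to it before it is known to be a true solution. Within that
bound χ = 1, and therefore it is one. -/
theorem exists_mem_solutions_of_truncated {χ : AmbientState m → ℝ} {ρ ρ' : ℝ}
    (hχ0 : ∀ x, 0 ≤ χ x) (hχ : ∀ x, ‖x‖ ≤ ρ' → χ x = 1)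
    (hb : ∀ (c : ℝ → ℝ) (z : ℝ → BodyState m), (∀ t, 0 ≤ c t) → p.IsScaledSolution c z →
      ‖(z 0).toAmbient‖ ≤ ρ → ∀ t ∈ Set.Ici (0 : ℝ), ‖(z t).toAmbient‖ ≤ ρ')
    {x : ℝ → AmbientState m} (hx : ∀ t, HasDerivAt x (χ (x t) • p.field (x t)) t)
    (h0 : ‖x 0‖ ≤ ρ) {T : ℝ} (hT : T ∈ Set.Ici (0 : ℝ)) {y : BodyState m}
    (hy : x T = y.toAmbient) :
    ∃ z ∈ p.solutions, ∀ t ∈ Set.Ici (0 : ℝ), (z t).toAmbient = x t := by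
  obtain ⟨z, hzx⟩ := p.exists_lift (c := fun t => χ (x t))
    (fun t _ => (hx t).hasDerivWithinAt) hT hy
  have hsc : p.IsScaledSolution (fun t => χ (x t)) z :=
    (p.isScaledSolution_iff hp.kp_pos hp.J_transpose hp.J_inv_mul _ z).2 fun t ht =>
      ((hx t).hasDerivWithinAt.congr_of_mem hzx ht).congr_deriv (by rw [hzx t ht])
  have hzb := hb _ z (fun t => hχ0 _) hsc (by rwa [hzx 0 Set.self_mem_Ici])
  refine ⟨z, (p.mem_solutions_iff hp.J_inv_mul z).2 fun t ht => ?_, hzx⟩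
  have h1 : χ (x t) = 1 := hχ _ (by rw [← hzx t ht]; exact hzb t ht)
  have := hsc t ht
  simp only [h1] at this
  exact this

theorem exists_mem_solutions (z₀ : BodyState m) : ∃ z ∈ p.solutions, z 0 = z₀ := by
  obtain ⟨ρ', -, hb⟩ := hp.exists_bound ‖z₀.toAmbient‖
  obtain ⟨χ, hχ0, hχ, K, L, hK, hL⟩ := p.exists_truncated_field ρ'
  obtain ⟨x, hx0, hx⟩ := exists_global_solution hK hL 0 z₀.toAmbient
  obtain ⟨z, hz, hzx⟩ := hp.exists_mem_solutions_of_truncated hχ0 hχ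
    (fun c z hc hz h0 t ht => (hb c z hc hz h0 t ht).1) hx (by rw [hx0]) Set.self_mem_Ici hx0
  exact ⟨z, hz, BodyState.isometry_toAmbient.injective (by rw [hzx 0 Set.self_mem_Ici, hx0])⟩

/-- The flow and its inverse are Lipschitz on bounded sets, and a state close to a trajectory at
time `T` has a past on `[0, T]`. -/
theorem exists_flow_lipschitz (ρ : ℝ) : ∃ K : ℝ, 0 ≤ K ∧
    (∀ z₁ ∈ p.solutions, ∀ z₂ ∈ p.solutions, ‖(z₁ 0).toAmbient‖ ≤ ρ → ‖(z₂ 0).toAmbient‖ ≤ ρ →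
      ∀ t ∈ Set.Ici (0 : ℝ), dist (z₁ t) (z₂ t) ≤ dist (z₁ 0) (z₂ 0) * Real.exp (K * t)) ∧
    (∀ z₁ ∈ p.solutions, ‖(z₁ 0).toAmbient‖ ≤ ρ → ∀ T ∈ Set.Ici (0 : ℝ), ∀ y : BodyState m,
      dist y (z₁ T) * Real.exp (K * T) ≤ 1 → ∃ z₂ ∈ p.solutions, z₂ T = y ∧
        dist (z₂ 0) (z₁ 0) ≤ dist y (z₁ T) * Real.exp (K * T)) := by
  -- The extra 1 leaves room for the reconstructed past, whose initial state lies within distance 1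
  -- of that of `z₁`.
  obtain ⟨ρ', -, hb⟩ := hp.exists_bound (ρ + 1)
  obtain ⟨χ, hχ0, hχ, K, L, hK, hL⟩ := p.exists_truncated_field ρ'
  have htr : ∀ z ∈ p.solutions, ‖(z 0).toAmbient‖ ≤ ρ → ∀ t ∈ Set.Ici (0 : ℝ),
      HasDerivWithinAt (fun s => (z s).toAmbient) (χ (z t).toAmbient • p.field (z t).toAmbient)
        (Set.Ici 0) t := fun z hz h0 => hp.hasDerivWithinAt_truncated hχ hz fun t ht =>
    (hb _ z (fun _ => zero_le_one) ((p.mem_solutions_iff hp.J_inv_mul z).1 hz)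
      (h0.trans (by linarith)) t ht).1
  refine ⟨K, K.2, fun z₁ h1 z₂ h2 b1 b2 t ht => ?_, fun z₁ h1 b1 T hT y hy => ?_⟩
  · have := dist_le_exp_forward hK (htr z₁ h1 b1) (htr z₂ h2 b2) ht
    simpa only [BodyState.isometry_toAmbient.dist_eq] using this
  · obtain ⟨x, hxT, hx⟩ := exists_global_solution hK hL T y.toAmbient
    have hd := dist_le_exp_backward hK (fun t _ => (hx t).hasDerivWithinAt) (htr z₁ h1 b1) hT
    rw [hxT, BodyState.isometry_toAmbient.dist_eq] at hd
    have h0 : ‖x 0‖ ≤ ρ + 1 := by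
      have := norm_le_norm_add_norm_sub' (x 0) (z₁ 0).toAmbient
      rw [← dist_eq_norm] at this
      linarith
    obtain ⟨z, hz, hzx⟩ := hp.exists_mem_solutions_of_truncated hχ0 hχ
      (fun c z hc hz h0 t ht => (hb c z hc hz h0 t ht).1) hx h0 hT hxT
    refine ⟨z, hz, BodyState.isometry_toAmbient.injective (by rw [hzx T hT, hxT]), ?_⟩
    rw [← hzx 0 Set.self_mem_Ici, BodyState.isometry_toAmbient.dist_eq] at hd
    exact hd

/-- Two trajectories that share the exosystem at one time share it at all times. -/
theorem exosystem_eq {z₁ z₂ : ℝ → BodyState m} (h1 : z₁ ∈ p.solutions) (h2 : z₂ ∈ p.solutions)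
    {T : ℝ} (hT : T ∈ Set.Ici (0 : ℝ)) (hRd : (z₁ T).Rd = (z₂ T).Rd) (hw : (z₁ T).w = (z₂ T).w)
    {t : ℝ} (ht : t ∈ Set.Ici (0 : ℝ)) : (z₁ t).Rd = (z₂ t).Rd ∧ (z₁ t).w = (z₂ t).w := by
  have s1 := (p.mem_solutions_iff hp.J_inv_mul z₁).1 h1
  have s2 := (p.mem_solutions_iff hp.J_inv_mul z₂).1 h2
  have hweq : ∀ t ∈ Set.Ici (0 : ℝ), (z₁ t).w = (z₂ t).w := fun t ht => by
    have hd : ∀ t ∈ Set.Ici (0 : ℝ), HasDerivWithinAt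
        (fun t => ((z₁ t).w - (z₂ t).w) ⬝ᵥ ((z₁ t).w - (z₂ t).w)) 0 (Set.Ici 0) t := fun t ht => by
      obtain ⟨-, -, -, w1, -⟩ := s1 t ht
      obtain ⟨-, -, -, w2, -⟩ := s2 t ht
      refine ((w1.sub w2).dotProduct (w1.sub w2)).congr_deriv ?_
      rw [one_smul, one_smul, ← Matrix.mulVec_sub, dotProduct_comm, Pi.sub_apply,
        dotProduct_mulVec_self_of_skew hp.skew, add_zero]
    have h := eq_of_hasDerivWithinAt_zero hd ht hT
    have h' : ((z₁ t).w - (z₂ t).w) ⬝ᵥ ((z₁ t).w - (z₂ t).w) = 0 := by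
      rw [h, hw, sub_self, dotProduct_zero]
    exact sub_eq_zero.1 (dotProduct_self_eq_zero.1 h')
  refine ⟨?_, hweq t ht⟩
  have hd : ∀ t ∈ Set.Ici (0 : ℝ), HasDerivWithinAt
      (fun t => (z₁ t).Rdᵀ * (z₂ t).Rd) 0 (Set.Ici 0) t := fun t ht => by
    obtain ⟨-, r1, -, -, -⟩ := s1 t ht
    obtain ⟨-, r2, -, -, -⟩ := s2 t ht
    refine (r1.matrix_transpose.matrix_mul r2).congr_deriv ?_
    rw [one_smul, one_smul, Ωd, Ωd, hweq t ht, Matrix.transpose_mul, hat_transpose, Matrix.mul_neg,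
      Matrix.neg_mul, Matrix.mul_assoc, neg_add_cancel]
  have h : (z₁ t).Rdᵀ * (z₂ t).Rd = (z₁ T).Rdᵀ * (z₂ T).Rd := eq_of_hasDerivWithinAt_zero hd ht hT
  rw [hRd, mul_eq_one_comm.1 (z₂ T).Rd_mul_transpose] at h
  calc (z₁ t).Rd = (z₁ t).Rd * ((z₁ t).Rdᵀ * (z₂ t).Rd) := by rw [h, Matrix.mul_one]
    _ = (z₂ t).Rd := by rw [← Matrix.mul_assoc, (z₁ t).Rd_mul_transpose, Matrix.one_mul]

end IsAdmissible

end TrackingData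

/-! ### The attitude error as a local coordinate on SO(3). -/

theorem norm_mulVec_le_three (A : Matrix (Fin 3) (Fin 3) ℝ) (v : Fin 3 → ℝ) :
    ‖A *ᵥ v‖ ≤ 3 * ‖A‖ * ‖v‖ := by
  simpa using A.norm_mulVec_le_card v

theorem norm_mul_le_three (A B : Matrix (Fin 3) (Fin 3) ℝ) : ‖A * B‖ ≤ 3 * ‖A‖ * ‖B‖ := by
  simpa using Matrix.norm_mul_le_card A B

theorem exists_eq_hat_of_skew {X : Matrix (Fin 3) (Fin 3) ℝ} (hX : Xᵀ = -X) :
    ∃ s : Fin 3 → ℝ, X = hat s ∧ ‖s‖ ≤ ‖X‖ := by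
  have h : ∀ i j, X j i = -X i j := fun i j => congrFun (congrFun hX i) j
  refine ⟨![X 2 1, X 0 2, X 1 0], ?_, ?_⟩
  · have h0 := h 0 0
    have h1 := h 1 1
    have h2 := h 2 2
    have h3 := h 0 1
    have h4 := h 2 0
    have h5 := h 1 2
    ext i j
    fin_cases i <;> fin_cases j <;> simp [hat] <;> linarith
  · refine (pi_norm_le_iff_of_nonneg (norm_nonneg _)).2 fun i => ?_
    fin_cases i <;> exact Matrix.norm_entry_le_entrywise_sup_norm X

namespace TrackingData

variable {m ν : ℕ} (p : TrackingData m ν)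

theorem exists_norm_attErr_le : ∃ A : ℝ, ∀ A' ≥ A, ∀ X, ‖p.attErr X‖ ≤ A' * ‖X‖ := by
  refine ⟨|p.kp / 2| * ∑ i, 3 * ‖p.yr i‖ * (3 * ‖p.yr i‖), fun A' hA' X => ?_⟩
  have h : ‖p.attErr X‖ ≤ |p.kp / 2| * ∑ i, 3 * ‖p.yr i‖ * (3 * ‖X‖ * ‖p.yr i‖) := by
    rw [attErr, norm_smul, Real.norm_eq_abs]
    gcongr
    refine norm_sum_le_of_le _ fun i _ => (norm_cross_le _ _).trans ?_
    gcongr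
    exact norm_mulVec_le_three _ _
  refine h.trans (le_trans (le_of_eq ?_) (mul_le_mul_of_nonneg_right hA' (norm_nonneg X)))
  rw [mul_assoc, Finset.sum_mul]
  congr 1
  exact Finset.sum_congr rfl fun i _ => by ring

theorem attGain_sub (P P' : Matrix (Fin 3) (Fin 3) ℝ) :
    p.attGain (P - P') = p.attGain P - p.attGain P' := by
  rw [attGain, attGain, attGain, Matrix.sub_mul, Matrix.trace_sub, sub_smul]
  abel

theorem exists_norm_attGain_le : ∃ A : ℝ, ∀ A' ≥ A, ∀ X, ‖p.attGain X‖ ≤ A' * ‖X‖ := by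
  refine ⟨12 * ‖p.Y‖, fun A' hA' X => ?_⟩
  have h1 := norm_mul_le_three X p.Y
  have h2 : ‖(X * p.Y).trace‖ ≤ 3 * ‖X * p.Y‖ := by
    rw [Matrix.trace]
    refine (norm_sum_le_of_le _ fun i _ => Matrix.norm_entry_le_entrywise_sup_norm (X * p.Y)).trans ?_
    simp
  have h3 : ‖(1 : Matrix (Fin 3) (Fin 3) ℝ)‖ ≤ 1 :=
    Matrix.norm_le_one_of_mul_transpose (by simp)
  have h4 : ‖p.attGain X‖ ≤ ‖X * p.Y‖ + 3 * ‖X * p.Y‖ * 1 := by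
    rw [attGain]
    refine (norm_sub_le _ _).trans ?_
    gcongr
    exact (norm_smul_le _ _).trans (by gcongr)
  nlinarith [norm_nonneg X]

/-- Near an attitude at which the gain is invertible, `attErr` separates rotations linearly. -/
theorem exists_norm_sub_le_attErr {P₀ : Matrix (Fin 3) (Fin 3) ℝ} (hP₀ : P₀ * P₀ᵀ = 1)
    (hN : IsUnit (p.attGain P₀).det) : ∃ ε > 0, ∃ K : ℝ, ∀ K' ≥ K,
      ∀ P₁ P₂ : Matrix (Fin 3) (Fin 3) ℝ, P₁ * P₁ᵀ = 1 → P₂ * P₂ᵀ = 1 → ‖P₁ - P₀‖ ≤ ε →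
      ‖P₂ - P₀‖ ≤ ε → ‖P₁ - P₂‖ ≤ K' * ‖p.attErr P₁ - p.attErr P₂‖ := by
  obtain ⟨A', hA'⟩ := p.exists_norm_attErr_le
  set A := max A' 0
  have hA := hA' A (le_max_left _ _)
  have hA0 : 0 ≤ A := le_max_right _ _
  obtain ⟨L', hL'⟩ := exists_mulVec_bound (p.attGain P₀)⁻¹
  set L := max L' 0
  have hL := hL' L (le_max_left _ _)
  have hL0 : 0 ≤ L := le_max_right _ _
  have hP₀n := Matrix.norm_le_one_of_mul_transpose hP₀
  -- With this radius, ε(27LA + 9) = ½, so that the error terms of the final estimate are absorbed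
  -- by half of ‖D‖.
  refine ⟨1 / (2 * (27 * L * A + 9)), by positivity, 6 * L, fun K' hK' P₁ P₂ h1 h2 b1 b2 => ?_⟩
  set ε := 1 / (2 * (27 * L * A + 9)) with hε
  have hε0 : 0 < ε := by positivity
  have hεe : ε * (27 * L * A + 9) = 1 / 2 := by
    rw [hε]; field_simp
  set D := P₁ - P₂ with hD
  set H := D * P₀ᵀ with hH
  -- Orthogonality of both rotations gives D P₁ᵀ + P₂ Dᵀ = 0 exactly. Replacing P₁ and P₂ by P₀
  -- shows that D P₀ᵀ is skew up to O(ε‖D‖).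
  have hsum : H + Hᵀ = -(D * (P₁ - P₀)ᵀ + (P₂ - P₀) * Dᵀ) := by
    have e : D * P₁ᵀ + P₂ * Dᵀ = 0 := by
      rw [hD, Matrix.transpose_sub, Matrix.sub_mul, Matrix.mul_sub, h1, h2]; abel
    rw [hH, Matrix.transpose_mul, Matrix.transpose_transpose, Matrix.transpose_sub P₁ P₀,
      Matrix.mul_sub D, Matrix.sub_mul P₂ P₀]
    rw [← sub_eq_zero]
    rw [← e]
    abel
  have hsumn : ‖H + Hᵀ‖ ≤ 6 * ε * ‖D‖ := by
    rw [hsum, norm_neg]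
    refine (norm_add_le _ _).trans ?_
    have n1 := norm_mul_le_three D (P₁ - P₀)ᵀ
    have n2 := norm_mul_le_three (P₂ - P₀) Dᵀ
    rw [Matrix.norm_transpose] at n1 n2
    have := norm_nonneg D
    nlinarith
  obtain ⟨s, hs, hsn⟩ := exists_eq_hat_of_skew (X := (1 / 2 : ℝ) • (H - Hᵀ)) (by
    rw [Matrix.transpose_smul, Matrix.transpose_sub, Matrix.transpose_transpose, ← smul_neg]
    congr 1
    abel)
  set E := (1 / 2 : ℝ) • (H + Hᵀ) with hE
  have hEn : ‖E‖ ≤ 3 * ε * ‖D‖ := by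
    rw [hE, norm_smul]
    norm_num
    linarith
  have hDe : D = hat s * P₀ + E * P₀ := by
    have hHE : H = hat s + E := by
      rw [← hs, hE, ← smul_add]
      rw [show H - Hᵀ + (H + Hᵀ) = (2 : ℝ) • H by rw [two_smul]; abel, smul_smul]
      norm_num
    rw [← Matrix.add_mul, ← hHE, hH, Matrix.mul_assoc, mul_eq_one_comm.1 hP₀, Matrix.mul_one]
  -- On the skew part s_× P₀ the linear map `attErr` is −N s, and N is invertible, so s is recovered
  -- from the difference of the attitude errors.
  have hatt : p.attErr P₁ - p.attErr P₂ = -(p.attGain P₀ *ᵥ s) + p.attErr (E * P₀) := by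
    have e1 : p.attErr (hat s * P₀) = -(p.attGain P₀ *ᵥ s) := by
      rw [← Matrix.mulVec_neg, ← attErr_hat_mul]
      congr 1
      rw [show hat (-s) = -hat s by simpa using hat_smul (-1) s, neg_neg]
    rw [← attErr_sub, ← hD, ← e1, ← sub_eq_iff_eq_add', ← attErr_sub]
    congr 1
    rw [sub_eq_iff_eq_add', ← hDe]
  have hEP : ‖E * P₀‖ ≤ 9 * ε * ‖D‖ := by
    have := norm_mul_le_three E P₀
    nlinarith [norm_nonneg E, norm_nonneg P₀]
  have hsb : ‖s‖ ≤ L * (‖p.attErr P₁ - p.attErr P₂‖ + A * (9 * ε * ‖D‖)) := by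
    have e : s = (p.attGain P₀)⁻¹ *ᵥ (p.attErr (E * P₀) - (p.attErr P₁ - p.attErr P₂)) := by
      rw [hatt]
      rw [show p.attErr (E * P₀) - (-(p.attGain P₀ *ᵥ s) + p.attErr (E * P₀)) = p.attGain P₀ *ᵥ s by
        abel, Matrix.mulVec_mulVec, Matrix.nonsing_inv_mul _ hN, Matrix.one_mulVec]
    rw [e]
    refine (hL _).trans ?_
    gcongr
    refine (norm_sub_le _ _).trans ?_
    rw [add_comm]
    gcongr
    exact (hA _).trans (by gcongr)
  have hDn : ‖D‖ ≤ 3 * ‖s‖ + 9 * ε * ‖D‖ := by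
    calc ‖D‖ ≤ ‖hat s * P₀‖ + ‖E * P₀‖ := by
          conv_lhs => rw [hDe]
          exact norm_add_le _ _
      _ ≤ 3 * ‖s‖ + 9 * ε * ‖D‖ := by
          gcongr
          have := norm_mul_le_three (hat s) P₀
          have h3 := norm_hat_le s
          nlinarith [norm_nonneg (hat s), norm_nonneg P₀]
  have hfin : ‖D‖ ≤ 6 * L * ‖p.attErr P₁ - p.attErr P₂‖ := by
    have : 3 * ‖s‖ + 9 * ε * ‖D‖ ≤ 3 * L * ‖p.attErr P₁ - p.attErr P₂‖ + 1 / 2 * ‖D‖ := by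
      rw [← hεe]; linarith
    linarith
  exact hfin.trans (mul_le_mul_of_nonneg_right hK' (norm_nonneg _))

end TrackingData

/-! ### Strict decrease along trajectories and along differences of trajectories. -/

theorem norm_mulVec_le_of_le {A : Matrix (Fin 3) (Fin 3) ℝ} {v : Fin 3 → ℝ} {x y : ℝ}
    (hA : ‖A‖ ≤ x) (hv : ‖v‖ ≤ y) : ‖A *ᵥ v‖ ≤ 3 * x * y :=
  (norm_mulVec_le_three A v).trans (by
    have := (norm_nonneg A).trans hA
    gcongr)

namespace TrackingData

variable {m ν : ℕ} (p : TrackingData m ν)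

/-- Velocity of `attErr` along the closed loop. -/
noncomputable def errRate (R P : Matrix (Fin 3) (Fin 3) ℝ) (v : Fin 3 → ℝ) (d : Fin m → ℝ) :
    Fin 3 → ℝ :=
  p.attGain P *ᵥ (Rᵀ *ᵥ (p.C *ᵥ d) + p.attErr P + v)

/-- Velocity of `Ωtilde` along the closed loop. -/
noncomputable def velRate (R P : Matrix (Fin 3) (Fin 3) ℝ) (v : Fin 3 → ℝ) (d : Fin m → ℝ) :
    Fin 3 → ℝ :=
  p.J⁻¹ *ᵥ ((2 / p.kp) • p.attErr P - p.kD • v) - p.attGain P *ᵥ (Rᵀ *ᵥ (p.C *ᵥ d))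

/-- Velocity of `δ - w` along the closed loop. -/
noncomputable def regRate (R P : Matrix (Fin 3) (Fin 3) ℝ) (v : Fin 3 → ℝ) (d : Fin m → ℝ) :
    Fin m → ℝ :=
  p.S *ᵥ d + p.kI • (p.Cᵀ *ᵥ (R *ᵥ ((p.attGain P)ᵀ *ᵥ (p.J *ᵥ v) + (2 / p.kp) • p.attErr P)))

variable {p}

set_option maxHeartbeats 1000000 in
/-- Strict decrease of `lyap` along the difference of two error trajectories near a critical
attitude `P₀`. -/
theorem IsAdmissible.exists_pair_lyap (hp : p.IsAdmissible) {P₀ : Matrix (Fin 3) (Fin 3) ℝ}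
    (hP₀ : P₀ * P₀ᵀ = 1) (hdet : P₀.det = 1) (hcrit : p.attErr P₀ = 0) (ρ : ℝ) :
    ∃ (B : Matrix (Fin m) (Fin m) ℝ) (e μ : ℝ), ∃ c > 0, ∃ K > 0, ∃ ε > 0,
      (∀ R : Matrix (Fin 3) (Fin 3) ℝ, ‖R‖ ≤ 1 → ∀ a v d,
        -(1 / p.kp) * (a ⬝ᵥ (p.attGain P₀)⁻¹ *ᵥ a) + c * (‖v‖ ^ 2 + ‖d‖ ^ 2) ≤
          p.lyap (p.attGain P₀) (p.attGain P₀)⁻¹ B e μ R a v d ∧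
        p.lyap (p.attGain P₀) (p.attGain P₀)⁻¹ B e μ R a v d ≤
          -(1 / p.kp) * (a ⬝ᵥ (p.attGain P₀)⁻¹ *ᵥ a) + K * (‖v‖ ^ 2 + ‖d‖ ^ 2) ∧
        |p.lyap (p.attGain P₀) (p.attGain P₀)⁻¹ B e μ R a v d| ≤
          K * (‖a‖ ^ 2 + ‖v‖ ^ 2 + ‖d‖ ^ 2)) ∧
      (∀ P₁ P₂ : Matrix (Fin 3) (Fin 3) ℝ, P₁ * P₁ᵀ = 1 → P₂ * P₂ᵀ = 1 → ‖P₁ - P₀‖ ≤ ε →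
        ‖P₂ - P₀‖ ≤ ε → ‖P₁ - P₂‖ ≤ K * ‖p.attErr P₁ - p.attErr P₂‖) ∧
      ∀ R₁ R₂ P₁ P₂ : Matrix (Fin 3) (Fin 3) ℝ, R₁ * R₁ᵀ = 1 → R₂ * R₂ᵀ = 1 → P₁ * P₁ᵀ = 1 →
        P₂ * P₂ᵀ = 1 → ∀ (Ω v₁ v₂ : Fin 3 → ℝ) (d₁ d₂ : Fin m → ℝ), ‖Ω‖ ≤ ρ → ‖P₁ - P₀‖ ≤ ε →
        ‖P₂ - P₀‖ ≤ ε → ‖R₁ - R₂‖ ≤ 9 * ‖P₁ - P₂‖ → ‖v₂‖ ≤ ε → ‖d₂‖ ≤ ε →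
        p.lyapDeriv (p.attGain P₀) (p.attGain P₀)⁻¹ B e μ R₁ (R₁ * hat Ω)
          (p.attErr P₁ - p.attErr P₂) (v₁ - v₂) (d₁ - d₂)
          (p.errRate R₁ P₁ v₁ d₁ - p.errRate R₂ P₂ v₂ d₂)
          (p.velRate R₁ P₁ v₁ d₁ - p.velRate R₂ P₂ v₂ d₂)
          (p.regRate R₁ P₁ v₁ d₁ - p.regRate R₂ P₂ v₂ d₂) ≤
        -c * (‖p.attErr P₁ - p.attErr P₂‖ ^ 2 + ‖v₁ - v₂‖ ^ 2 + ‖d₁ - d₂‖ ^ 2) := by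
  obtain ⟨hN, hNu, -, -⟩ := p.critical_attitude hp.kp_pos hp.measurement hP₀ hdet hcrit
  set N := p.attGain P₀ with hNdef
  obtain ⟨B, e, μ, c, hc, κ, hκ, K₀, hK₀, hb, hdec⟩ := p.exists_strict_lyap hp.posDef hp.skew
    hp.observable hN (Matrix.mul_nonsing_inv N hNu) hp.kp_pos hp.kI_pos hp.kD_pos ρ
  obtain ⟨ε₀, hε₀, K₁, hK₁⟩ := p.exists_norm_sub_le_attErr hP₀ hNu
  obtain ⟨L₁, h₁⟩ := p.exists_norm_attErr_le
  obtain ⟨L₂, h₂⟩ := p.exists_norm_attGain_le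
  obtain ⟨L₃, h₃⟩ := exists_mulVec_bound p.C
  obtain ⟨L₄, h₄⟩ := exists_mulVec_bound p.Cᵀ
  obtain ⟨L₅, h₅⟩ := exists_mulVec_bound p.J
  obtain ⟨L₆, h₆⟩ := exists_mulVec_bound N⁻¹
  obtain ⟨L, hL⟩ : ∃ L, ∀ x ∈ ({L₁, L₂, L₃, L₄, L₅, L₆, K₁, 1, p.kI, 2 / p.kp} : Finset ℝ), x ≤ L :=
    Finset.exists_le _
  simp only [Finset.mem_insert, Finset.mem_singleton, forall_eq_or_imp, forall_eq] at hL
  obtain ⟨l1, l2, l3, l4, l5, l6, l7, hL1, hkI, hkp⟩ := hL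
  have hE := h₁ L l1
  have hG := h₂ L l2
  have hC := h₃ L l3
  have hCt := h₄ L l4
  have hJ := h₅ L l5
  have hNi := h₆ L l6
  have hinj := hK₁ L l7
  have hL0 : 0 < L := by linarith
  -- The residuals below are at most 192 L⁵ ε n, hence at most κn, as `hdec` requires.
  set ε := min ε₀ (min 1 (κ / (200 * L ^ 5))) with hε
  have hεpos : 0 < ε := lt_min hε₀ (lt_min one_pos (by positivity))
  have hε1 : ε ≤ 1 := (min_le_right _ _).trans (min_le_left _ _)
  have hεκ : 200 * L ^ 5 * ε ≤ κ := by
    have : ε ≤ κ / (200 * L ^ 5) := (min_le_right _ _).trans (min_le_right _ _)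
    rw [le_div_iff₀ (by positivity)] at this
    linarith
  have hεε₀ : ε ≤ ε₀ := min_le_left _ _
  have hqa : ∀ a : Fin 3 → ℝ, |-(1 / p.kp) * (a ⬝ᵥ N⁻¹ *ᵥ a)| ≤ 1 / p.kp * (3 * L) * ‖a‖ ^ 2 := by
    intro a
    have h1 := abs_dotProduct_le_card a (N⁻¹ *ᵥ a)
    have h2 := hNi a
    have hkp' : 0 < 1 / p.kp := one_div_pos.2 hp.kp_pos
    rw [abs_mul, abs_neg, abs_of_pos hkp', mul_assoc]
    gcongr
    refine h1.trans ?_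
    simp only [Fintype.card_fin, Nat.cast_ofNat]
    nlinarith [norm_nonneg a]
  refine ⟨B, e, μ, c, hc, max K₀ (1 / p.kp * (3 * L)) + L, by positivity, ε, hεpos, ?_, ?_, ?_⟩
  · intro R hR a v d
    obtain ⟨hb1, hb2⟩ := hb R hR a v d
    have hKK : K₀ ≤ max K₀ (1 / p.kp * (3 * L)) + L := (le_max_left _ _).trans (by linarith)
    have hq := abs_le.1 (hqa a)
    have hq2 : 1 / p.kp * (3 * L) * ‖a‖ ^ 2 ≤ (max K₀ (1 / p.kp * (3 * L)) + L) * ‖a‖ ^ 2 := by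
      gcongr
      exact (le_max_right _ _).trans (by linarith)
    have hq3 : K₀ * (‖v‖ ^ 2 + ‖d‖ ^ 2) ≤
      (max K₀ (1 / p.kp * (3 * L)) + L) * (‖v‖ ^ 2 + ‖d‖ ^ 2) := by gcongr
    have hq4 : 0 ≤ c * (‖v‖ ^ 2 + ‖d‖ ^ 2) := by positivity
    have hq5 : 0 ≤ (max K₀ (1 / p.kp * (3 * L)) + L) * (‖v‖ ^ 2 + ‖d‖ ^ 2) := by positivity
    generalize -(1 / p.kp) * (a ⬝ᵥ N⁻¹ *ᵥ a) = x at *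
    generalize 1 / p.kp * (3 * L) = y at *
    refine ⟨hb1, by linarith, abs_le.2 ⟨?_, ?_⟩⟩
    · linarith
    · linarith
  · intro P₁ P₂ h1 h2 b1 b2
    refine (hinj P₁ P₂ h1 h2 (b1.trans hεε₀) (b2.trans hεε₀)).trans ?_
    gcongr
    have : 0 ≤ max K₀ (1 / p.kp * (3 * L)) := hK₀.le.trans (le_max_left _ _)
    linarith
  intro R₁ R₂ P₁ P₂ o1 o2 q1 q2 Ω v₁ v₂ d₁ d₂ hΩ b1 b2 hR hv2 hd2
  have hD := hinj P₁ P₂ q1 q2 (b1.trans hεε₀) (b2.trans hεε₀)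
  set a := p.attErr P₁ - p.attErr P₂ with ha
  set v := v₁ - v₂ with hv
  set d := d₁ - d₂ with hd
  set n := ‖a‖ + ‖v‖ + ‖d‖ with hn
  have hna : ‖a‖ ≤ n := by rw [hn]; linarith [norm_nonneg v, norm_nonneg d]
  have hnv : ‖v‖ ≤ n := by rw [hn]; linarith [norm_nonneg a, norm_nonneg d]
  have hnd : ‖d‖ ≤ n := by rw [hn]; linarith [norm_nonneg v, norm_nonneg a]
  have hn0 : 0 ≤ n := (norm_nonneg a).trans hna
  set M₁ := p.attGain P₁
  set M₂ := p.attGain P₂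
  have gN : ‖N‖ ≤ L := (hG P₀).trans
    (mul_le_of_le_one_right hL0.le (Matrix.norm_le_one_of_mul_transpose hP₀))
  have gM₂ : ‖M₂‖ ≤ L := (hG P₂).trans
    (mul_le_of_le_one_right hL0.le (Matrix.norm_le_one_of_mul_transpose q2))
  have g1 : ‖M₁ - N‖ ≤ L * ε := by
    rw [hNdef, ← attGain_sub]
    exact (hG _).trans (by gcongr)
  have hDn : ‖P₁ - P₂‖ ≤ L * n := hD.trans (by gcongr)
  have g2 : ‖M₁ - M₂‖ ≤ L ^ 2 * n := by
    rw [← attGain_sub, sq, mul_assoc]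
    exact (hG _).trans (by gcongr)
  have g3 : ‖R₁ - R₂‖ ≤ 9 * (L * n) := hR.trans (by gcongr)
  have g4 : ‖p.attErr P₂‖ ≤ L * ε := by
    have : p.attErr P₂ = p.attErr (P₂ - P₀) := by rw [attErr_sub, hcrit, sub_zero]
    rw [this]
    exact (hE _).trans (by gcongr)
  have t1 : ‖R₁ᵀ‖ ≤ 1 := by
    rw [Matrix.norm_transpose]; exact Matrix.norm_le_one_of_mul_transpose o1
  have t2 : ‖R₂ᵀ‖ ≤ 1 := by
    rw [Matrix.norm_transpose]; exact Matrix.norm_le_one_of_mul_transpose o2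
  have g3' : ‖(R₁ - R₂)ᵀ‖ ≤ 9 * (L * n) := by rw [Matrix.norm_transpose]; exact g3
  have hCd : ‖p.C *ᵥ d‖ ≤ L * n := (hC d).trans (by gcongr)
  have hCd2 : ‖p.C *ᵥ d₂‖ ≤ L * ε := (hC d₂).trans (by gcongr)
  set ζ := R₁ᵀ *ᵥ (p.C *ᵥ d) with hζ
  have hζn : ‖ζ‖ ≤ 3 * 1 * (L * n) := norm_mulVec_le_of_le t1 hCd
  set ζ₂ := (R₁ - R₂)ᵀ *ᵥ (p.C *ᵥ d₂) with hζ₂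
  have hζ₂n : ‖ζ₂‖ ≤ 3 * (9 * (L * n)) * (L * ε) := norm_mulVec_le_of_le g3' hCd2
  set θ := R₁ᵀ *ᵥ (p.C *ᵥ d₂) with hθ
  have hθn : ‖θ‖ ≤ 3 * 1 * (L * ε) := norm_mulVec_le_of_le t1 hCd2
  set ξ₂ := R₂ᵀ *ᵥ (p.C *ᵥ d₂) + p.attErr P₂ + v₂ with hξ₂
  have pow1 : L ≤ L ^ 2 := by nlinarith
  have pow2 : L ^ 3 ≤ L ^ 5 := pow_le_pow_right₀ hL1 (by norm_num)
  have hξ₂n : ‖ξ₂‖ ≤ 5 * L * ε := by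
    have e1 : ‖R₂ᵀ *ᵥ (p.C *ᵥ d₂)‖ ≤ 3 * 1 * (L * ε) := norm_mulVec_le_of_le t2 hCd2
    have e2 : ε ≤ L * ε := le_mul_of_one_le_left hεpos.le hL1
    refine norm_add₃_le.trans ?_
    linarith
  have hξn : ‖ζ + ζ₂ + a + v‖ ≤ 32 * L ^ 2 * n := by
    have e1 : ‖ζ + ζ₂ + a + v‖ ≤ ‖ζ‖ + ‖ζ₂‖ + ‖a‖ + ‖v‖ :=
      (norm_add_le _ _).trans (add_le_add_left norm_add₃_le _)
    have e2 : L * n ≤ L ^ 2 * n := by gcongr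
    have e3 : n ≤ L * n := le_mul_of_one_le_left hn0 hL1
    have e4 : L ^ 2 * n * ε ≤ L ^ 2 * n := mul_le_of_le_one_right (by positivity) hε1
    have e5 : 3 * (9 * (L * n)) * (L * ε) = 27 * (L ^ 2 * n * ε) := by ring
    linarith
  have hfin : ∀ x, x ≤ 192 * (L ^ 5 * ε * n) → x ≤ κ * n := fun x hx => by
    have e1 : 0 ≤ L ^ 5 * ε * n := by positivity
    have e2 := mul_le_mul_of_nonneg_right hεκ hn0
    linarith
  have e35 : L ^ 3 * ε * n ≤ L ^ 5 * ε * n := by gcongr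
  -- Each residual term is a product of a factor of order ε and a difference of order n. Only the
  -- second trajectory and the two attitudes have to be close to the equilibrium; v₁ and d₁ enter
  -- through differences alone.
  have hr1 : ‖(M₁ - N) *ᵥ (ζ + ζ₂ + a + v) + (M₁ - M₂) *ᵥ ξ₂ + N *ᵥ ζ₂‖ ≤ κ * n := by
    refine hfin _ (norm_add₃_le.trans ?_)
    have e1 := norm_mulVec_le_of_le g1 hξn
    have e2 := norm_mulVec_le_of_le g2 hξ₂n
    have e3 := norm_mulVec_le_of_le gN hζ₂n
    have e4 : 3 * (L * ε) * (32 * L ^ 2 * n) + 3 * (L ^ 2 * n) * (5 * L * ε) +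
      3 * L * (3 * (9 * (L * n)) * (L * ε)) = 192 * (L ^ 3 * ε * n) := by ring
    linarith
  have hr2 : ‖-((M₁ - N) *ᵥ ζ + (M₁ - M₂) *ᵥ θ + M₂ *ᵥ ζ₂)‖ ≤ κ * n := by
    rw [norm_neg]
    refine hfin _ (norm_add₃_le.trans ?_)
    have e1 := norm_mulVec_le_of_le g1 hζn
    have e2 := norm_mulVec_le_of_le g2 hθn
    have e3 := norm_mulVec_le_of_le gM₂ hζ₂n
    have e4 : 3 * (L * ε) * (3 * 1 * (L * n)) = 9 * (L ^ 2 * ε * n) := by ring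
    have e5 : 3 * (L ^ 2 * n) * (3 * 1 * (L * ε)) + 3 * L * (3 * (9 * (L * n)) * (L * ε)) =
      90 * (L ^ 3 * ε * n) := by ring
    have e6 : L ^ 2 * ε * n ≤ L ^ 3 * ε * n := by
      gcongr
      norm_num
    have e7 : 0 ≤ L ^ 5 * ε * n := by positivity
    linarith
  set u₂ := M₂ᵀ *ᵥ (p.J *ᵥ v₂) + (2 / p.kp) • p.attErr P₂ with hu₂
  have hkp0 : 0 ≤ 2 / p.kp := div_nonneg zero_le_two hp.kp_pos.le
  have hJv : ‖p.J *ᵥ v‖ ≤ L * n := (hJ v).trans (by gcongr)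
  have hJv2 : ‖p.J *ᵥ v₂‖ ≤ L * ε := (hJ v₂).trans (by gcongr)
  have hu₂n : ‖u₂‖ ≤ 4 * L ^ 2 * ε := by
    have e1 : ‖M₂ᵀ *ᵥ (p.J *ᵥ v₂)‖ ≤ 3 * L * (L * ε) :=
      norm_mulVec_le_of_le (by rw [Matrix.norm_transpose]; exact gM₂) hJv2
    have e2 : ‖(2 / p.kp) • p.attErr P₂‖ ≤ L * (L * ε) := by
      rw [norm_smul, Real.norm_of_nonneg hkp0]
      gcongr
    refine (norm_add_le _ _).trans ((add_le_add e1 e2).trans (le_of_eq (by ring)))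
  set q := (M₁ - N)ᵀ *ᵥ (p.J *ᵥ v) + (M₁ - M₂)ᵀ *ᵥ (p.J *ᵥ v₂) with hq
  have hqn : ‖q‖ ≤ 6 * L ^ 3 * ε * n := by
    have e1 : ‖(M₁ - N)ᵀ *ᵥ (p.J *ᵥ v)‖ ≤ 3 * (L * ε) * (L * n) :=
      norm_mulVec_le_of_le (by rw [Matrix.norm_transpose]; exact g1) hJv
    have e2 : ‖(M₁ - M₂)ᵀ *ᵥ (p.J *ᵥ v₂)‖ ≤ 3 * (L ^ 2 * n) * (L * ε) :=
      norm_mulVec_le_of_le (by rw [Matrix.norm_transpose]; exact g2) hJv2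
    have e3 : 3 * (L * ε) * (L * n) = 3 * (L ^ 2 * ε * n) := by ring
    have e4 : 3 * (L ^ 2 * n) * (L * ε) = 3 * (L ^ 3 * ε * n) := by ring
    have e6 : L ^ 2 * ε * n ≤ L ^ 3 * ε * n := by
      gcongr
      norm_num
    refine (norm_add_le _ _).trans ?_
    linarith
  have hr3 : ‖p.kI • (p.Cᵀ *ᵥ (R₁ *ᵥ q + (R₁ - R₂) *ᵥ u₂))‖ ≤ κ * n := by
    have e1 : ‖R₁ *ᵥ q‖ ≤ 3 * 1 * (6 * L ^ 3 * ε * n) :=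
      norm_mulVec_le_of_le (Matrix.norm_le_one_of_mul_transpose o1) hqn
    have e2 : ‖(R₁ - R₂) *ᵥ u₂‖ ≤ 3 * (9 * (L * n)) * (4 * L ^ 2 * ε) :=
      norm_mulVec_le_of_le g3 hu₂n
    refine hfin _ ?_
    rw [norm_smul, Real.norm_of_nonneg hp.kI_pos.le]
    calc p.kI * ‖p.Cᵀ *ᵥ (R₁ *ᵥ q + (R₁ - R₂) *ᵥ u₂)‖
        ≤ L * (L * (3 * 1 * (6 * L ^ 3 * ε * n) + 3 * (9 * (L * n)) * (4 * L ^ 2 * ε))) := by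
          gcongr
          refine (hCt _).trans ?_
          gcongr
          exact (norm_add_le _ _).trans (add_le_add e1 e2)
      _ = 126 * (L ^ 5 * ε * n) := by ring
      _ ≤ _ := by gcongr; norm_num
  have key := hdec R₁ o1 Ω hΩ a v d _ _ _ hr1 hr2 hr3
  have f1 : p.errRate R₁ P₁ v₁ d₁ - p.errRate R₂ P₂ v₂ d₂ = N *ᵥ (R₁ᵀ *ᵥ (p.C *ᵥ d) + a + v) +
      ((M₁ - N) *ᵥ (ζ + ζ₂ + a + v) + (M₁ - M₂) *ᵥ ξ₂ + N *ᵥ ζ₂) := by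
    simp only [errRate, hζ, hζ₂, hξ₂, ha, hv, hd, Matrix.transpose_sub, Matrix.sub_mulVec,
      Matrix.mulVec_add, Matrix.mulVec_sub, M₁, M₂]
    abel
  have f2 : p.velRate R₁ P₁ v₁ d₁ - p.velRate R₂ P₂ v₂ d₂ =
      p.J⁻¹ *ᵥ ((2 / p.kp) • a - p.kD • v) - N *ᵥ (R₁ᵀ *ᵥ (p.C *ᵥ d)) +
      -((M₁ - N) *ᵥ ζ + (M₁ - M₂) *ᵥ θ + M₂ *ᵥ ζ₂) := by
    simp only [velRate, hζ, hζ₂, hθ, ha, hv, hd, Matrix.transpose_sub, Matrix.sub_mulVec,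
      Matrix.mulVec_sub, smul_sub, M₁, M₂]
    abel
  have f3 : p.regRate R₁ P₁ v₁ d₁ - p.regRate R₂ P₂ v₂ d₂ =
      p.S *ᵥ d + p.kI • (p.Cᵀ *ᵥ (R₁ *ᵥ (N *ᵥ (p.J *ᵥ v) + (2 / p.kp) • a))) +
      p.kI • (p.Cᵀ *ᵥ (R₁ *ᵥ q + (R₁ - R₂) *ᵥ u₂)) := by
    simp only [regRate, hq, hu₂, ha, hv, hd, Matrix.transpose_sub, hN, Matrix.sub_mulVec,
      Matrix.mulVec_add, Matrix.mulVec_sub, smul_sub, smul_add, Matrix.mulVec_smul, M₁, M₂]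
    abel
  rw [f1, f2, f3]
  exact key

end TrackingData

/-- The product f·exp(lt) is antitone. The rate l may be negative: with f(T) < 0 the lemma then
yields exponential growth of −f, which is the unstable case. -/
theorem le_mul_exp_of_hasDerivWithinAt_le {f f' : ℝ → ℝ} {T l : ℝ} (hT : 0 ≤ T)
    (hf : ∀ t ∈ Set.Ici T, HasDerivWithinAt f (f' t) (Set.Ici 0) t)
    (hl : ∀ t ∈ Set.Ici T, f' t ≤ -l * f t) {t : ℝ} (ht : T ≤ t) :
    f t ≤ f T * Real.exp (-l * (t - T)) := by
  have hg : ∀ t ∈ Set.Ici T, HasDerivWithinAt (fun s => f s * Real.exp (l * s))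
      (f' t * Real.exp (l * t) + f t * (Real.exp (l * t) * (l * 1))) (Set.Ici T) t := fun t ht =>
    ((hf t ht).mono (Set.Ici_subset_Ici.2 hT)).mul
      (((hasDerivAt_id t).const_mul l).exp.hasDerivWithinAt)
  have hanti : AntitoneOn (fun s => f s * Real.exp (l * s)) (Set.Ici T) := by
    refine antitoneOn_of_hasDerivWithinAt_nonpos (convex_Ici T)
      (fun t ht => (hg t ht).continuousWithinAt)
      (fun t ht => (hg t (interior_subset ht)).mono interior_subset) fun t ht => ?_
    have h := hl t (interior_subset ht)
    have : f' t * Real.exp (l * t) + f t * (Real.exp (l * t) * (l * 1)) =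
      (f' t + l * f t) * Real.exp (l * t) := by ring
    rw [this]
    exact mul_nonpos_of_nonpos_of_nonneg (by linarith) (Real.exp_nonneg _)
  have h := hanti Set.self_mem_Ici ht ht
  simp only at h
  have e : Real.exp (-l * (t - T)) = Real.exp (l * T) * Real.exp (-(l * t)) := by
    rw [← Real.exp_add]; ring_nf
  rw [e, ← mul_assoc, Real.exp_neg, ← div_eq_mul_inv, le_div_iff₀ (Real.exp_pos _)]
  exact h

namespace TrackingData

variable {m ν : ℕ} (p : TrackingData m ν)

theorem R_eq (z : BodyState m) :
    z.R = z.Rd * (p.Xr : Matrix (Fin 3) (Fin 3) ℝ)ᵀ * (p.attP z)ᵀ := by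
  rw [attP, Matrix.transpose_mul, Matrix.transpose_mul, Matrix.transpose_transpose,
    Matrix.transpose_transpose]
  calc z.R = z.Rd * (((p.Xr : Matrix (Fin 3) (Fin 3) ℝ)ᵀ * (p.Xr : Matrix (Fin 3) (Fin 3) ℝ)) *
        (z.Rdᵀ * z.R)) := by
        rw [p.Xr.transpose_mul_self, Matrix.one_mul, ← Matrix.mul_assoc, z.Rd_mul_transpose,
          Matrix.one_mul]
    _ = _ := by simp only [Matrix.mul_assoc]

theorem norm_R_sub_le {A : Matrix (Fin 3) (Fin 3) ℝ} (hA : ‖A‖ ≤ 1) (X : SO3)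
    (P₁ P₂ : Matrix (Fin 3) (Fin 3) ℝ) :
    ‖A * (X : Matrix (Fin 3) (Fin 3) ℝ)ᵀ * P₁ᵀ - A * (X : Matrix (Fin 3) (Fin 3) ℝ)ᵀ * P₂ᵀ‖ ≤
      9 * ‖P₁ - P₂‖ := by
  rw [← Matrix.mul_sub, ← Matrix.transpose_sub]
  have h1 := norm_mul_le_three A (X : Matrix (Fin 3) (Fin 3) ℝ)ᵀ
  have h2 := norm_mul_le_three (A * (X : Matrix (Fin 3) (Fin 3) ℝ)ᵀ) (P₁ - P₂)ᵀ
  rw [Matrix.norm_transpose] at h1 h2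
  have h3 := X.norm_le_one
  have h4 : ‖A * (X : Matrix (Fin 3) (Fin 3) ℝ)ᵀ‖ ≤ 3 := by
    nlinarith [norm_nonneg A, norm_nonneg (X : Matrix (Fin 3) (Fin 3) ℝ)]
  nlinarith [norm_nonneg (P₁ - P₂)]

/-- With R_d fixed, R = R_d X_rᵀ Pᵀ is a function of P. This is why trajectories are compared only
when they share the exosystem. -/
theorem norm_R_sub_R_le {z₁ z₂ : BodyState m} (h : z₁.Rd = z₂.Rd) :
    ‖z₁.R - z₂.R‖ ≤ 9 * ‖p.attP z₁ - p.attP z₂‖ := by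
  rw [p.R_eq z₁, p.R_eq z₂, ← h]
  exact norm_R_sub_le (SO3.norm_le_one z₁.2.1) _ _ _

/-- The form `lyap` at the error coordinates of a state. -/
noncomputable def stateLyap (N : Matrix (Fin 3) (Fin 3) ℝ) (B : Matrix (Fin m) (Fin m) ℝ)
    (e μ : ℝ) (z : BodyState m) : ℝ :=
  p.lyap N N⁻¹ B e μ z.R (p.attErr (p.attP z)) (p.Ωtilde z) (z.δ - z.w)

/-- The form `lyap` at the difference of the error coordinates of two states. -/
noncomputable def pairLyap (N : Matrix (Fin 3) (Fin 3) ℝ) (B : Matrix (Fin m) (Fin m) ℝ)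
    (e μ : ℝ) (z₁ z₂ : BodyState m) : ℝ :=
  p.lyap N N⁻¹ B e μ z₁.R (p.attErr (p.attP z₁) - p.attErr (p.attP z₂))
    (p.Ωtilde z₁ - p.Ωtilde z₂) (z₁.δ - z₁.w - (z₂.δ - z₂.w))

/-- The square size of the error coordinates of a state. -/
noncomputable def stateSq (z : BodyState m) : ℝ :=
  ‖p.attErr (p.attP z)‖ ^ 2 + ‖p.Ωtilde z‖ ^ 2 + ‖z.δ - z.w‖ ^ 2

/-- The square size of the difference of the error coordinates of two states. -/
noncomputable def pairSq (z₁ z₂ : BodyState m) : ℝ :=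
  ‖p.attErr (p.attP z₁) - p.attErr (p.attP z₂)‖ ^ 2 + ‖p.Ωtilde z₁ - p.Ωtilde z₂‖ ^ 2 +
    ‖z₁.δ - z₁.w - (z₂.δ - z₂.w)‖ ^ 2

theorem stateSq_nonneg (z : BodyState m) : 0 ≤ p.stateSq z := by
  unfold stateSq; positivity

variable {p}

theorem IsAdmissible.hasDeriv_err (hp : p.IsAdmissible) {z : ℝ → BodyState m}
    (hz : z ∈ p.solutions) {t : ℝ} (ht : t ∈ Set.Ici (0 : ℝ)) :
    HasDerivWithinAt (fun s => (z s).R) ((z t).R * hat (z t).Ω) (Set.Ici 0) t ∧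
    HasDerivWithinAt (fun s => p.attErr (p.attP (z s)))
      (p.errRate (z t).R (p.attP (z t)) (p.Ωtilde (z t)) ((z t).δ - (z t).w)) (Set.Ici 0) t ∧
    HasDerivWithinAt (fun s => p.Ωtilde (z s))
      (p.velRate (z t).R (p.attP (z t)) (p.Ωtilde (z t)) ((z t).δ - (z t).w)) (Set.Ici 0) t ∧
    HasDerivWithinAt (fun s => (z s).δ - (z s).w)
      (p.regRate (z t).R (p.attP (z t)) (p.Ωtilde (z t)) ((z t).δ - (z t).w)) (Set.Ici 0) t := by
  have hs := (p.mem_solutions_iff hp.J_inv_mul z).1 hz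
  have h1 := (hs t ht).1
  have h2 := hs.hasDeriv_attErr ht
  have h3 := hs.hasDeriv_Ωtilde hp.kp_pos hp.J_inv_mul ht
  have h4 := hs.hasDeriv_regErr hp.kp_pos hp.J_transpose ht
  simp only [one_smul] at h1 h2 h3 h4
  exact ⟨h1, h2, h3, h4⟩

/-- Constants for which `stateLyap` and `pairLyap` decrease along trajectories near a critical
attitude `P₀`. -/
structure IsLyapCone (p : TrackingData m ν) (P₀ : Matrix (Fin 3) (Fin 3) ℝ) (ρ : ℝ)
    (B : Matrix (Fin m) (Fin m) ℝ) (e μ c K ε : ℝ) : Prop where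
  c_pos : 0 < c
  K_pos : 0 < K
  ε_pos : 0 < ε
  lyap_ge : ∀ R : Matrix (Fin 3) (Fin 3) ℝ, ‖R‖ ≤ 1 → ∀ a v d,
    -(1 / p.kp) * (a ⬝ᵥ (p.attGain P₀)⁻¹ *ᵥ a) + c * (‖v‖ ^ 2 + ‖d‖ ^ 2) ≤
      p.lyap (p.attGain P₀) (p.attGain P₀)⁻¹ B e μ R a v d
  lyap_le : ∀ R : Matrix (Fin 3) (Fin 3) ℝ, ‖R‖ ≤ 1 → ∀ a v d,
    p.lyap (p.attGain P₀) (p.attGain P₀)⁻¹ B e μ R a v d ≤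
      -(1 / p.kp) * (a ⬝ᵥ (p.attGain P₀)⁻¹ *ᵥ a) + K * (‖v‖ ^ 2 + ‖d‖ ^ 2)
  abs_stateLyap_le : ∀ z : BodyState m,
    |p.stateLyap (p.attGain P₀) B e μ z| ≤ K * p.stateSq z
  abs_pairLyap_le : ∀ z₁ z₂ : BodyState m,
    |p.pairLyap (p.attGain P₀) B e μ z₁ z₂| ≤ K * p.pairSq z₁ z₂
  norm_sub_le : ∀ P₁ P₂ : Matrix (Fin 3) (Fin 3) ℝ, P₁ * P₁ᵀ = 1 → P₂ * P₂ᵀ = 1 →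
    ‖P₁ - P₀‖ ≤ ε → ‖P₂ - P₀‖ ≤ ε → ‖P₁ - P₂‖ ≤ K * ‖p.attErr P₁ - p.attErr P₂‖
  stateLyap_deriv : ∀ z ∈ p.solutions, ∀ t ∈ Set.Ici (0 : ℝ), ‖(z t).Ω‖ ≤ ρ →
    ‖p.attP (z t) - P₀‖ ≤ ε → ∃ W' : ℝ,
      HasDerivWithinAt (fun s => p.stateLyap (p.attGain P₀) B e μ (z s)) W' (Set.Ici 0) t ∧
      W' ≤ -c * p.stateSq (z t)
  pairLyap_deriv : ∀ z₁ ∈ p.solutions, ∀ z₂ ∈ p.solutions, ∀ t ∈ Set.Ici (0 : ℝ),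
    ‖(z₁ t).Ω‖ ≤ ρ → ‖p.attP (z₁ t) - P₀‖ ≤ ε → ‖p.attP (z₂ t) - P₀‖ ≤ ε →
    (z₁ t).Rd = (z₂ t).Rd → ‖p.Ωtilde (z₂ t)‖ ≤ ε → ‖(z₂ t).δ - (z₂ t).w‖ ≤ ε → ∃ W' : ℝ,
      HasDerivWithinAt (fun s => p.pairLyap (p.attGain P₀) B e μ (z₁ s) (z₂ s)) W'
        (Set.Ici 0) t ∧ W' ≤ -c * p.pairSq (z₁ t) (z₂ t)

theorem IsAdmissible.exists_isLyapCone (hp : p.IsAdmissible) {P₀ : Matrix (Fin 3) (Fin 3) ℝ}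
    (hP₀ : P₀ * P₀ᵀ = 1) (hdet : P₀.det = 1) (hcrit : p.attErr P₀ = 0) (ρ : ℝ) :
    ∃ (B : Matrix (Fin m) (Fin m) ℝ) (e μ c K ε : ℝ), p.IsLyapCone P₀ ρ B e μ c K ε := by
  obtain ⟨B, e, μ, c, hc, K, hK, ε, hε, hb, hinj, hdec⟩ := hp.exists_pair_lyap hP₀ hdet hcrit ρ
  refine ⟨B, e, μ, c, K, ε, hc, hK, hε, fun R hR a v d => (hb R hR a v d).1,
    fun R hR a v d => (hb R hR a v d).2.1, fun z => (hb _ (SO3.norm_le_one z.1) _ _ _).2.2,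
    fun z₁ z₂ => (hb _ (SO3.norm_le_one z₁.1) _ _ _).2.2, hinj, ?_, ?_⟩
  · intro z hz t ht hΩ hP
    obtain ⟨h1, h2, h3, h4⟩ := hp.hasDeriv_err hz ht
    refine ⟨_, p.hasDerivWithinAt_lyap _ _ _ _ _ h1 h2 h3 h4, ?_⟩
    -- The comparison state is the equilibrium (P₀, 0, 0) with the same R, whose rates vanish. As
    -- only the second state must be small, no smallness of Ω̃ or δ − w is required here; the proof
    -- that d → 0 depends on this.
    have h := hdec (z t).R (z t).R (p.attP (z t)) P₀ (z t).R_mul_transpose (z t).R_mul_transpose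
      (p.attP_mul_transpose _) hP₀ (z t).Ω (p.Ωtilde (z t)) 0 ((z t).δ - (z t).w) 0 hΩ hP
      (by simpa using hε.le) (by simp) (by simpa using hε.le) (by simpa using hε.le)
    have e1 : p.errRate (z t).R P₀ 0 (0 : Fin m → ℝ) = 0 := by simp [errRate, hcrit]
    have e2 : p.velRate (z t).R P₀ 0 (0 : Fin m → ℝ) = 0 := by simp [velRate, hcrit]
    have e3 : p.regRate (z t).R P₀ 0 (0 : Fin m → ℝ) = 0 := by simp [regRate, hcrit]
    rw [e1, e2, e3, hcrit] at h
    simp only [sub_zero] at h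
    exact h
  · intro z₁ hz₁ z₂ hz₂ t ht hΩ hP₁ hP₂ hRd hv hd
    obtain ⟨h1, h2, h3, h4⟩ := hp.hasDeriv_err hz₁ ht
    obtain ⟨-, h2', h3', h4'⟩ := hp.hasDeriv_err hz₂ ht
    exact ⟨_, p.hasDerivWithinAt_lyap _ _ _ _ _ h1 (h2.sub h2') (h3.sub h3') (h4.sub h4'),
      hdec _ _ _ _ (z₁ t).R_mul_transpose (z₂ t).R_mul_transpose (p.attP_mul_transpose _)
        (p.attP_mul_transpose _) _ _ _ _ _ hΩ hP₁ hP₂ (p.norm_R_sub_R_le hRd) hv hd⟩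

end TrackingData

/-! ### Error size versus distance to the target set. -/

namespace TrackingData

variable {m ν : ℕ} (p : TrackingData m ν)

/-- The size of the tracking error of a state. -/
noncomputable def errSize (z : BodyState m) : ℝ :=
  ‖p.attP z - 1‖ + ‖z.δ - z.w‖ + ‖p.errVel z‖

theorem errSize_nonneg (z : BodyState m) : 0 ≤ p.errSize z := by
  unfold errSize; positivity

theorem attP_of_mem_targetSet {z : BodyState m} (hz : z ∈ p.targetSet) : p.attP z = 1 := by
  rw [attP, hz.1, p.Xr.mul_transpose_self]

/-- The point of the target set with the same exosystem state. -/
def targetPoint (z : BodyState m) : BodyState m :=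
  (z.2.1 * p.Xr⁻¹, z.2.1, z.w, z.w, ((z.2.1 * p.Xr⁻¹ : SO3) : Matrix (Fin 3) (Fin 3) ℝ)ᵀ *ᵥ p.Ωd z)

theorem targetPoint_R (z : BodyState m) :
    (p.targetPoint z).R = z.Rd * (p.Xr : Matrix (Fin 3) (Fin 3) ℝ)ᵀ := rfl

theorem targetPoint_mem (z : BodyState m) : p.targetPoint z ∈ p.targetSet := by
  refine ⟨?_, rfl, rfl⟩
  rw [targetPoint_R, Matrix.transpose_mul, Matrix.transpose_transpose, Matrix.mul_assoc]
  rw [show (p.targetPoint z).Rd = z.Rd from rfl, mul_eq_one_comm.1 z.Rd_mul_transpose,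
    Matrix.mul_one]

theorem nonempty_targetSet : (p.targetSet : Set (BodyState m)).Nonempty :=
  ⟨_, p.targetPoint_mem (1, 1, 0, 0, 0)⟩

/-- The comparison point keeps R_d and w and corrects R, δ and Ω. Its velocity is RᵀCw at the
corrected attitude, so an attitude error costs a velocity error proportional to w; hence the bound ρ
on w. -/
theorem exists_infDist_le (ρ : ℝ) : ∃ K > 0, ∀ z : BodyState m, ‖z.w‖ ≤ ρ →
    Metric.infDist z p.targetSet ≤ K * p.errSize z := by
  obtain ⟨L, hL⟩ := exists_mulVec_bound p.C
  set L' := max L 0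
  have hC := hL L' (le_max_left _ _)
  have hL0 : 0 ≤ L' := le_max_right _ _
  refine ⟨9 + 27 * (L' * |ρ|), by positivity, fun z hz => ?_⟩
  refine (Metric.infDist_le_dist_of_mem (p.targetPoint_mem z)).trans ?_
  have n1 := norm_nonneg (p.attP z - 1)
  have n2 := norm_nonneg (z.δ - z.w)
  have n3 := norm_nonneg (p.errVel z)
  have n4 : 0 ≤ L' * |ρ| := by positivity
  have hR : ‖z.R - (p.targetPoint z).R‖ ≤ 9 * ‖p.attP z - 1‖ := by
    have h := norm_R_sub_le (A := z.Rd) (SO3.norm_le_one z.2.1) p.Xr (p.attP z) 1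
    rw [← R_eq, Matrix.transpose_one, Matrix.mul_one] at h
    exact h
  have hΩ : ‖z.Ω - (p.targetPoint z).Ω‖ ≤ ‖p.errVel z‖ + 27 * (L' * |ρ|) * ‖p.attP z - 1‖ := by
    have e : z.Ω - (p.targetPoint z).Ω =
        p.errVel z + (z.R - (p.targetPoint z).R)ᵀ *ᵥ (p.C *ᵥ z.w) := by
      rw [errVel_eq, Matrix.transpose_sub, Matrix.sub_mulVec]
      change _ - (p.targetPoint z).Rᵀ *ᵥ (p.C *ᵥ z.w) = z.Ω - z.Rᵀ *ᵥ (p.C *ᵥ z.w) + _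
      abel
    rw [e]
    refine (norm_add_le _ _).trans (add_le_add le_rfl ?_)
    have h1 : ‖(z.R - (p.targetPoint z).R)ᵀ *ᵥ (p.C *ᵥ z.w)‖ ≤
        3 * (9 * ‖p.attP z - 1‖) * (L' * |ρ|) :=
      norm_mulVec_le_of_le (by rw [Matrix.norm_transpose]; exact hR)
        ((hC _).trans (by gcongr; exact hz.trans (le_abs_self _)))
    exact h1.trans (le_of_eq (by ring))
  have hK : 0 ≤ (9 + 27 * (L' * |ρ|)) * p.errSize z :=
    mul_nonneg (by positivity) (p.errSize_nonneg z)
  have m1 := mul_nonneg n4 n1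
  have m2 := mul_nonneg n4 n2
  have m3 := mul_nonneg n4 n3
  have hexp : (9 + 27 * (L' * |ρ|)) * p.errSize z = 9 * ‖p.attP z - 1‖ + 9 * ‖z.δ - z.w‖ +
      9 * ‖p.errVel z‖ + 27 * (L' * |ρ| * ‖p.attP z - 1‖) + 27 * (L' * |ρ| * ‖z.δ - z.w‖) +
      27 * (L' * |ρ| * ‖p.errVel z‖) := by unfold errSize; ring
  rw [← BodyState.isometry_toAmbient.dist_eq, dist_eq_norm]
  refine norm_prod_le_iff.2 ⟨?_, norm_prod_le_iff.2 ⟨?_, norm_prod_le_iff.2 ⟨?_,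
    norm_prod_le_iff.2 ⟨?_, ?_⟩⟩⟩⟩
  · refine hR.trans ?_
    rw [hexp]; linarith
  · change ‖z.Rd - z.Rd‖ ≤ _
    rw [sub_self, norm_zero]; exact hK
  · change ‖z.δ - z.w‖ ≤ _
    rw [hexp]; linarith
  · change ‖z.w - z.w‖ ≤ _
    rw [sub_self, norm_zero]; exact hK
  · refine hΩ.trans ?_
    rw [hexp]; linarith

theorem exists_errSize_le (ρ : ℝ) : ∃ K > 0, ∀ z : BodyState m, ‖z.w‖ ≤ ρ →
    p.errSize z ≤ K * Metric.infDist z p.targetSet := by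
  obtain ⟨L, hL⟩ := exists_mulVec_bound p.C
  set L' := max L 0
  have hC := hL L' (le_max_left _ _)
  have hL0 : 0 ≤ L' := le_max_right _ _
  have hK : 0 < 21 + 3 * L' + 3 * (L' * |ρ|) := by positivity
  refine ⟨21 + 3 * L' + 3 * (L' * |ρ|), hK, fun z hz => ?_⟩
  rw [← div_le_iff₀' hK, Metric.le_infDist p.nonempty_targetSet]
  intro y hy
  rw [div_le_iff₀' hK]
  obtain ⟨D, hD⟩ : ∃ D, D = dist z y := ⟨_, rfl⟩
  have hd := hD.symm.le
  rw [← BodyState.isometry_toAmbient.dist_eq, dist_eq_norm] at hd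
  obtain ⟨dR, hd⟩ := norm_prod_le_iff.1 hd
  obtain ⟨dRd, hd⟩ := norm_prod_le_iff.1 hd
  obtain ⟨dδ, hd⟩ := norm_prod_le_iff.1 hd
  obtain ⟨dw, dΩ⟩ := norm_prod_le_iff.1 hd
  replace dR : ‖z.R - y.R‖ ≤ D := dR
  replace dRd : ‖z.Rd - y.Rd‖ ≤ D := dRd
  replace dδ : ‖z.δ - y.δ‖ ≤ D := dδ
  replace dw : ‖z.w - y.w‖ ≤ D := dw
  replace dΩ : ‖z.Ω - y.Ω‖ ≤ D := dΩ
  have hD0 : 0 ≤ D := (norm_nonneg _).trans dR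
  rw [← hD]
  have h1 : ‖p.attP z - 1‖ ≤ 18 * D := by
    have e : p.attP z - 1 = ((z.R - y.R)ᵀ * z.Rd + y.Rᵀ * (z.Rd - y.Rd)) *
        (p.Xr : Matrix (Fin 3) (Fin 3) ℝ)ᵀ := by
      rw [← p.attP_of_mem_targetSet hy, attP, attP, Matrix.transpose_sub, Matrix.sub_mul,
        Matrix.mul_sub, sub_add_sub_cancel, Matrix.sub_mul]
    have k1 := norm_mul_le_three (z.R - y.R)ᵀ z.Rd
    have k2 := norm_mul_le_three y.Rᵀ (z.Rd - y.Rd)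
    have k3 := norm_mul_le_three ((z.R - y.R)ᵀ * z.Rd + y.Rᵀ * (z.Rd - y.Rd))
      (p.Xr : Matrix (Fin 3) (Fin 3) ℝ)ᵀ
    have k4 := norm_add_le ((z.R - y.R)ᵀ * z.Rd) (y.Rᵀ * (z.Rd - y.Rd))
    rw [Matrix.norm_transpose] at k1 k2 k3
    have k5 : ‖z.Rd‖ ≤ 1 := SO3.norm_le_one z.2.1
    have k6 : ‖y.R‖ ≤ 1 := SO3.norm_le_one y.1
    have k7 := p.Xr.norm_le_one
    rw [e]
    have k8 : ‖(z.R - y.R)ᵀ * z.Rd‖ ≤ 3 * D := by nlinarith [norm_nonneg (z.R - y.R), norm_nonneg z.Rd]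
    have k9 : ‖y.Rᵀ * (z.Rd - y.Rd)‖ ≤ 3 * D := by
      nlinarith [norm_nonneg (z.Rd - y.Rd), norm_nonneg y.R]
    nlinarith [norm_nonneg ((z.R - y.R)ᵀ * z.Rd + y.Rᵀ * (z.Rd - y.Rd))]
  have h2 : ‖z.δ - z.w‖ ≤ 2 * D := by
    have e : z.δ - z.w = (z.δ - y.δ) - (z.w - y.w) := by rw [hy.2.1]; abel
    rw [e]
    exact (norm_sub_le _ _).trans (by linarith)
  have h3 : ‖p.errVel z‖ ≤ D + 3 * (L' * D) + 3 * (L' * |ρ|) * D := by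
    have e : p.errVel z = (z.Ω - y.Ω) + -(y.Rᵀ *ᵥ (p.C *ᵥ (z.w - y.w))) +
        -((z.R - y.R)ᵀ *ᵥ (p.C *ᵥ z.w)) := by
      rw [errVel_eq, hy.2.2, Ωd, Ωd, Matrix.transpose_sub, Matrix.sub_mulVec, Matrix.mulVec_sub,
        Matrix.mulVec_sub]
      abel
    have k1 : ‖y.Rᵀ *ᵥ (p.C *ᵥ (z.w - y.w))‖ ≤ 3 * 1 * (L' * D) :=
      norm_mulVec_le_of_le (by rw [Matrix.norm_transpose]; exact SO3.norm_le_one y.1)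
        ((hC _).trans (by gcongr))
    have k2 : ‖(z.R - y.R)ᵀ *ᵥ (p.C *ᵥ z.w)‖ ≤ 3 * D * (L' * |ρ|) :=
      norm_mulVec_le_of_le (by rw [Matrix.norm_transpose]; exact dR)
        ((hC _).trans (by gcongr; exact hz.trans (le_abs_self _)))
    rw [e]
    refine norm_add₃_le.trans ?_
    rw [norm_neg, norm_neg]
    linarith
  unfold errSize
  linarith

variable {p}

namespace IsAdmissible

variable (hp : p.IsAdmissible)
include hp

/-- Zero potential means that P fixes every y_i^r. Then P is critical and has the same gain as I,
which is negative definite, whereas a critical P ≠ I would have a gain with a positive eigenvalue.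
-/
theorem eq_one_of_attPot_eq_zero {P : Matrix (Fin 3) (Fin 3) ℝ} (hP : P * Pᵀ = 1)
    (hdet : P.det = 1) (h : p.attPot P = 0) : P = 1 := by
  have hfix : ∀ i, P *ᵥ p.yr i = p.yr i := fun i => by
    have h1 : ∑ i, (p.yr i - P *ᵥ p.yr i) ⬝ᵥ (p.yr i - P *ᵥ p.yr i) = 0 := by
      unfold attPot at h; linarith
    have h2 := (Finset.sum_eq_zero_iff_of_nonneg fun i _ =>
      (sq_nonneg _).trans (sq_norm_le_dotProduct_self (p.yr i - P *ᵥ p.yr i))).1 h1 i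
      (Finset.mem_univ i)
    exact (sub_eq_zero.1 (dotProduct_self_eq_zero.1 h2)).symm
  by_contra hne
  have ha : p.attErr P = 0 := by simp [attErr, hfix]
  have hg : p.attGain P = p.attGain 1 := by simp [attGain_eq, hfix]
  obtain ⟨u, τ, hu, hτ, hPu⟩ :=
    (p.critical_attitude hp.kp_pos hp.measurement hP hdet ha).2.2.2 hne
  have h1 := (p.critical_attitude (P := 1) hp.kp_pos hp.measurement (by simp) (by simp)
    p.attErr_one).2.2.1 rfl u hu
  rw [← hg, hPu, dotProduct_smul, smul_eq_mul] at h1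
  exact absurd h1 (not_lt.2 (mul_nonneg hτ.le
    ((sq_nonneg _).trans (sq_norm_le_dotProduct_self u))))

/-- On the compact set of rotations at distance at least ε from I the potential has a positive lower
bound. Low energy therefore confines P near I for all later times. -/
theorem exists_norm_sub_one_le_of_attPot {ε : ℝ} (hε : 0 < ε) : ∃ E > 0, ∀ z : BodyState m,
    p.attPot (p.attP z) ≤ E → ‖p.attP z - 1‖ ≤ ε := by
  have hc : IsCompact {X : SO3 | ε ≤ ‖(X : Matrix (Fin 3) (Fin 3) ℝ) - 1‖} := by
    refine IsClosed.isCompact ?_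
    exact isClosed_le continuous_const (continuous_subtype_val.sub continuous_const).norm
  obtain ⟨E, hE, h⟩ := hc.exists_forall_le'
    (f := fun X : SO3 => p.attPot (X : Matrix (Fin 3) (Fin 3) ℝ)) (a := 0)
    (p.continuous_attPot.comp continuous_subtype_val).continuousOn fun X hX => by
      refine lt_of_le_of_ne (p.attPot_nonneg _) fun h0 => ?_
      have := hp.eq_one_of_attPot_eq_zero X.mul_transpose_self X.det_eq_one h0.symm
      rw [Set.mem_ofPred_eq, this, sub_self, norm_zero] at hX
      linarith
  refine ⟨E / 2, by positivity, fun z hz => ?_⟩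
  by_contra hlt
  have hmem : p.attP z ∈ Matrix.specialOrthogonalGroup (Fin 3) ℝ :=
    Matrix.mem_specialOrthogonalGroup_iff.2
      ⟨(Matrix.mem_orthogonalGroup_iff _ _).2 (p.attP_mul_transpose z), p.det_attP z⟩
  have := h ⟨p.attP z, hmem⟩ (not_le.1 hlt).le
  simp only at this
  linarith

theorem attPot_le_energy (z : BodyState m) : p.attPot (p.attP z) ≤ p.energy z := by
  have h1 : 0 ≤ p.Ωtilde z ⬝ᵥ p.J *ᵥ p.Ωtilde z := by
    by_cases h : p.Ωtilde z = 0
    · simp [h]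
    · simpa using (hp.posDef.dotProduct_mulVec_pos h).le
  have h2 : 0 ≤ (z.δ - z.w) ⬝ᵥ (z.δ - z.w) :=
    (sq_nonneg _).trans (sq_norm_le_dotProduct_self _)
  have h3 : 0 ≤ 1 / (2 * p.kI) * ((z.δ - z.w) ⬝ᵥ (z.δ - z.w)) :=
    mul_nonneg (by have := hp.kI_pos; positivity) h2
  unfold energy
  linarith

end IsAdmissible

theorem exists_energy_le (p : TrackingData m ν) {E : ℝ} (hE : 0 < E) : ∃ η > 0,
    ∀ z : BodyState m, ‖p.attP z - 1‖ < η → ‖p.Ωtilde z‖ < η → ‖z.δ - z.w‖ < η → p.energy z < E := by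
  let g : Matrix (Fin 3) (Fin 3) ℝ × (Fin 3 → ℝ) × (Fin m → ℝ) → ℝ := fun x =>
    p.attPot x.1 + 1 / 2 * (x.2.1 ⬝ᵥ p.J *ᵥ x.2.1) + 1 / (2 * p.kI) * (x.2.2 ⬝ᵥ x.2.2)
  have hg : Continuous g := by
    have h1 : Continuous fun x : Matrix (Fin 3) (Fin 3) ℝ × (Fin 3 → ℝ) × (Fin m → ℝ) => x.2.1 :=
      continuous_fst.comp continuous_snd
    have h2 : Continuous fun x : Matrix (Fin 3) (Fin 3) ℝ × (Fin 3 → ℝ) × (Fin m → ℝ) => x.2.2 :=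
      continuous_snd.comp continuous_snd
    exact ((p.continuous_attPot.comp continuous_fst).add
      (continuous_const.mul (h1.dotProduct (continuous_const.matrix_mulVec h1)))).add
      (continuous_const.mul (h2.dotProduct h2))
  obtain ⟨η, hη, h⟩ := Metric.continuousAt_iff.1 (hg.continuousAt (x := (1, 0, 0))) E hE
  refine ⟨η, hη, fun z h1 h2 h3 => ?_⟩
  have h0 : g (1, 0, 0) = 0 := by simp [g, attPot]
  have := h (x := (p.attP z, p.Ωtilde z, z.δ - z.w)) (by
    rw [Prod.dist_eq, Prod.dist_eq]
    refine max_lt (by rwa [dist_eq_norm]) (max_lt ?_ ?_)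
    · rwa [dist_eq_norm, sub_zero]
    · rwa [dist_eq_norm, sub_zero])
  rw [h0, Real.dist_eq, sub_zero] at this
  exact (le_abs_self _).trans_lt this

end TrackingData

/-! ### Local exponential stability. -/

theorem LocallyExponentiallyStableOn.lyapunovStableOn {Z : Type*} [PseudoMetricSpace Z]
    {T : Set (ℝ → Z)} {A B : Set Z} (h : LocallyExponentiallyStableOn T A B) :
    LyapunovStableOn T A B := by
  obtain ⟨r, hr, K, hK, l, hl, h⟩ := h
  intro ε hε
  refine ⟨min r (ε / K), lt_min hr (by positivity), fun z hz hB hd t ht => ?_⟩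
  have h1 := h z hz hB (hd.trans_le (min_le_left _ _)) t ht
  have h2 := (lt_div_iff₀' hK).1 (hd.trans_le (min_le_right _ _))
  have h3 : Real.exp (-l * t) ≤ 1 := Real.exp_le_one_iff.2 (by nlinarith)
  have h4 : K * Real.exp (-l * t) * Metric.infDist (z 0) A ≤ K * 1 * Metric.infDist (z 0) A := by
    have := Metric.infDist_nonneg (x := z 0) (s := A)
    gcongr
  linarith

namespace TrackingData

variable {m ν : ℕ} (p : TrackingData m ν)

/-- The sum of the norms of the error coordinates of a state. -/
noncomputable def stateSum (z : BodyState m) : ℝ :=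
  ‖p.attErr (p.attP z)‖ + ‖p.Ωtilde z‖ + ‖z.δ - z.w‖

theorem stateSum_nonneg (z : BodyState m) : 0 ≤ p.stateSum z := by
  unfold stateSum; positivity

theorem stateSq_le (z : BodyState m) : p.stateSq z ≤ p.stateSum z ^ 2 := by
  unfold stateSq stateSum
  nlinarith [mul_nonneg (norm_nonneg (p.attErr (p.attP z))) (norm_nonneg (p.Ωtilde z)),
    mul_nonneg (norm_nonneg (p.attErr (p.attP z))) (norm_nonneg (z.δ - z.w)),
    mul_nonneg (norm_nonneg (p.Ωtilde z)) (norm_nonneg (z.δ - z.w))]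

theorem stateSum_sq_le (z : BodyState m) : p.stateSum z ^ 2 ≤ 3 * p.stateSq z := by
  unfold stateSq stateSum
  nlinarith [sq_nonneg (‖p.attErr (p.attP z)‖ - ‖p.Ωtilde z‖),
    sq_nonneg (‖p.attErr (p.attP z)‖ - ‖z.δ - z.w‖), sq_nonneg (‖p.Ωtilde z‖ - ‖z.δ - z.w‖)]

theorem exists_stateSum_le : ∃ K > 0, ∀ z : BodyState m, p.stateSum z ≤ K * p.errSize z := by
  obtain ⟨L, hL⟩ := exists_mulVec_bound p.C
  have hC := hL (max L 0) (le_max_left _ _)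
  have hL0 : 0 ≤ max L 0 := le_max_right _ _
  obtain ⟨A, hA⟩ := p.exists_norm_attErr_le
  have hE := hA (max A 0) (le_max_left _ _)
  have hA0 : 0 ≤ max A 0 := le_max_right _ _
  generalize max L 0 = L' at *
  generalize max A 0 = A' at *
  refine ⟨2 + 2 * A' + 3 * L', by positivity, fun z => ?_⟩
  have h1 : ‖p.attErr (p.attP z)‖ ≤ A' * ‖p.attP z - 1‖ := by
    have e : p.attErr (p.attP z) = p.attErr (p.attP z - 1) := by
      rw [attErr_sub, attErr_one, sub_zero]
    rw [e]
    exact hE _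
  have h2 : ‖p.Ωtilde z‖ ≤ ‖p.errVel z‖ + ‖p.attErr (p.attP z)‖ + 3 * L' * ‖z.δ - z.w‖ := by
    have e : p.Ωtilde z = p.errVel z + -p.attErr (p.attP z) +
        -(z.Rᵀ *ᵥ (p.C *ᵥ (z.δ - z.w))) := by
      rw [errVel]; abel
    rw [e]
    refine norm_add₃_le.trans ?_
    rw [norm_neg, norm_neg]
    have : ‖z.Rᵀ *ᵥ (p.C *ᵥ (z.δ - z.w))‖ ≤ 3 * 1 * (L' * ‖z.δ - z.w‖) :=
      norm_mulVec_le_of_le (by rw [Matrix.norm_transpose]; exact SO3.norm_le_one z.1) (hC _)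
    linarith
  have m1 := mul_nonneg hA0 (norm_nonneg (p.attP z - 1))
  have m2 := mul_nonneg hA0 (norm_nonneg (z.δ - z.w))
  have m3 := mul_nonneg hA0 (norm_nonneg (p.errVel z))
  have m4 := mul_nonneg hL0 (norm_nonneg (p.attP z - 1))
  have m5 := mul_nonneg hL0 (norm_nonneg (p.errVel z))
  have n1 := norm_nonneg (p.attP z - 1)
  have n2 := norm_nonneg (z.δ - z.w)
  have n3 := norm_nonneg (p.errVel z)
  unfold stateSum errSize
  linarith

theorem exists_errSize_le_stateSum (k : ℝ) : ∃ K > 0, ∀ z : BodyState m,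
    ‖p.attP z - 1‖ ≤ k * ‖p.attErr (p.attP z)‖ → p.errSize z ≤ K * p.stateSum z := by
  obtain ⟨L, hL⟩ := exists_mulVec_bound p.C
  have hC := hL (max L 0) (le_max_left _ _)
  have hL0 : 0 ≤ max L 0 := le_max_right _ _
  generalize max L 0 = L' at *
  refine ⟨2 + 3 * L' + |k|, by positivity, fun z hz => ?_⟩
  have h1 : ‖p.errVel z‖ ≤ 3 * L' * ‖z.δ - z.w‖ + ‖p.attErr (p.attP z)‖ + ‖p.Ωtilde z‖ := by
    rw [errVel]
    refine norm_add₃_le.trans ?_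
    have : ‖z.Rᵀ *ᵥ (p.C *ᵥ (z.δ - z.w))‖ ≤ 3 * 1 * (L' * ‖z.δ - z.w‖) :=
      norm_mulVec_le_of_le (by rw [Matrix.norm_transpose]; exact SO3.norm_le_one z.1) (hC _)
    linarith
  have h2 : k * ‖p.attErr (p.attP z)‖ ≤ |k| * ‖p.attErr (p.attP z)‖ := by
    gcongr; exact le_abs_self _
  have m1 := mul_nonneg hL0 (norm_nonneg (p.attErr (p.attP z)))
  have m2 := mul_nonneg hL0 (norm_nonneg (p.Ωtilde z))
  have m3 := mul_nonneg (abs_nonneg k) (norm_nonneg (z.δ - z.w))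
  have m4 := mul_nonneg (abs_nonneg k) (norm_nonneg (p.Ωtilde z))
  have n1 := norm_nonneg (p.attErr (p.attP z))
  have n2 := norm_nonneg (z.δ - z.w)
  have n3 := norm_nonneg (p.Ωtilde z)
  unfold stateSum errSize
  linarith

theorem norm_Ω_le (z : BodyState m) : ‖z.Ω‖ ≤ ‖z.toAmbient‖ :=
  (norm_snd_le (z.w, z.Ω)).trans ((norm_snd_le (z.δ, z.w, z.Ω)).trans
    ((norm_snd_le (z.Rd, z.δ, z.w, z.Ω)).trans (norm_snd_le z.toAmbient)))

variable {p}

/-- At the identity N is negative definite, hence so is N⁻¹, and every term of the main part of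
`lyap` is positive. -/
theorem IsLyapCone.exists_stateSq_le (hp : p.IsAdmissible) {ρ : ℝ}
    {B : Matrix (Fin m) (Fin m) ℝ} {e μ c K ε : ℝ} (h : p.IsLyapCone 1 ρ B e μ c K ε) :
    ∃ c₁ > 0, ∀ z : BodyState m, c₁ * p.stateSq z ≤ p.stateLyap (p.attGain 1) B e μ z := by
  obtain ⟨-, hNu, hneg, -⟩ := p.critical_attitude (P := 1) hp.kp_pos hp.measurement (by simp)
    (by simp) p.attErr_one
  set N := p.attGain 1
  obtain ⟨j, hj, hjq⟩ := exists_norm_sq_le_of_pos (A := -N⁻¹) fun v hv => by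
    have e : N *ᵥ (N⁻¹ *ᵥ v) = v := by
      rw [Matrix.mulVec_mulVec, Matrix.mul_nonsing_inv _ hNu, Matrix.one_mulVec]
    have := hneg rfl (N⁻¹ *ᵥ v) (by
      rintro h0
      rw [h0, Matrix.mulVec_zero] at e
      exact hv e.symm)
    rw [e] at this
    rw [Matrix.neg_mulVec, dotProduct_neg, dotProduct_comm]
    linarith
  have hc := h.c_pos
  have hkp : 0 < 1 / p.kp := one_div_pos.2 hp.kp_pos
  refine ⟨min (1 / p.kp * j) c, lt_min (by positivity) hc, fun z => ?_⟩
  have h1 := h.lyap_ge z.R (SO3.norm_le_one z.1) (p.attErr (p.attP z)) (p.Ωtilde z) (z.δ - z.w)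
  have h2 := mul_le_mul_of_nonneg_left (hjq (p.attErr (p.attP z))) hkp.le
  rw [Matrix.neg_mulVec, dotProduct_neg] at h2
  have h3 : min (1 / p.kp * j) c * ‖p.attErr (p.attP z)‖ ^ 2 ≤
      1 / p.kp * j * ‖p.attErr (p.attP z)‖ ^ 2 := by
    gcongr; exact min_le_left _ _
  have h4 : min (1 / p.kp * j) c * (‖p.Ωtilde z‖ ^ 2 + ‖z.δ - z.w‖ ^ 2) ≤
      c * (‖p.Ωtilde z‖ ^ 2 + ‖z.δ - z.w‖ ^ 2) := by
    gcongr; exact min_le_right _ _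
  have e1 : min (1 / p.kp * j) c * p.stateSq z = min (1 / p.kp * j) c *
      ‖p.attErr (p.attP z)‖ ^ 2 + min (1 / p.kp * j) c * (‖p.Ωtilde z‖ ^ 2 + ‖z.δ - z.w‖ ^ 2) := by
    unfold stateSq; ring
  rw [e1]
  refine le_trans ?_ h1
  rw [mul_assoc] at h3
  rw [neg_mul]
  rw [mul_neg] at h2
  exact add_le_add (h3.trans h2) h4

/-- Monotonicity of the energy keeps P within the validity range of the quadratic form for all
times. There `stateLyap` is comparable to the squared error and decays at rate c/K, and the error is
comparable to the distance to the target set. -/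
theorem IsAdmissible.locallyExponentiallyStableOn (hp : p.IsAdmissible) (ρ : ℝ) :
    LocallyExponentiallyStableOn p.solutions p.targetSet {z : BodyState m | ‖z.w‖ ≤ ρ} := by
  obtain ⟨ρ', -, hb⟩ := hp.exists_bound_of_energy_le 1 ρ
  obtain ⟨B, e, μ, c, K, ε, hcone⟩ := hp.exists_isLyapCone (P₀ := 1) (by simp) (by simp)
    p.attErr_one ρ'
  obtain ⟨c₁, hc₁, hlow⟩ := hcone.exists_stateSq_le hp
  obtain ⟨E, hE, hEP⟩ := hp.exists_norm_sub_one_le_of_attPot hcone.ε_pos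
  obtain ⟨η, hη, hηE⟩ := p.exists_energy_le (lt_min hE one_pos)
  obtain ⟨K₁, hK₁, hup⟩ := p.exists_infDist_le (√m * ρ)
  obtain ⟨K₂, hK₂, hdn⟩ := p.exists_errSize_le ρ
  obtain ⟨K₃, hK₃, hsum⟩ := p.exists_stateSum_le
  obtain ⟨K₄, hK₄, herr⟩ := p.exists_errSize_le_stateSum K
  have hc := hcone.c_pos
  have hK := hcone.K_pos
  -- The radius makes both the initial error size and the initial coordinate sum smaller than η. The
  -- rate c/K is halved, and the square root appears, on passing from squares to norms.
  refine ⟨η / (2 * (K₃ + 1) * K₂), by positivity, K₁ * (K₄ * (√(3 * (K / c₁)) * (K₃ * K₂))),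
    by positivity, c / K / 2, by positivity, fun z hz hw hd t ht => ?_⟩
  have hsc := (p.mem_solutions_iff hp.J_inv_mul z).1 hz
  have hd0 := Metric.infDist_nonneg (x := z 0) (s := p.targetSet)
  rw [lt_div_iff₀ (by positivity)] at hd
  have he0 := hdn (z 0) hw
  have hs0 := hsum (z 0)
  have hse : p.errSize (z 0) < η ∧ p.stateSum (z 0) < η := by
    have h1 : 0 ≤ K₂ * Metric.infDist (z 0) p.targetSet := by positivity
    have h2 : K₃ * p.errSize (z 0) ≤ K₃ * (K₂ * Metric.infDist (z 0) p.targetSet) := by gcongr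
    have h3 := mul_nonneg hK₃.le h1
    constructor <;> nlinarith
  have hE0 : p.energy (z 0) < min E 1 := by
    have n1 := norm_nonneg (p.attP (z 0) - 1)
    have n2 := norm_nonneg ((z 0).δ - (z 0).w)
    have n3 := norm_nonneg (p.errVel (z 0))
    have n4 := norm_nonneg (p.Ωtilde (z 0))
    have n5 := norm_nonneg (p.attErr (p.attP (z 0)))
    unfold errSize stateSum at hse
    exact hηE _ (by linarith) (by linarith) (by linarith)
  have hbt := hb _ z (fun _ => zero_le_one) hsc (hE0.le.trans (min_le_right _ _)) hw
  have hPt : ∀ t ∈ Set.Ici (0 : ℝ), ‖p.attP (z t) - 1‖ ≤ ε := fun t ht =>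
    hEP _ ((hp.attPot_le_energy _).trans
      ((hp.antitoneOn_energy hsc (fun _ => zero_le_one) Set.self_mem_Ici ht ht).trans
        (hE0.le.trans (min_le_left _ _))))
  have hder : ∀ t, t ∈ Set.Ici (0 : ℝ) → ∃ W' : ℝ,
      HasDerivWithinAt (fun s => p.stateLyap (p.attGain 1) B e μ (z s)) W' (Set.Ici 0) t ∧
      W' ≤ -c * p.stateSq (z t) := fun t ht =>
    hcone.stateLyap_deriv z hz t ht ((norm_Ω_le _).trans (hbt t ht).1) (hPt t ht)
  choose! W' hW' hW'le using hder
  have hdec := le_mul_exp_of_hasDerivWithinAt_le (l := c / K) le_rfl hW' (fun t ht => by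
    refine (hW'le t ht).trans ?_
    have h1 := (abs_le.1 (hcone.abs_stateLyap_le (z t))).2
    have h2 := mul_le_mul_of_nonneg_left h1 (div_pos hc hK).le
    rw [← mul_assoc, div_mul_cancel₀ _ hK.ne'] at h2
    linarith) ht
  rw [sub_zero] at hdec
  have h1 := hlow (z t)
  have h2 := (abs_le.1 (hcone.abs_stateLyap_le (z 0))).2
  have h3 : p.stateSum (z t) ^ 2 ≤
      (√(3 * (K / c₁)) * Real.exp (-(c / K / 2) * t) * p.stateSum (z 0)) ^ 2 := by
    have e1 : (√(3 * (K / c₁)) * Real.exp (-(c / K / 2) * t) * p.stateSum (z 0)) ^ 2 =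
        3 * (K / c₁) * Real.exp (-(c / K) * t) * p.stateSum (z 0) ^ 2 := by
      rw [mul_pow, mul_pow, Real.sq_sqrt (by positivity), ← Real.exp_nat_mul]
      congr 3
      push_cast
      ring
    rw [e1]
    calc p.stateSum (z t) ^ 2 ≤ 3 * p.stateSq (z t) := p.stateSum_sq_le _
      _ = 3 / c₁ * (c₁ * p.stateSq (z t)) := by field_simp
      _ ≤ 3 / c₁ * ((K * p.stateSum (z 0) ^ 2) * Real.exp (-(c / K) * t)) := by
          refine mul_le_mul_of_nonneg_left (h1.trans (hdec.trans
            (mul_le_mul_of_nonneg_right (h2.trans ?_) (Real.exp_nonneg _)))) (by positivity)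
          exact mul_le_mul_of_nonneg_left (p.stateSq_le _) hK.le
      _ = _ := by ring
  have h4 : p.stateSum (z t) ≤
      √(3 * (K / c₁)) * Real.exp (-(c / K / 2) * t) * p.stateSum (z 0) :=
    abs_le_of_sq_le_sq' h3 (mul_nonneg (by positivity) (p.stateSum_nonneg _)) |>.2
  have hwt : ‖(z t).w‖ ≤ √m * ρ := (hp.norm_w_le hsc ht).trans (by gcongr; exact hw)
  have hPa : ‖p.attP (z t) - 1‖ ≤ K * ‖p.attErr (p.attP (z t))‖ := by
    have := hcone.norm_sub_le (p.attP (z t)) 1 (p.attP_mul_transpose _) (by simp) (hPt t ht)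
      (by simpa using hcone.ε_pos.le)
    rwa [attErr_one, sub_zero] at this
  calc Metric.infDist (z t) p.targetSet ≤ K₁ * p.errSize (z t) := hup _ hwt
    _ ≤ K₁ * (K₄ * p.stateSum (z t)) := by gcongr; exact herr _ hPa
    _ ≤ K₁ * (K₄ * (√(3 * (K / c₁)) * Real.exp (-(c / K / 2) * t) *
          (K₃ * (K₂ * Metric.infDist (z 0) p.targetSet)))) := by
        gcongr
        refine h4.trans ?_
        gcongr
        exact hs0.trans (by gcongr)
    _ = _ := by ring

end TrackingData

/-! ### Convergence of every trajectory to a critical equilibrium. -/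

/-- Barbalat's lemma: a uniformly continuous nonnegative decay rate of a function that is bounded
below tends to zero. -/
theorem tendsto_zero_of_hasDerivWithinAt_le {V f : ℝ → ℝ} {T b : ℝ} (hT : 0 ≤ T)
    (hV : ∀ t ∈ Set.Ici T, ∃ V', HasDerivWithinAt V V' (Set.Ici 0) t ∧ V' ≤ -f t)
    (hb : ∀ t ∈ Set.Ici T, b ≤ V t) (hf0 : ∀ t, 0 ≤ f t)
    (hf : UniformContinuousOn f (Set.Ici 0)) : Tendsto f atTop (𝓝 0) := by
  choose! V' hV' hle using hV
  have hTT : Set.Ici T ⊆ Set.Ici (0 : ℝ) := Set.Ici_subset_Ici.2 hT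
  have hanti : ∀ k : ℝ, ∀ s t : ℝ, T ≤ s → s ≤ t → (∀ x ∈ Set.Icc s t, k ≤ f x) →
      V t + k * t ≤ V s + k * s := by
    intro k s t hs hst hk
    have hd : ∀ x ∈ Set.Icc s t, HasDerivWithinAt (fun x => V x + k * x) (V' x + k * 1)
        (Set.Icc s t) x := fun x hx =>
      ((hV' x (hs.trans hx.1)).mono fun y hy => hTT (hs.trans hy.1)).add
        ((hasDerivAt_id x).const_mul k).hasDerivWithinAt
    have : AntitoneOn (fun x => V x + k * x) (Set.Icc s t) := by
      refine antitoneOn_of_hasDerivWithinAt_nonpos (convex_Icc s t)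
        (fun x hx => (hd x hx).continuousWithinAt)
        (fun x hx => (hd x (interior_subset hx)).mono interior_subset) fun x hx => ?_
      have h1 := hle x (hs.trans (interior_subset hx).1)
      have h2 := hk x (interior_subset hx)
      linarith
    exact this ⟨le_rfl, hst⟩ ⟨hst, le_rfl⟩ hst
  rw [Metric.tendsto_atTop]
  by_contra hcon
  push Not at hcon
  obtain ⟨δ, hδ, hfreq⟩ := hcon
  obtain ⟨τ, hτ, huc⟩ := Metric.uniformContinuousOn_iff.1 hf (δ / 2) (by positivity)
  have hbdd : BddBelow (V '' Set.Ici T) := ⟨b, by rintro _ ⟨t, ht, rfl⟩; exact hb t ht⟩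
  have hne : (V '' Set.Ici T).Nonempty := ⟨_, T, Set.self_mem_Ici, rfl⟩
  -- After t₀ the function V can drop by less than (δ/2)(τ/2) in total. A later time with f ≥ δ
  -- would force f ≥ δ/2 during a time τ/2, and hence a drop of at least that much.
  obtain ⟨_, ⟨t₀, ht₀, rfl⟩, hlt⟩ := exists_lt_of_csInf_lt hne
    (lt_add_of_pos_right (sInf (V '' Set.Ici T)) (show 0 < δ / 2 * (τ / 2) by positivity))
  obtain ⟨t, htt, hft⟩ := hfreq t₀
  rw [Real.dist_eq, sub_zero, abs_of_nonneg (hf0 t)] at hft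
  have htT : T ≤ t := le_trans ht₀ htt
  have h1 := hanti (δ / 2) t (t + τ / 2) htT (by linarith) fun x hx => by
    have hxt : dist x t < τ := by
      rw [Real.dist_eq, abs_of_nonneg (by linarith [hx.1])]; linarith [hx.2]
    have := huc x (hT.trans (htT.trans hx.1)) t (hT.trans htT) hxt
    rw [Real.dist_eq] at this
    linarith [(abs_lt.1 this).1]
  have h2 := hanti 0 t₀ t ht₀ htt fun x _ => hf0 x
  have h3 := csInf_le hbdd ⟨t + τ / 2, (by linarith : T ≤ t + τ / 2), rfl⟩
  linarith

namespace TrackingData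

variable {m ν : ℕ} {p : TrackingData m ν}

/-- The attitude error as an element of `SO(3)`. -/
def attSO (p : TrackingData m ν) (z : BodyState m) : SO3 :=
  ⟨p.attP z, Matrix.mem_specialOrthogonalGroup_iff.2
    ⟨(Matrix.mem_orthogonalGroup_iff _ _).2 (p.attP_mul_transpose z), p.det_attP z⟩⟩

namespace IsAdmissible

variable (hp : p.IsAdmissible)
include hp

theorem exists_norm_le_of_mem_solutions {z : ℝ → BodyState m} (hz : z ∈ p.solutions) :
    ∃ ρ : ℝ, 1 ≤ ρ ∧ ∀ t ∈ Set.Ici (0 : ℝ), ‖(z t).toAmbient‖ ≤ ρ ∧ ‖p.Ωtilde (z t)‖ ≤ ρ ∧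
      ‖(z t).δ - (z t).w‖ ≤ ρ ∧ ‖p.attErr (p.attP (z t))‖ ≤ ρ := by
  obtain ⟨ρ, h1, h⟩ := hp.exists_bound ‖(z 0).toAmbient‖
  exact ⟨ρ, h1, h _ z (fun _ => zero_le_one) ((p.mem_solutions_iff hp.J_inv_mul z).1 hz) le_rfl⟩

/-- A bounded trajectory has bounded velocity, so it is Lipschitz, and g is uniformly continuous on
the compact ball that contains it. -/
theorem uniformContinuousOn_comp {z : ℝ → BodyState m} (hz : z ∈ p.solutions)
    {g : BodyState m → ℝ} (hg : Continuous g) :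
    UniformContinuousOn (fun t => g (z t)) (Set.Ici 0) := by
  obtain ⟨ρ, -, hρ⟩ := hp.exists_norm_le_of_mem_solutions hz
  obtain ⟨L, hL⟩ := (isCompact_closedBall (0 : AmbientState m) ρ).exists_bound_of_continuousOn
    p.contDiff_field.continuous.continuousOn
  have hlip : ∀ s ∈ Set.Ici (0 : ℝ), ∀ t ∈ Set.Ici (0 : ℝ), dist (z s) (z t) ≤ |L| * dist s t :=
    fun s hs t ht => by
      rw [← BodyState.isometry_toAmbient.dist_eq, dist_eq_norm, dist_eq_norm]
      exact (convex_Ici (0 : ℝ)).norm_image_sub_le_of_norm_hasDerivWithin_le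
        (fun x hx => hp.hasDerivWithinAt_of_mem_solutions hz hx)
        (fun x hx => (hL _ (by simpa using (hρ x hx).1)).trans (le_abs_self L)) ht hs
  have huz : UniformContinuousOn z (Set.Ici 0) :=
    (LipschitzOnWith.of_dist_le_mul (K := ⟨|L|, abs_nonneg L⟩) hlip).uniformContinuousOn
  exact ((isCompact_norm_le ρ).uniformContinuousOn_of_continuous hg.continuousOn).comp huz
    fun t ht => (hρ t ht).1

theorem tendsto_attErr_Ωtilde {z : ℝ → BodyState m} (hz : z ∈ p.solutions) :
    Tendsto (fun t => ‖p.attErr (p.attP (z t))‖ ^ 2 + ‖p.Ωtilde (z t)‖ ^ 2) atTop (𝓝 0) := by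
  set k := min (2 / p.kp) p.kD
  have hk : 0 < k := lt_min (div_pos two_pos hp.kp_pos) hp.kD_pos
  have hcont : Continuous fun z : BodyState m =>
      k * (‖p.attErr (p.attP z)‖ ^ 2 + ‖p.Ωtilde z‖ ^ 2) :=
    continuous_const.mul (((p.continuous_attErr.comp p.continuous_attP).norm.pow 2).add
      (p.continuous_Ωtilde.norm.pow 2))
  have h := tendsto_zero_of_hasDerivWithinAt_le (V := fun t => p.energy (z t)) (T := 0) (b := 0)
    le_rfl (fun t ht => ⟨_, ((p.mem_solutions_iff hp.J_inv_mul z).1 hz).hasDeriv_energy hp.kp_pos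
      hp.kI_pos hp.J_transpose hp.J_inv_mul hp.skew ht, ?_⟩)
    (fun t _ => (p.attPot_nonneg _).trans (hp.attPot_le_energy _))
    (fun t => mul_nonneg hk.le (by positivity)) (hp.uniformContinuousOn_comp hz hcont)
  · have h2 := h.const_mul k⁻¹
    rw [mul_zero] at h2
    refine h2.congr fun t => ?_
    rw [inv_mul_cancel_left₀ hk.ne']
  · have h1 := sq_norm_le_dotProduct_self (p.attErr (p.attP (z t)))
    have h2 := sq_norm_le_dotProduct_self (p.Ωtilde (z t))
    have h3 := mul_le_mul (min_le_left (2 / p.kp) p.kD) h1 (sq_nonneg _)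
      (div_pos two_pos hp.kp_pos).le
    have h4 := mul_le_mul (min_le_right (2 / p.kp) p.kD) h2 (sq_nonneg _) hp.kD_pos.le
    rw [one_mul, mul_add, neg_mul]
    change k * _ ≤ _ at h3
    change k * _ ≤ _ at h4
    generalize 2 / p.kp * (p.attErr (p.attP (z t)) ⬝ᵥ p.attErr (p.attP (z t))) = x at *
    linarith

theorem tendsto_norm_attErr {z : ℝ → BodyState m} (hz : z ∈ p.solutions) :
    Tendsto (fun t => ‖p.attErr (p.attP (z t))‖) atTop (𝓝 0) := by
  have h := (hp.tendsto_attErr_Ωtilde hz).sqrt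
  rw [Real.sqrt_zero] at h
  refine squeeze_zero (fun t => norm_nonneg _) (fun t => Real.le_sqrt_of_sq_le ?_) h
  have := sq_nonneg ‖p.Ωtilde (z t)‖
  linarith

/-- The attitude error converges to a critical attitude. -/
theorem exists_tendsto_attP {z : ℝ → BodyState m} (hz : z ∈ p.solutions) :
    ∃ X : SO3, p.attErr X = 0 ∧
      Tendsto (fun t => ‖p.attP (z t) - (X : Matrix (Fin 3) (Fin 3) ℝ)‖) atTop (𝓝 0) := by
  have ha := hp.tendsto_norm_attErr hz
  obtain ⟨X, -, hX⟩ := (isCompact_univ (X := SO3)).exists_mapClusterPt (f := atTop)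
    (u := fun t => p.attSO (z t)) (by simp)
  have hcrit : p.attErr X = 0 := by
    have hc : Continuous fun X : SO3 => p.attErr (X : Matrix (Fin 3) (Fin 3) ℝ) :=
      p.continuous_attErr.comp continuous_subtype_val
    have h1 := hX.continuousAt_comp hc.continuousAt
    have h2 : Tendsto (fun t => p.attErr (p.attP (z t))) atTop (𝓝 0) :=
      tendsto_zero_iff_norm_tendsto_zero.2 ha
    have h3 : ClusterPt (p.attErr X) (𝓝 0) := ClusterPt.mono h1 h2
    exact eq_of_nhds_neBot h3
  refine ⟨X, hcrit, ?_⟩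
  obtain ⟨-, hNu, -⟩ := p.critical_attitude hp.kp_pos hp.measurement X.mul_transpose_self
    X.det_eq_one hcrit
  obtain ⟨ε, hε, K', hK'⟩ := p.exists_norm_sub_le_attErr X.mul_transpose_self hNu
  set K := max K' 1
  have hK := hK' K (le_max_left _ _)
  have hK0 : 0 < K := one_pos.trans_le (le_max_right _ _)
  rw [Metric.tendsto_atTop]
  intro η₀ hη₀
  set η := min η₀ ε
  have hη : 0 < η := lt_min hη₀ hε
  obtain ⟨T, hT⟩ := (Metric.tendsto_atTop.1 ha) (η / (2 * K)) (by positivity)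
  -- Once a is small, P cannot be at distance exactly η from X. A late trajectory that comes closer
  -- than η, as it does near a cluster point, can never cross that sphere.
  have hgap : ∀ t ≥ T, ‖p.attP (z t) - (X : Matrix (Fin 3) (Fin 3) ℝ)‖ ≤ η →
      ‖p.attP (z t) - (X : Matrix (Fin 3) (Fin 3) ℝ)‖ < η := fun t ht hle => by
    have h1 := hK (p.attP (z t)) X (p.attP_mul_transpose _) X.mul_transpose_self
      (hle.trans (min_le_right _ _)) (by simpa using hε.le)
    rw [hcrit, sub_zero] at h1
    have h2 := hT t ht
    rw [Real.dist_eq, sub_zero, abs_norm, lt_div_iff₀ (by positivity)] at h2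
    linarith
  have hnear : ∃ᶠ t in atTop, ‖p.attP (z t) - (X : Matrix (Fin 3) (Fin 3) ℝ)‖ < η := by
    have := hX.frequently (Metric.ball_mem_nhds X hη)
    refine this.mono fun t ht => ?_
    rw [SO3.dist_eq] at ht
    exact ht
  obtain ⟨t₁, ht₁, hlt⟩ := frequently_atTop.1 hnear (max T 0)
  have hcont : ContinuousOn (fun t => ‖p.attP (z t) - (X : Matrix (Fin 3) (Fin 3) ℝ)‖)
      (Set.Ici 0) :=
    ((p.continuous_attP.comp_continuousOn (hp.continuousOn_of_mem_solutions hz)).sub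
      continuousOn_const).norm
  refine ⟨t₁, fun t ht => ?_⟩
  rw [Real.dist_eq, sub_zero, abs_norm]
  by_contra hge
  have hge' : η ≤ ‖p.attP (z t) - (X : Matrix (Fin 3) (Fin 3) ℝ)‖ :=
    (min_le_left _ _).trans (not_lt.1 hge)
  obtain ⟨s, hs, hse⟩ := intermediate_value_Icc ht (hcont.mono fun x hx =>
    (le_max_right T 0).trans (ht₁.trans hx.1)) ⟨hlt.le, hge'⟩
  have := hgap s ((le_max_left T 0).trans (ht₁.trans hs.1)) hse.le
  exact absurd hse this.ne

/-- All error coordinates converge to those of a critical equilibrium. -/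
theorem tendsto_stateSq {z : ℝ → BodyState m} (hz : z ∈ p.solutions) :
    Tendsto (fun t => p.stateSq (z t)) atTop (𝓝 0) := by
  obtain ⟨X, hcrit, hX⟩ := hp.exists_tendsto_attP hz
  obtain ⟨ρ, h1, hρ⟩ := hp.exists_norm_le_of_mem_solutions hz
  obtain ⟨B, e, μ, c, K, ε, hcone⟩ := hp.exists_isLyapCone X.mul_transpose_self X.det_eq_one
    hcrit ρ
  have hc := hcone.c_pos
  have hK := hcone.K_pos
  obtain ⟨T, hT⟩ := eventually_atTop.1 (hX.eventually_le_const hcone.ε_pos)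
  have hcont : Continuous fun z : BodyState m => c * p.stateSq z :=
    continuous_const.mul ((((p.continuous_attErr.comp p.continuous_attP).norm.pow 2).add
      (p.continuous_Ωtilde.norm.pow 2)).add ((continuous_δ.sub continuous_w).norm.pow 2))
  -- Boundedness of the trajectory bounds W from below, so its sign is irrelevant and the argument
  -- works at every critical attitude.
  have h := tendsto_zero_of_hasDerivWithinAt_le
    (V := fun t => p.stateLyap (p.attGain X) B e μ (z t)) (T := max T 0)
    (b := -(K * (3 * ρ ^ 2))) (le_max_right _ _)
    (f := fun t => c * p.stateSq (z t)) (fun t ht => ?_) (fun t ht => ?_)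
    (fun t => mul_nonneg hc.le (p.stateSq_nonneg _)) (hp.uniformContinuousOn_comp hz hcont)
  · have h2 := h.const_mul c⁻¹
    rw [mul_zero] at h2
    refine h2.congr fun t => ?_
    rw [inv_mul_cancel_left₀ hc.ne']
  · have ht0 : t ∈ Set.Ici (0 : ℝ) := (le_max_right T 0).trans ht
    obtain ⟨W', hW', hle⟩ := hcone.stateLyap_deriv z hz t ht0 ((norm_Ω_le _).trans (hρ t ht0).1)
      (hT t ((le_max_left T 0).trans ht))
    exact ⟨W', hW', by linarith⟩
  · have ht0 : t ∈ Set.Ici (0 : ℝ) := (le_max_right T 0).trans ht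
    obtain ⟨-, b1, b2, b3⟩ := hρ t ht0
    have h2 := (abs_le.1 (hcone.abs_stateLyap_le (z t))).1
    have h3 : p.stateSq (z t) ≤ 3 * ρ ^ 2 := by
      unfold stateSq
      have := pow_le_pow_left₀ (norm_nonneg _) b1 2
      have := pow_le_pow_left₀ (norm_nonneg _) b2 2
      have := pow_le_pow_left₀ (norm_nonneg _) b3 2
      linarith
    have h4 := mul_le_mul_of_nonneg_left h3 hK.le
    linarith

/-- Trajectories whose attitude error converges to the identity converge to the target set. -/
theorem tendsto_infDist {z : ℝ → BodyState m} (hz : z ∈ p.solutions)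
    (hX : Tendsto (fun t => ‖p.attP (z t) - 1‖) atTop (𝓝 0)) :
    Tendsto (fun t => Metric.infDist (z t) p.targetSet) atTop (𝓝 0) := by
  obtain ⟨ρ, -, hρ⟩ := hp.exists_norm_le_of_mem_solutions hz
  obtain ⟨B, e, μ, c, K, ε, hcone⟩ := hp.exists_isLyapCone (P₀ := 1) (by simp) (by simp)
    p.attErr_one ρ
  obtain ⟨K₁, hK₁, hup⟩ := p.exists_infDist_le (m := m) ρ
  obtain ⟨K₂, hK₂, herr⟩ := p.exists_errSize_le_stateSum K
  have hsum : Tendsto (fun t => √(3 * p.stateSq (z t))) atTop (𝓝 0) := by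
    have := ((hp.tendsto_stateSq hz).const_mul 3).sqrt
    rwa [mul_zero, Real.sqrt_zero] at this
  have hlim := hsum.const_mul (K₁ * K₂)
  rw [mul_zero] at hlim
  refine squeeze_zero' (Eventually.of_forall fun t => Metric.infDist_nonneg) ?_ hlim
  filter_upwards [hX.eventually_le_const hcone.ε_pos, eventually_ge_atTop 0] with t ht ht0
  have hPa : ‖p.attP (z t) - 1‖ ≤ K * ‖p.attErr (p.attP (z t))‖ := by
    have := hcone.norm_sub_le (p.attP (z t)) 1 (p.attP_mul_transpose _) (by simp) ht
      (by simpa using hcone.ε_pos.le)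
    rwa [attErr_one, sub_zero] at this
  have h1 := hup (z t) ((TrackingData.norm_w_le _).trans (hρ t ht0).1)
  have h2 := herr _ hPa
  have h3 := Real.le_sqrt_of_sq_le (p.stateSum_sq_le (z t))
  calc _ ≤ K₁ * p.errSize (z t) := h1
    _ ≤ K₁ * (K₂ * √(3 * p.stateSq (z t))) := by
        gcongr
        exact h2.trans (by gcongr)
    _ = _ := by ring

end IsAdmissible

end TrackingData

/-! ### Porous sets, doubling of Haar measure, and fibres of the state space. -/

/-- A set with uniform holes at every scale near each of its points is negligible. -/
theorem measure_eq_zero_of_porous {α : Type*} [PseudoMetricSpace α] [MeasurableSpace α]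
    (μ : Measure α) [IsUnifLocDoublingMeasure μ] [SecondCountableTopology α] [BorelSpace α]
    [IsLocallyFiniteMeasure μ] {S : Set α} (hS : MeasurableSet S) {k C θ₀ : ℝ} (hk : 0 < k)
    (hθ₀ : 0 < θ₀)
    (h : ∀ x ∈ S, ∀ θ ∈ Set.Ioo 0 θ₀, ∃ y, dist x y ≤ C * θ ∧
      Disjoint S (Metric.closedBall y (k * θ))) : μ S = 0 := by
  have hae := IsUnifLocDoublingMeasure.ae_tendsto_measure_inter_div μ S (C / k)
  have hmem := ae_restrict_mem (μ := μ) hS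
  have hfalse : ∀ᵐ x ∂μ.restrict S, False := by
    filter_upwards [hae, hmem] with x hx hxS
    have hex : ∀ θ : ℝ, ∃ y, θ ∈ Set.Ioo 0 θ₀ → dist x y ≤ C * θ ∧
        Disjoint S (Metric.closedBall y (k * θ)) := fun θ => by
      by_cases hθ : θ ∈ Set.Ioo 0 θ₀
      · obtain ⟨y, hy⟩ := h x hxS θ hθ
        exact ⟨y, fun _ => hy⟩
      · exact ⟨x, fun h => absurd h hθ⟩
    choose y hy using hex
    have hev : ∀ᶠ θ in 𝓝[>] (0 : ℝ), θ ∈ Set.Ioo 0 θ₀ := Ioo_mem_nhdsGT hθ₀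
    have hlim : Tendsto (fun θ : ℝ => k * θ) (𝓝[>] 0) (𝓝[>] 0) := by
      refine tendsto_nhdsWithin_iff.2 ⟨?_, ?_⟩
      · have : Tendsto (fun θ : ℝ => k * θ) (𝓝 0) (𝓝 (k * 0)) := tendsto_id.const_mul k
        rw [mul_zero] at this
        exact this.mono_left nhdsWithin_le_nhds
      · filter_upwards [self_mem_nhdsWithin] with θ hθ
        exact mul_pos hk hθ
    -- The density theorem is used for balls not centred at x but within C/k radii of it; on these
    -- the density tends to 1, while in the holes it is 0.
    have ht := hx (l := 𝓝[>] (0 : ℝ)) y (fun θ => k * θ) hlim (by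
      filter_upwards [hev] with θ hθ
      rw [Metric.mem_closedBall, ← mul_assoc, div_mul_cancel₀ _ hk.ne']
      exact (hy θ hθ).1)
    have hz : Tendsto (fun θ : ℝ => μ (S ∩ Metric.closedBall (y θ) (k * θ)) /
        μ (Metric.closedBall (y θ) (k * θ))) (𝓝[>] 0) (𝓝 0) := by
      refine tendsto_const_nhds.congr' ?_
      filter_upwards [hev] with θ hθ
      rw [(hy θ hθ).2.inter_eq, measure_empty, ENNReal.zero_div]
    exact zero_ne_one (tendsto_nhds_unique hz ht)
  rw [ae_iff] at hfalse
  simpa using hfalse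

namespace SO3

theorem coe_mul (A B : SO3) : ((A * B : SO3) : Matrix (Fin 3) (Fin 3) ℝ) =
    (A : Matrix (Fin 3) (Fin 3) ℝ) * (B : Matrix (Fin 3) (Fin 3) ℝ) := rfl

theorem dist_mul_left_le (g A B : SO3) : dist (g * A) (g * B) ≤ 3 * dist A B := by
  rw [dist_eq, dist_eq, coe_mul, coe_mul, ← Matrix.mul_sub]
  have h := norm_mul_le_three (g : Matrix (Fin 3) (Fin 3) ℝ)
    ((A : Matrix (Fin 3) (Fin 3) ℝ) - (B : Matrix (Fin 3) (Fin 3) ℝ))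
  have := g.norm_le_one
  nlinarith [norm_nonneg ((A : Matrix (Fin 3) (Fin 3) ℝ) - (B : Matrix (Fin 3) (Fin 3) ℝ))]

/-- The translation taking g to x preserves Haar measure but not the entrywise distance, which it
may stretch by 3; the factor 9 is ample. -/
theorem haar_le_of_dist {S : Set SO3} {g x : SO3} {r : ℝ} (h : ∀ A ∈ S, dist A g ≤ r) :
    (Measure.haar : Measure SO3) S ≤ Measure.haar (Metric.closedBall x (9 * r)) := by
  rw [← measure_preimage_mul Measure.haar (g * x⁻¹)⁻¹⁻¹ S]
  refine measure_mono fun A hA => ?_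
  have h1 := h _ hA
  rw [Metric.mem_closedBall]
  have h2 := dist_mul_left_le (g * x⁻¹)⁻¹ ((g * x⁻¹)⁻¹⁻¹ * A) g
  rw [show (g * x⁻¹)⁻¹ * ((g * x⁻¹)⁻¹⁻¹ * A) = A by group,
    show (g * x⁻¹)⁻¹ * g = x by group] at h2
  have := dist_nonneg (x := (g * x⁻¹)⁻¹⁻¹ * A) (y := g)
  linarith

theorem exists_finset_of_bounded (N : ℤ) : ∃ F : Finset (Fin 3 → Fin 3 → ℤ),
    ∀ k : Fin 3 → Fin 3 → ℤ, (∀ i j, -N ≤ k i j ∧ k i j ≤ N) → k ∈ F :=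
  ⟨Fintype.piFinset fun _ => Fintype.piFinset fun _ => Finset.Icc (-N) N, fun _ hk =>
    Fintype.mem_piFinset.2 fun i => Fintype.mem_piFinset.2 fun j => Finset.mem_Icc.2 (hk i j)⟩

/-- The ball of radius 2ε is cut into cells on which all entries agree up to ε/9. Each cell has at
most the measure of a ball of radius ε, and the integer labels of the cells lie in [−18, 18], so
their number does not depend on x or ε. -/
instance : IsUnifLocDoublingMeasure (Measure.haar : Measure SO3) := by
  obtain ⟨F, hF⟩ := exists_finset_of_bounded 18
  refine ⟨⟨F.card, ?_⟩⟩
  filter_upwards [self_mem_nhdsWithin] with ε hε x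
  replace hε : 0 < ε := hε
  let c : SO3 → Fin 3 → Fin 3 → ℤ := fun A i j =>
    ⌊((A : Matrix (Fin 3) (Fin 3) ℝ) i j - (x : Matrix (Fin 3) (Fin 3) ℝ) i j) / (ε / 9)⌋
  have hcov : Metric.closedBall x (2 * ε) ⊆
      ⋃ k ∈ F, {A | A ∈ Metric.closedBall x (2 * ε) ∧ c A = k} := by
    intro A hA
    refine Set.mem_iUnion₂.2 ⟨c A, ?_, hA, rfl⟩
    refine hF _ fun i j => ?_
    rw [Metric.mem_closedBall, dist_eq, Matrix.norm_le_iff (by positivity)] at hA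
    have h1 := abs_le.1 (hA i j)
    rw [Matrix.sub_apply] at h1
    refine ⟨Int.le_floor.2 ?_, Int.floor_le_iff.2 ?_⟩
    · rw [le_div_iff₀ (by positivity)]
      push_cast
      linarith [h1.1]
    · rw [div_lt_iff₀ (by positivity)]
      push_cast
      linarith [h1.2]
  have hpiece : ∀ k ∈ F, (Measure.haar : Measure SO3)
      {A | A ∈ Metric.closedBall x (2 * ε) ∧ c A = k} ≤
        Measure.haar (Metric.closedBall x ε) := by
    intro k _
    by_cases hne : {A | A ∈ Metric.closedBall x (2 * ε) ∧ c A = k}.Nonempty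
    · obtain ⟨g, -, hg⟩ := hne
      rw [show ε = 9 * (ε / 9) by ring]
      refine haar_le_of_dist (g := g) fun A hA => ?_
      rw [dist_eq, Matrix.norm_le_iff (by positivity)]
      intro i j
      have h1 : c A i j = c g i j := by rw [hA.2, hg]
      have h2 := Int.abs_sub_lt_one_of_floor_eq_floor h1
      rw [← sub_div, sub_sub_sub_cancel_right, abs_div, abs_of_pos (show 0 < ε / 9 by positivity),
        div_lt_one (by positivity)] at h2
      exact h2.le
    · rw [Set.not_nonempty_iff_eq_empty.1 hne, measure_empty]
      exact zero_le
  calc (Measure.haar : Measure SO3) (Metric.closedBall x (2 * ε))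
      ≤ ∑ k ∈ F, Measure.haar {A | A ∈ Metric.closedBall x (2 * ε) ∧ c A = k} :=
        (measure_mono hcov).trans (measure_biUnion_finset_le _ _)
    _ ≤ ∑ _k ∈ F, Measure.haar (Metric.closedBall x ε) := Finset.sum_le_sum hpiece
    _ = _ := by simp

end SO3

theorem measurePreserving_prod_left_comm {α β γ : Type*} [MeasurableSpace α] [MeasurableSpace β]
    [MeasurableSpace γ] (μ : Measure α) (ν : Measure β) (l : Measure γ) [SFinite μ] [SFinite ν]
    [SFinite l] :
    MeasurePreserving (fun x : α × β × γ => (x.2.1, x.1, x.2.2)) (μ.prod (ν.prod l))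
      (ν.prod (μ.prod l)) := by
  have h1 := (measurePreserving_prodAssoc μ ν l).symm
  have h2 := (Measure.measurePreserving_swap (μ := μ) (ν := ν)).prod (MeasurePreserving.id l)
  have h3 := measurePreserving_prodAssoc ν μ l
  exact h3.comp (h2.comp h1)

namespace BodyState

variable {m : ℕ}

/-- A state assembled from the exosystem state `(R_d, w)` and the remaining coordinates. -/
def ofFibre (Q : SO3) (w : Fin m → ℝ) (x : SO3 × (Fin m → ℝ) × (Fin 3 → ℝ)) : BodyState m :=
  (x.1, Q, x.2.1, w, x.2.2)

/-- The measure on the coordinates `(R, δ, Ω)`. -/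
noncomputable def fibreMeasure (m : ℕ) : Measure (SO3 × (Fin m → ℝ) × (Fin 3 → ℝ)) :=
  (Measure.haar : Measure SO3).prod
    ((volume : Measure (Fin m → ℝ)).prod (volume : Measure (Fin 3 → ℝ)))

instance : IsUnifLocDoublingMeasure (fibreMeasure m) := by
  unfold fibreMeasure; infer_instance

instance : IsLocallyFiniteMeasure (fibreMeasure m) := by
  unfold fibreMeasure; infer_instance

/-- Fubini, after reordering the factors so that (R_d, w) comes first. -/
theorem measure_eq_zero_of_fibre {S : Set (BodyState m)} (hS : MeasurableSet S)
    (h : ∀ Q w, fibreMeasure m (ofFibre Q w ⁻¹' S) = 0) : measure m S = 0 := by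
  have e1 := (MeasurePreserving.id (Measure.haar : Measure SO3)).prod
    ((MeasurePreserving.id (Measure.haar : Measure SO3)).prod
      (measurePreserving_prod_left_comm (volume : Measure (Fin m → ℝ))
        (volume : Measure (Fin m → ℝ)) (volume : Measure (Fin 3 → ℝ))))
  have e2 := measurePreserving_prod_left_comm (Measure.haar : Measure SO3)
    (Measure.haar : Measure SO3) ((volume : Measure (Fin m → ℝ)).prod
      ((volume : Measure (Fin m → ℝ)).prod (volume : Measure (Fin 3 → ℝ))))
  have e3 := (MeasurePreserving.id (Measure.haar : Measure SO3)).prod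
    (measurePreserving_prod_left_comm (Measure.haar : Measure SO3)
      (volume : Measure (Fin m → ℝ))
      ((volume : Measure (Fin m → ℝ)).prod (volume : Measure (Fin 3 → ℝ))))
  have e := e3.comp (e2.comp e1)
  let g : SO3 × (Fin m → ℝ) × SO3 × (Fin m → ℝ) × (Fin 3 → ℝ) → BodyState m :=
    fun x => ofFibre x.1 x.2.1 x.2.2
  have hg : Measurable g := by
    unfold g ofFibre
    fun_prop
  have hgS : MeasurableSet (g ⁻¹' S) := hg hS
  have hpre : measure m S = _ := e.measure_preimage hgS.nullMeasurableSet
  refine hpre.trans ?_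
  refine Measure.measure_prod_null_of_ae_null hgS (Eventually.of_forall fun Q => ?_)
  refine Measure.measure_prod_null_of_ae_null (measurable_prodMk_left hgS)
    (Eventually.of_forall fun w => ?_)
  exact h Q w

end BodyState

/-! ### Perturbing a state in an unstable direction. -/

theorem hat_mul_hat_mul_hat (u : Fin 3 → ℝ) : hat u * hat u * hat u = -(u ⬝ᵥ u) • hat u := by
  ext i j
  fin_cases i <;> fin_cases j <;>
    simp [hat, Matrix.mul_apply, Fin.sum_univ_three, dotProduct] <;> ring

theorem rotation_mul_transpose {u : Fin 3 → ℝ} {x y : ℝ}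
    (h : 2 * y - x ^ 2 - (u ⬝ᵥ u) * y ^ 2 = 0) :
    (1 + x • hat u + y • (hat u * hat u)) * (1 + x • hat u + y • (hat u * hat u))ᵀ = 1 := by
  have h3 := hat_mul_hat_mul_hat u
  have h4 : hat u * hat u * (hat u * hat u) = -(u ⬝ᵥ u) • (hat u * hat u) := by
    rw [← Matrix.mul_assoc, h3, Matrix.smul_mul]
  have e1 : (1 + x • hat u + y • (hat u * hat u))ᵀ = 1 - x • hat u + y • (hat u * hat u) := by
    simp [Matrix.transpose_mul, hat_transpose, sub_eq_add_neg]
  have e2 : (1 + x • hat u + y • (hat u * hat u)) * (1 - x • hat u + y • (hat u * hat u)) =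
      1 + (2 * y - x ^ 2) • (hat u * hat u) + y ^ 2 • (hat u * hat u * (hat u * hat u)) := by
    simp only [Matrix.add_mul, Matrix.mul_add, Matrix.mul_sub, Matrix.smul_mul, Matrix.mul_smul,
      Matrix.one_mul, Matrix.mul_one, Matrix.mul_assoc]
    module
  rw [e1, e2, h4, smul_smul, add_assoc, ← add_smul]
  rw [show 2 * y - x ^ 2 + y ^ 2 * -(u ⬝ᵥ u) = 0 by linarith, zero_smul, add_zero]

theorem rotation_det {u : Fin 3 → ℝ} {x y : ℝ}
    (h : 2 * y - x ^ 2 - (u ⬝ᵥ u) * y ^ 2 = 0) :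
    (1 + x • hat u + y • (hat u * hat u)).det = 1 := by
  have e : (1 + x • hat u + y • (hat u * hat u)).det =
      1 - (u ⬝ᵥ u) * (2 * y - x ^ 2 - (u ⬝ᵥ u) * y ^ 2) := by
    rw [Matrix.det_fin_three]
    simp [hat, Fin.sum_univ_three, dotProduct]
    ring
  rw [e, h, mul_zero, sub_zero]

/-- Rotations about the axis `u` with small angle. -/
theorem exists_rotation (u : Fin 3 → ℝ) : ∃ C : ℝ, 0 ≤ C ∧ ∀ s ∈ Set.Ioc (0 : ℝ) 1,
    ∃ G : Matrix (Fin 3) (Fin 3) ℝ, G * Gᵀ = 1 ∧ G.det = 1 ∧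
      ‖G - 1 - (2 * s) • hat u‖ ≤ C * s ^ 2 := by
  set q := u ⬝ᵥ u with hq
  have hq0 : 0 ≤ q := (sq_nonneg _).trans (sq_norm_le_dotProduct_self u)
  refine ⟨2 * q * ‖u‖ + 6 * ‖u‖ ^ 2, by positivity, fun s hs => ?_⟩
  have hs0 := hs.1
  have hden : 0 < 1 + s ^ 2 * q := by positivity
  -- Rodrigues' formula for the angle θ with tan(θ/2) = s|u|; this makes the coefficients rational
  -- in s.
  set x := 2 * s / (1 + s ^ 2 * q) with hx
  set y := 2 * s ^ 2 / (1 + s ^ 2 * q) with hy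
  have h : 2 * y - x ^ 2 - (u ⬝ᵥ u) * y ^ 2 = 0 := by
    rw [← hq, hx, hy]
    field_simp
    ring
  refine ⟨_, rotation_mul_transpose h, rotation_det h, ?_⟩
  have e : 1 + x • hat u + y • (hat u * hat u) - 1 - (2 * s) • hat u =
      (x - 2 * s) • hat u + y • (hat u * hat u) := by module
  rw [e]
  have hy1 : |y| ≤ 2 * s ^ 2 := by
    rw [abs_of_nonneg (by positivity), hy]
    exact div_le_self (by positivity) (by linarith [mul_nonneg (sq_nonneg s) hq0])
  have hx1 : |x - 2 * s| ≤ 2 * q * s ^ 2 := by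
    have e1 : x - 2 * s = -(2 * s ^ 3 * q / (1 + s ^ 2 * q)) := by
      rw [hx]; field_simp; ring
    rw [e1, abs_neg, abs_of_nonneg (by positivity)]
    refine (div_le_self (by positivity) (by linarith [mul_nonneg (sq_nonneg s) hq0])).trans ?_
    have : s ^ 3 ≤ s ^ 2 := pow_le_pow_of_le_one hs0.le hs.2 (by norm_num)
    nlinarith
  have hH := norm_hat_le u
  have hHH : ‖hat u * hat u‖ ≤ 3 * ‖u‖ ^ 2 := by
    have := norm_mul_le_three (hat u) (hat u)
    nlinarith [norm_nonneg (hat u)]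
  calc ‖(x - 2 * s) • hat u + y • (hat u * hat u)‖
      ≤ |x - 2 * s| * ‖hat u‖ + |y| * ‖hat u * hat u‖ :=
        (norm_add_le _ _).trans (add_le_add (norm_smul_le _ _) (norm_smul_le _ _))
    _ ≤ 2 * q * s ^ 2 * ‖u‖ + 2 * s ^ 2 * (3 * ‖u‖ ^ 2) := by gcongr
    _ = _ := by ring

namespace TrackingData

variable {m ν : ℕ} (p : TrackingData m ν)

/-- The state with attitude error `P'` that agrees with `z` in all other error coordinates. -/
theorem exists_perturbed_state (ρ : ℝ) : ∃ C > 0, ∀ z : BodyState m, ‖z.toAmbient‖ ≤ ρ →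
    ∀ P' : Matrix (Fin 3) (Fin 3) ℝ, P' * P'ᵀ = 1 → P'.det = 1 → ∃ y : BodyState m,
      p.attP y = P' ∧ p.Ωtilde y = p.Ωtilde z ∧ y.δ = z.δ ∧ y.w = z.w ∧ y.Rd = z.Rd ∧
      dist y z ≤ C * ‖P' - p.attP z‖ := by
  obtain ⟨L, hL⟩ := exists_mulVec_bound p.C
  have hC := hL (max L 0) (le_max_left _ _)
  have hL0 : 0 ≤ max L 0 := le_max_right _ _
  obtain ⟨A, hA⟩ := p.exists_norm_attErr_le
  have hE := hA (max A 0) (le_max_left _ _)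
  have hA0 : 0 ≤ max A 0 := le_max_right _ _
  generalize max L 0 = L' at *
  generalize max A 0 = A' at *
  refine ⟨9 + 27 * (L' * |ρ|) + A', by positivity, fun z hz P' hP' hdet => ?_⟩
  let Q : SO3 := ⟨P', Matrix.mem_specialOrthogonalGroup_iff.2
    ⟨(Matrix.mem_orthogonalGroup_iff _ _).2 hP', hdet⟩⟩
  let R' : SO3 := z.2.1 * p.Xr⁻¹ * Q⁻¹
  have hR' : (R' : Matrix (Fin 3) (Fin 3) ℝ) =
      z.Rd * (p.Xr : Matrix (Fin 3) (Fin 3) ℝ)ᵀ * P'ᵀ := rfl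
  let y : BodyState m := (R', z.2.1, z.δ, z.w, p.Ωtilde z +
    ((R' : Matrix (Fin 3) (Fin 3) ℝ)ᵀ *ᵥ (p.C *ᵥ z.δ) + p.attErr P'))
  have hyR : y.R = z.Rd * (p.Xr : Matrix (Fin 3) (Fin 3) ℝ)ᵀ * P'ᵀ := rfl
  have hyP : p.attP y = P' := by
    have h1 : y.Rᵀ = P' * ((p.Xr : Matrix (Fin 3) (Fin 3) ℝ) * z.Rdᵀ) := by
      rw [hyR]; simp [Matrix.transpose_mul]
    rw [attP, h1, show y.Rd = z.Rd from rfl]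
    calc P' * ((p.Xr : Matrix (Fin 3) (Fin 3) ℝ) * z.Rdᵀ) * z.Rd *
          (p.Xr : Matrix (Fin 3) (Fin 3) ℝ)ᵀ = P' * ((p.Xr : Matrix (Fin 3) (Fin 3) ℝ) *
          (z.Rdᵀ * z.Rd) * (p.Xr : Matrix (Fin 3) (Fin 3) ℝ)ᵀ) := by
          simp only [Matrix.mul_assoc]
      _ = P' := by
          rw [mul_eq_one_comm.1 z.Rd_mul_transpose, Matrix.mul_one, p.Xr.mul_transpose_self,
            Matrix.mul_one]
  have hyV : p.Ωtilde y = p.Ωtilde z := by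
    rw [Ωtilde, Ωc_eq, hyP]
    change p.Ωtilde z + (y.Rᵀ *ᵥ (p.C *ᵥ z.δ) + p.attErr P') -
      (y.Rᵀ *ᵥ (p.C *ᵥ z.δ) + p.attErr P') = _
    rw [add_sub_cancel_right]
  refine ⟨y, hyP, hyV, rfl, rfl, rfl, ?_⟩
  have hRd : ‖y.R - z.R‖ ≤ 9 * ‖P' - p.attP z‖ := by
    have := p.norm_R_sub_R_le (z₁ := y) (z₂ := z) rfl
    rwa [hyP] at this
  have hδ : ‖z.δ‖ ≤ |ρ| := ((norm_fst_le (z.δ, z.w, z.Ω)).trans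
    ((norm_snd_le (z.Rd, z.δ, z.w, z.Ω)).trans (norm_snd_le z.toAmbient))).trans
      (hz.trans (le_abs_self _))
  have hΩ : ‖y.Ω - z.Ω‖ ≤ 27 * (L' * |ρ|) * ‖P' - p.attP z‖ + A' * ‖P' - p.attP z‖ := by
    have e : y.Ω - z.Ω = (y.R - z.R)ᵀ *ᵥ (p.C *ᵥ z.δ) + p.attErr (P' - p.attP z) := by
      change p.Ωtilde z + (y.Rᵀ *ᵥ (p.C *ᵥ z.δ) + p.attErr P') - z.Ω = _
      rw [Ωtilde, Ωc_eq, Δ, attErr_sub, Matrix.transpose_sub, Matrix.sub_mulVec]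
      abel
    rw [e]
    have h1 : ‖(y.R - z.R)ᵀ *ᵥ (p.C *ᵥ z.δ)‖ ≤ 3 * (9 * ‖P' - p.attP z‖) * (L' * |ρ|) :=
      norm_mulVec_le_of_le (by rw [Matrix.norm_transpose]; exact hRd)
        ((hC _).trans (by gcongr))
    refine (norm_add_le _ _).trans (add_le_add (h1.trans (le_of_eq (by ring))) (hE _))
  have n0 := norm_nonneg (P' - p.attP z)
  have n1 : 0 ≤ 27 * (L' * |ρ|) * ‖P' - p.attP z‖ := by positivity
  have n2 : 0 ≤ A' * ‖P' - p.attP z‖ := by positivity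
  have hexp : (9 + 27 * (L' * |ρ|) + A') * ‖P' - p.attP z‖ = 9 * ‖P' - p.attP z‖ +
      27 * (L' * |ρ|) * ‖P' - p.attP z‖ + A' * ‖P' - p.attP z‖ := by ring
  rw [← BodyState.isometry_toAmbient.dist_eq, dist_eq_norm, hexp]
  have hz0 : 0 ≤ 9 * ‖P' - p.attP z‖ + 27 * (L' * |ρ|) * ‖P' - p.attP z‖ +
    A' * ‖P' - p.attP z‖ := by positivity
  refine norm_prod_le_iff.2 ⟨?_, norm_prod_le_iff.2 ⟨?_, norm_prod_le_iff.2 ⟨?_,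
    norm_prod_le_iff.2 ⟨?_, ?_⟩⟩⟩⟩
  · exact hRd.trans (by linarith)
  · change ‖z.Rd - z.Rd‖ ≤ _
    rwa [sub_self, norm_zero]
  · change ‖z.δ - z.δ‖ ≤ _
    rwa [sub_self, norm_zero]
  · change ‖z.w - z.w‖ ≤ _
    rwa [sub_self, norm_zero]
  · exact hΩ.trans (by linarith)

theorem contDiff_ambP : ContDiff ℝ 1 (p.ambP : AmbientState m → _) := by
  have hR : ContDiff ℝ 1 (fun x : AmbientState m => x.1) := contDiff_fst
  have hRd : ContDiff ℝ 1 (fun x : AmbientState m => x.2.1) := contDiff_fst.comp contDiff_snd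
  exact (hR.matrix_transpose.matrix_mul hRd).matrix_mul contDiff_const

theorem contDiff_ambErr : ContDiff ℝ 1 (fun x : AmbientState m => p.attErr (p.ambP x)) := by
  unfold attErr
  exact ContDiff.const_smul _ (ContDiff.sum fun i _ =>
    contDiff_const.cross (p.contDiff_ambP.matrix_mulVec contDiff_const))

theorem contDiff_ambV : ContDiff ℝ 1 (p.ambV : AmbientState m → _) := by
  have hR : ContDiff ℝ 1 (fun x : AmbientState m => x.1) := contDiff_fst
  have hδ : ContDiff ℝ 1 (fun x : AmbientState m => x.2.2.1) :=
    contDiff_fst.comp (contDiff_snd.comp contDiff_snd)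
  have hΩ : ContDiff ℝ 1 (fun x : AmbientState m => x.2.2.2.2) :=
    contDiff_snd.comp (contDiff_snd.comp (contDiff_snd.comp contDiff_snd))
  exact hΩ.sub ((hR.matrix_transpose.matrix_mulVec (contDiff_const.matrix_mulVec hδ)).add
    p.contDiff_ambErr)

/-- The error coordinates are Lipschitz on bounded sets of states. -/
theorem exists_err_lipschitz (ρ : ℝ) : ∃ K : ℝ, 1 ≤ K ∧ ∀ y z : BodyState m,
    ‖y.toAmbient‖ ≤ ρ → ‖z.toAmbient‖ ≤ ρ →
    ‖p.attErr (p.attP y) - p.attErr (p.attP z)‖ ≤ K * dist y z ∧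
    ‖p.Ωtilde y - p.Ωtilde z‖ ≤ K * dist y z ∧
    ‖y.δ - y.w - (z.δ - z.w)‖ ≤ K * dist y z := by
  have key : ∀ f : AmbientState m → Fin 3 → ℝ, ContDiff ℝ 1 f → ∃ K : NNReal,
      LipschitzOnWith K f (Metric.closedBall 0 ρ) := fun f hf =>
    hf.contDiffOn.exists_lipschitzOnWith one_ne_zero (convex_closedBall 0 ρ)
      (isCompact_closedBall 0 ρ)
  obtain ⟨K₁, h₁⟩ := key _ p.contDiff_ambErr
  obtain ⟨K₂, h₂⟩ := key _ p.contDiff_ambV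
  have hV : ∀ z : BodyState m, p.ambV z.toAmbient = p.Ωtilde z := fun z => by
    rw [Ωtilde, Ωc_eq]; rfl
  refine ⟨K₁ + K₂ + 2, by have := K₁.2; have := K₂.2; change 1 ≤ K₁.1 + K₂.1 + 2; linarith,
    fun y z hy hz => ?_⟩
  have hy' : y.toAmbient ∈ Metric.closedBall 0 ρ := by simpa using hy
  have hz' : z.toAmbient ∈ Metric.closedBall 0 ρ := by simpa using hz
  have e1 := h₁.dist_le_mul _ hy' _ hz'
  have e2 := h₂.dist_le_mul _ hy' _ hz'
  rw [BodyState.isometry_toAmbient.dist_eq, dist_eq_norm] at e1 e2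
  rw [hV, hV] at e2
  have hD := dist_nonneg (x := y) (y := z)
  have n1 := mul_nonneg K₁.2 hD
  have n2 := mul_nonneg K₂.2 hD
  replace n1 : 0 ≤ (K₁ : ℝ) * dist y z := n1
  replace n2 : 0 ≤ (K₂ : ℝ) * dist y z := n2
  replace e1 : ‖p.attErr (p.attP y) - p.attErr (p.attP z)‖ ≤ K₁ * dist y z := e1
  have e3 : ‖y.δ - y.w - (z.δ - z.w)‖ ≤ 2 * dist y z := by
    have hd := le_of_eq (BodyState.isometry_toAmbient.dist_eq y z)
    rw [dist_eq_norm] at hd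
    obtain ⟨-, hd⟩ := norm_prod_le_iff.1 hd
    obtain ⟨-, hd⟩ := norm_prod_le_iff.1 hd
    obtain ⟨dδ, hd⟩ := norm_prod_le_iff.1 hd
    obtain ⟨dw, -⟩ := norm_prod_le_iff.1 hd
    replace dδ : ‖y.δ - z.δ‖ ≤ dist y z := dδ
    replace dw : ‖y.w - z.w‖ ≤ dist y z := dw
    rw [sub_sub_sub_comm]
    exact (norm_sub_le _ _).trans (by linarith)
  refine ⟨?_, ?_, ?_⟩ <;> linarith

variable {p}

/-- Near a critical attitude other than the identity there are rotations along which the attitude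
part of `lyap` is negative. -/
theorem IsAdmissible.exists_negative_direction (hp : p.IsAdmissible) {X : SO3}
    (hcrit : p.attErr X = 0) (hX : (X : Matrix (Fin 3) (Fin 3) ℝ) ≠ 1) :
    ∃ (b : Fin 3 → ℝ), ∃ η > 0, ∃ c > 0, ∃ ε > 0, ∃ s₀ > 0, ∃ C > 0,
      (∀ a : Fin 3 → ℝ, ‖a - b‖ ≤ 2 * η →
        -(1 / p.kp) * (a ⬝ᵥ (p.attGain X)⁻¹ *ᵥ a) ≤ -c) ∧
      ∀ P : Matrix (Fin 3) (Fin 3) ℝ, P * Pᵀ = 1 → P.det = 1 →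
        ‖P - (X : Matrix (Fin 3) (Fin 3) ℝ)‖ ≤ ε → ∀ s ∈ Set.Ioo 0 s₀,
        ∃ P' : Matrix (Fin 3) (Fin 3) ℝ, P' * P'ᵀ = 1 ∧ P'.det = 1 ∧ ‖P' - P‖ ≤ C * s ∧
          ‖p.attErr P - p.attErr P' - s • b‖ ≤ η * s := by
  obtain ⟨-, hNu, -, hpos⟩ := p.critical_attitude hp.kp_pos hp.measurement X.mul_transpose_self
    X.det_eq_one hcrit
  obtain ⟨u, τ, hu, hτ, hNτ⟩ := hpos hX
  set N := p.attGain (X : Matrix (Fin 3) (Fin 3) ℝ) with hN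
  -- Replacing P by (1 + 2s u_× + O(s²)) P lowers the attitude error by about 2s N u = s b. As N⁻¹b
  -- = 2u, the attitude part of the form at b is −4τ|u|²/k_p.
  set b := (2 * τ) • u with hb
  have hkp := hp.kp_pos
  have huu : 0 < u ⬝ᵥ u :=
    lt_of_lt_of_le (by have := norm_pos_iff.2 hu; positivity) (sq_norm_le_dotProduct_self u)
  have hNb : N⁻¹ *ᵥ b = (2 : ℝ) • u := by
    rw [hb, mul_smul, ← hNτ, ← Matrix.mulVec_smul, Matrix.mulVec_mulVec,
      Matrix.nonsing_inv_mul _ hNu, Matrix.one_mulVec]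
  have hqb : -(1 / p.kp) * (b ⬝ᵥ N⁻¹ *ᵥ b) = -(4 * τ * (u ⬝ᵥ u) / p.kp) := by
    rw [hNb, hb, smul_dotProduct, dotProduct_smul, smul_eq_mul, smul_eq_mul]
    field_simp
    ring
  set c := 2 * τ * (u ⬝ᵥ u) / p.kp with hc
  have hc0 : 0 < c := by positivity
  have hcont : Continuous fun a : Fin 3 → ℝ => -(1 / p.kp) * (a ⬝ᵥ N⁻¹ *ᵥ a) :=
    continuous_const.mul (continuous_id.dotProduct (continuous_const.matrix_mulVec continuous_id))
  obtain ⟨η', hη', hball⟩ := Metric.continuousAt_iff.1 (hcont.continuousAt (x := b)) c hc0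
  obtain ⟨A₁, h₁⟩ := p.exists_norm_attErr_le
  obtain ⟨A₂, h₂⟩ := p.exists_norm_attGain_le
  set L := max (max A₁ A₂) 1 with hL
  have hE := h₁ L ((le_max_left _ _).trans (le_max_left _ _))
  have hG := h₂ L ((le_max_right _ _).trans (le_max_left _ _))
  have hL0 : 0 < L := one_pos.trans_le (le_max_right _ _)
  obtain ⟨C, hC, hrot⟩ := exists_rotation u
  set η := η' / 4 with hη
  have hη0 : 0 < η := by positivity
  -- The radius ε controls the variation of the gain and s₀ the quadratic error of the rotation;
  -- each contributes at most (η/2)s.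
  refine ⟨b, η, hη0, c, hc0, η / (2 * (6 * L * (‖u‖ + 1))), by positivity,
    min 1 (η / (2 * (3 * L * (C + 1)))), lt_min one_pos (by positivity),
    3 * (2 * ‖u‖ + C) + 1, by positivity, fun a ha => ?_, fun P hP hdet hPX s hs => ?_⟩
  · have h := hball (x := a) (by rw [dist_eq_norm]; linarith)
    rw [hqb, Real.dist_eq] at h
    have h' := (abs_lt.1 h).2
    have e : 4 * τ * (u ⬝ᵥ u) / p.kp = 2 * c := by rw [hc]; ring
    rw [e] at h'
    linarith
  · obtain ⟨hs0, hs1⟩ := hs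
    have hs1' : s < 1 := hs1.trans_le (min_le_left _ _)
    have hs2 : s < η / (2 * (3 * L * (C + 1))) := hs1.trans_le (min_le_right _ _)
    obtain ⟨G, hGG, hGd, hGn⟩ := hrot s ⟨hs0, hs1'.le⟩
    set D := G - 1 - (2 * s) • hat u with hD
    have hPn := Matrix.norm_le_one_of_mul_transpose hP
    have hdiff : G * P - P = (2 * s) • (hat u * P) + D * P := by
      rw [hD, Matrix.sub_mul, Matrix.sub_mul, Matrix.one_mul, Matrix.smul_mul]
      abel
    have hDP : ‖D * P‖ ≤ 3 * (C * s ^ 2) := by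
      have h1 := norm_mul_le_three D P
      nlinarith [norm_nonneg D, norm_nonneg P]
    refine ⟨G * P, ?_, ?_, ?_, ?_⟩
    · rw [Matrix.transpose_mul]
      calc G * P * (Pᵀ * Gᵀ) = G * (P * Pᵀ) * Gᵀ := by simp only [Matrix.mul_assoc]
        _ = 1 := by rw [hP, Matrix.mul_one, hGG]
    · rw [Matrix.det_mul, hGd, hdet, one_mul]
    · rw [hdiff]
      refine (norm_add_le _ _).trans ?_
      have h1 : ‖hat u * P‖ ≤ 3 * ‖u‖ := by
        have h1 := norm_mul_le_three (hat u) P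
        have h2 := norm_hat_le u
        nlinarith [norm_nonneg (hat u), norm_nonneg P]
      have h2 : ‖(2 * s) • (hat u * P)‖ ≤ 2 * s * (3 * ‖u‖) := by
        rw [norm_smul, Real.norm_of_nonneg (by positivity)]
        gcongr
      have h3 : C * s ^ 2 ≤ C * s := by
        have : s ^ 2 ≤ s := by nlinarith
        gcongr
      linarith
    · have e : p.attErr P - p.attErr (G * P) - s • b =
          (2 * s) • (p.attGain (P - (X : Matrix (Fin 3) (Fin 3) ℝ)) *ᵥ u) - p.attErr (D * P) := by
        have e1 : p.attErr P - p.attErr (G * P) = -p.attErr (G * P - P) := by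
          rw [attErr_sub]; abel
        have e2 : p.attErr (G * P - P) = -((2 * s) • (p.attGain P *ᵥ u)) + p.attErr (D * P) := by
          have e3 : p.attErr (G * P - P - D * P) = -((2 * s) • (p.attGain P *ᵥ u)) := by
            rw [hdiff, add_sub_cancel_right, ← attErr_hat_mul, ← attErr_smul]
            rw [show -(hat u) * P = (-1 : ℝ) • (hat u * P) by
              rw [Matrix.neg_mul, neg_one_smul], attErr_smul, attErr_smul, attErr_smul]
            module
          rw [attErr_sub] at e3
          rw [← e3]; abel
        rw [e1, e2, attGain_sub, Matrix.sub_mulVec, hb, ← hN, hNτ]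
        module
      rw [e]
      have h1 : ‖p.attGain (P - (X : Matrix (Fin 3) (Fin 3) ℝ)) *ᵥ u‖ ≤
          3 * (L * (η / (2 * (6 * L * (‖u‖ + 1))))) * ‖u‖ :=
        norm_mulVec_le_of_le ((hG _).trans (by gcongr)) le_rfl
      have h2 : ‖p.attErr (D * P)‖ ≤ L * (3 * (C * s ^ 2)) := (hE _).trans (by gcongr)
      have h3 : 2 * s * (3 * (L * (η / (2 * (6 * L * (‖u‖ + 1))))) * ‖u‖) ≤ η / 2 * s := by
        have : 2 * s * (3 * (L * (η / (2 * (6 * L * (‖u‖ + 1))))) * ‖u‖) =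
            η / 2 * s * (‖u‖ / (‖u‖ + 1)) := by
          field_simp
          ring
        rw [this]
        refine mul_le_of_le_one_right (by positivity) ?_
        rw [div_le_one (by positivity)]
        linarith
      have h4 : L * (3 * (C * s ^ 2)) ≤ η / 2 * s := by
        rw [lt_div_iff₀ (by positivity)] at hs2
        have : L * (3 * (C * s ^ 2)) ≤ s * (3 * L * (C + 1)) * s := by
          have : 0 ≤ s * (3 * L) * s := by positivity
          linarith
        refine this.trans ?_
        gcongr
        linarith
      refine (norm_sub_le _ _).trans ?_
      rw [norm_smul, Real.norm_of_nonneg (by positivity : (0:ℝ) ≤ 2 * s)]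
      have h5 : 2 * s * ‖p.attGain (P - (X : Matrix (Fin 3) (Fin 3) ℝ)) *ᵥ u‖ ≤
        2 * s * (3 * (L * (η / (2 * (6 * L * (‖u‖ + 1))))) * ‖u‖) := by gcongr
      linarith

end TrackingData

/-! ### Trapped states are negligible; almost global attractivity. -/

namespace TrackingData

variable {m ν : ℕ} {p : TrackingData m ν}

namespace IsAdmissible

variable (hp : p.IsAdmissible)

/-- The trajectory that starts at a given state. -/
noncomputable def flow (z₀ : BodyState m) : ℝ → BodyState m :=
  (hp.exists_mem_solutions z₀).choose

theorem flow_mem (z₀ : BodyState m) : hp.flow z₀ ∈ p.solutions :=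
  (hp.exists_mem_solutions z₀).choose_spec.1

theorem flow_zero (z₀ : BodyState m) : hp.flow z₀ 0 = z₀ :=
  (hp.exists_mem_solutions z₀).choose_spec.2

theorem eq_flow {z : ℝ → BodyState m} (hz : z ∈ p.solutions) {t : ℝ} (ht : t ∈ Set.Ici (0 : ℝ)) :
    z t = hp.flow (z 0) t := by
  obtain ⟨K, -, h, -⟩ := hp.exists_flow_lipschitz ‖(z 0).toAmbient‖
  have := h z hz _ (hp.flow_mem (z 0)) le_rfl (by rw [flow_zero]) t ht
  rw [flow_zero, dist_self, zero_mul] at this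
  refine BodyState.isometry_toAmbient.injective (dist_le_zero.1 ?_)
  rwa [BodyState.isometry_toAmbient.dist_eq]

theorem continuousOn_flow (ρ : ℝ) {t : ℝ} (ht : t ∈ Set.Ici (0 : ℝ)) :
    ContinuousOn (fun z₀ => hp.flow z₀ t) {z₀ | ‖z₀.toAmbient‖ ≤ ρ} := by
  obtain ⟨K, -, h, -⟩ := hp.exists_flow_lipschitz (m := m) ρ
  have hlip : LipschitzOnWith (⟨Real.exp (K * t), (Real.exp_pos _).le⟩ : NNReal)
      (fun z₀ => hp.flow z₀ t) {z₀ | ‖z₀.toAmbient‖ ≤ ρ} :=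
    LipschitzOnWith.of_dist_le_mul fun x hx y hy => by
      have := h _ (hp.flow_mem x) _ (hp.flow_mem y) (by rwa [flow_zero]) (by rwa [flow_zero]) t ht
      rw [flow_zero, flow_zero, mul_comm] at this
      exact this
  exact hlip.continuousOn

/-- The initial states in a ball from which the error coordinates stay near those of the critical
attitude `X` after time `T`. -/
def trapped (X : SO3) (ρ T ε : ℝ) : Set (BodyState m) :=
  {z₀ | ‖z₀.toAmbient‖ ≤ ρ ∧ ∀ t, T ≤ t →
    ‖p.attP (hp.flow z₀ t) - (X : Matrix (Fin 3) (Fin 3) ℝ)‖ ≤ ε ∧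
    ‖p.Ωtilde (hp.flow z₀ t)‖ ≤ ε ∧ ‖(hp.flow z₀ t).δ - (hp.flow z₀ t).w‖ ≤ ε}

theorem isClosed_trapped (X : SO3) (ρ ε : ℝ) {T : ℝ} (hT : 0 ≤ T) :
    IsClosed (hp.trapped X ρ T ε) := by
  have hcl : IsClosed {z₀ : BodyState m | ‖z₀.toAmbient‖ ≤ ρ} :=
    (isCompact_norm_le ρ).isClosed
  have hset : IsClosed {z : BodyState m | ‖p.attP z - (X : Matrix (Fin 3) (Fin 3) ℝ)‖ ≤ ε ∧
      ‖p.Ωtilde z‖ ≤ ε ∧ ‖z.δ - z.w‖ ≤ ε} :=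
    (isClosed_le (p.continuous_attP.sub continuous_const).norm continuous_const).inter
      ((isClosed_le p.continuous_Ωtilde.norm continuous_const).inter
        (isClosed_le (continuous_δ.sub continuous_w).norm continuous_const))
  have heq : hp.trapped X ρ T ε = {z₀ : BodyState m | ‖z₀.toAmbient‖ ≤ ρ} ∩
      ⋂ t : Set.Ici T, ({z₀ : BodyState m | ‖z₀.toAmbient‖ ≤ ρ} ∩ (fun z₀ => hp.flow z₀ t) ⁻¹'
        {z : BodyState m | ‖p.attP z - (X : Matrix (Fin 3) (Fin 3) ℝ)‖ ≤ ε ∧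
          ‖p.Ωtilde z‖ ≤ ε ∧ ‖z.δ - z.w‖ ≤ ε}) := by
    ext z₀
    simp only [trapped, Set.mem_inter_iff, Set.mem_iInter, Set.mem_preimage, Set.mem_ofPred_eq,
      Subtype.forall, Set.mem_Ici]
    exact ⟨fun h => ⟨h.1, fun t ht => ⟨h.1, h.2 t ht⟩⟩, fun h => ⟨h.1, fun t ht => (h.2 t ht).2⟩⟩
  rw [heq]
  exact hcl.inter (isClosed_iInter fun t =>
    (hp.continuousOn_flow ρ (hT.trans t.2)).preimage_isClosed_of_isClosed hcl hset)

/-- Two trapped trajectories with the same exosystem state are never in the negative cone. -/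
theorem pairLyap_nonneg {X : SO3} {ρ ρ' T ε : ℝ} (hT : 0 ≤ T)
    (hρ' : ∀ z ∈ p.solutions, ‖(z 0).toAmbient‖ ≤ ρ → ∀ t ∈ Set.Ici (0 : ℝ),
      ‖(z t).toAmbient‖ ≤ ρ' ∧ ‖p.Ωtilde (z t)‖ ≤ ρ' ∧ ‖(z t).δ - (z t).w‖ ≤ ρ' ∧
        ‖p.attErr (p.attP (z t))‖ ≤ ρ')
    {B : Matrix (Fin m) (Fin m) ℝ} {e μ c K ε₀ : ℝ}
    (hcone : p.IsLyapCone (X : Matrix (Fin 3) (Fin 3) ℝ) ρ' B e μ c K ε₀) (hε : ε ≤ ε₀)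
    {z₁ z₂ : BodyState m} (h1 : z₁ ∈ hp.trapped X ρ T ε) (h2 : z₂ ∈ hp.trapped X ρ T ε)
    (hRd : z₁.Rd = z₂.Rd) (hw : z₁.w = z₂.w) :
    0 ≤ p.pairLyap (p.attGain X) B e μ (hp.flow z₁ T) (hp.flow z₂ T) := by
  -- If W is negative at T, then W' ≤ (c/K) W drives it to −∞ exponentially, whereas boundedness of
  -- both trajectories keeps it above −12Kρ'².
  by_contra hneg
  rw [not_le] at hneg
  have hc := hcone.c_pos
  have hK := hcone.K_pos
  have hb1 := hρ' _ (hp.flow_mem z₁) (by rw [flow_zero]; exact h1.1)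
  have hb2 := hρ' _ (hp.flow_mem z₂) (by rw [flow_zero]; exact h2.1)
  have hder : ∀ t, t ∈ Set.Ici T → ∃ W' : ℝ, HasDerivWithinAt
      (fun s => p.pairLyap (p.attGain X) B e μ (hp.flow z₁ s) (hp.flow z₂ s)) W' (Set.Ici 0) t ∧
      W' ≤ -c * p.pairSq (hp.flow z₁ t) (hp.flow z₂ t) := fun t ht => by
    have ht0 : t ∈ Set.Ici (0 : ℝ) := hT.trans ht
    obtain ⟨a1, -, -⟩ := h1.2 t ht
    obtain ⟨a2, b2, c2⟩ := h2.2 t ht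
    refine hcone.pairLyap_deriv _ (hp.flow_mem z₁) _ (hp.flow_mem z₂) t ht0
      ((norm_Ω_le _).trans (hb1 t ht0).1) (a1.trans hε) (a2.trans hε) ?_ (b2.trans hε)
      (c2.trans hε)
    exact (hp.exosystem_eq (hp.flow_mem z₁) (hp.flow_mem z₂) (T := 0) Set.self_mem_Ici
      (by rwa [flow_zero, flow_zero]) (by rwa [flow_zero, flow_zero]) ht0).1
  choose! W' hW' hle using hder
  have habs := fun t => abs_le.1 (hcone.abs_pairLyap_le (hp.flow z₁ t) (hp.flow z₂ t))
  have hgrow : ∀ t, T ≤ t → p.pairLyap (p.attGain X) B e μ (hp.flow z₁ t) (hp.flow z₂ t) ≤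
      p.pairLyap (p.attGain X) B e μ (hp.flow z₁ T) (hp.flow z₂ T) *
        Real.exp (-(-(c / K)) * (t - T)) := fun t ht =>
    le_mul_exp_of_hasDerivWithinAt_le (f := fun s => p.pairLyap (p.attGain X) B e μ (hp.flow z₁ s)
      (hp.flow z₂ s)) hT hW' (fun t ht => by
        refine (hle t ht).trans ?_
        have h3 := mul_le_mul_of_nonneg_left (habs t).1 (div_pos hc hK).le
        have h4 : c / K * -(K * p.pairSq (hp.flow z₁ t) (hp.flow z₂ t)) =
            -c * p.pairSq (hp.flow z₁ t) (hp.flow z₂ t) := by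
          field_simp
        rw [h4] at h3
        rw [neg_neg]
        exact h3) ht
  have hbound : ∀ t, T ≤ t → -(K * (12 * ρ' ^ 2)) ≤
      p.pairLyap (p.attGain X) B e μ (hp.flow z₁ t) (hp.flow z₂ t) := fun t ht => by
    obtain ⟨-, a1, a2, a3⟩ := hb1 t (hT.trans ht)
    obtain ⟨-, b1, b2, b3⟩ := hb2 t (hT.trans ht)
    have hsq : p.pairSq (hp.flow z₁ t) (hp.flow z₂ t) ≤ 12 * ρ' ^ 2 := by
      have q1 := pow_le_pow_left₀ (norm_nonneg _) ((norm_sub_le _ _).trans (add_le_add a1 b1)) 2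
      have q2 := pow_le_pow_left₀ (norm_nonneg _) ((norm_sub_le _ _).trans (add_le_add a2 b2)) 2
      have q3 := pow_le_pow_left₀ (norm_nonneg _) ((norm_sub_le _ _).trans (add_le_add a3 b3)) 2
      unfold pairSq
      linarith
    have := mul_le_mul_of_nonneg_left hsq hK.le
    linarith [(habs t).1]
  set w₀ := -p.pairLyap (p.attGain X) B e μ (hp.flow z₁ T) (hp.flow z₂ T) with hw₀
  have hw₀pos : 0 < w₀ := by rw [hw₀]; linarith
  set M := K * (12 * ρ' ^ 2) with hM
  have hM0 : 0 ≤ M := by positivity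
  have hs : 0 ≤ M / w₀ / (c / K) := by positivity
  -- At this time −W ≥ w₀ exp(M/w₀) ≥ w₀ + M, which exceeds the bound M.
  have h3 := hgrow (T + M / w₀ / (c / K)) (by linarith)
  have h4 := hbound (T + M / w₀ / (c / K)) (by linarith)
  rw [add_sub_cancel_left, neg_neg, mul_div_cancel₀ _ (div_pos hc hK).ne'] at h3
  have h5 := Real.add_one_le_exp (M / w₀)
  have h6 := mul_le_mul_of_nonneg_left h5 hw₀pos.le
  rw [mul_add, mul_div_cancel₀ _ hw₀pos.ne'] at h6
  have h7 : p.pairLyap (p.attGain X) B e μ (hp.flow z₁ T) (hp.flow z₂ T) * Real.exp (M / w₀) =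
      -(w₀ * Real.exp (M / w₀)) := by rw [hw₀]; ring
  linarith

end IsAdmissible

end TrackingData

namespace BodyState

variable {m : ℕ}

theorem dist_ofFibre (Q : SO3) (w : Fin m → ℝ) (x y : SO3 × (Fin m → ℝ) × (Fin 3 → ℝ)) :
    dist (ofFibre Q w x) (ofFibre Q w y) = dist x y := by
  simp only [Prod.dist_eq, ofFibre, dist_self]
  have h1 := dist_nonneg (x := x.2.1) (y := y.2.1)
  have h2 := dist_nonneg (x := x.2.2) (y := y.2.2)
  rw [max_eq_right h2, max_eq_right (le_max_of_le_left h1)]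

theorem continuous_ofFibre (Q : SO3) (w : Fin m → ℝ) : Continuous (ofFibre Q w) := by
  unfold ofFibre
  fun_prop

end BodyState

namespace TrackingData

variable {m ν : ℕ} {p : TrackingData m ν}

theorem quadratic_form_smul (N : Matrix (Fin 3) (Fin 3) ℝ) {s : ℝ} (hs : 0 < s) (k : ℝ)
    (a : Fin 3 → ℝ) : k * (a ⬝ᵥ N *ᵥ a) = s ^ 2 * (k * ((s⁻¹ • a) ⬝ᵥ N *ᵥ (s⁻¹ • a))) := by
  rw [Matrix.mulVec_smul, smul_dotProduct, dotProduct_smul, smul_eq_mul, smul_eq_mul]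
  field_simp

/-- A state whose error coordinates differ from those of another one essentially in a negative
direction lies in the negative cone. -/
theorem IsLyapCone.pairLyap_neg {P₀ : Matrix (Fin 3) (Fin 3) ℝ} {ρ : ℝ}
    {B : Matrix (Fin m) (Fin m) ℝ} {e μ c K ε : ℝ} (h : p.IsLyapCone P₀ ρ B e μ c K ε)
    {b : Fin 3 → ℝ} {η c' : ℝ} (hc' : 0 < c') (hneg : ∀ a : Fin 3 → ℝ, ‖a - b‖ ≤ 2 * η →
      -(1 / p.kp) * (a ⬝ᵥ (p.attGain P₀)⁻¹ *ᵥ a) ≤ -c') {s t : ℝ} (hs : 0 < s)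
    (ht : 4 * K * t ^ 2 ≤ c') {z y : BodyState m}
    (ha : ‖p.attErr (p.attP z) - p.attErr (p.attP y) - s • b‖ ≤ 2 * η * s)
    (hv : ‖p.Ωtilde z - p.Ωtilde y‖ ≤ t * s) (hd : ‖z.δ - z.w - (y.δ - y.w)‖ ≤ t * s) :
    p.pairLyap (p.attGain P₀) B e μ z y < 0 := by
  have hK := h.K_pos
  set a := p.attErr (p.attP z) - p.attErr (p.attP y)
  have h1 := h.lyap_le z.R (SO3.norm_le_one z.1) a (p.Ωtilde z - p.Ωtilde y)
    (z.δ - z.w - (y.δ - y.w))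
  have h2 : ‖s⁻¹ • a - b‖ ≤ 2 * η := by
    have e1 : s⁻¹ • a - b = s⁻¹ • (a - s • b) := by
      rw [smul_sub _ a (s • b), smul_smul, inv_mul_cancel₀ hs.ne', one_smul]
    rw [e1, norm_smul, Real.norm_of_nonneg (by positivity), inv_mul_le_iff₀ hs]
    linarith
  have h3 := mul_le_mul_of_nonneg_left (hneg _ h2) (sq_nonneg s)
  rw [← quadratic_form_smul _ hs] at h3
  have h4 : K * (‖p.Ωtilde z - p.Ωtilde y‖ ^ 2 + ‖z.δ - z.w - (y.δ - y.w)‖ ^ 2) ≤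
      K * ((t * s) ^ 2 + (t * s) ^ 2) := by gcongr
  have h5 : K * ((t * s) ^ 2 + (t * s) ^ 2) = 4 * K * t ^ 2 * (s ^ 2 / 2) := by ring
  have h6 : 4 * K * t ^ 2 * (s ^ 2 / 2) ≤ c' * (s ^ 2 / 2) := by gcongr
  have h7 : 0 < c' * (s ^ 2 / 2) := by positivity
  unfold pairLyap
  linarith

namespace IsAdmissible

variable (hp : p.IsAdmissible)

/-- Fix (R_d, w) and a trapped z. At time T, push its image by s in the unstable direction to a
state y: the difference lies in the negative cone with a margin proportional to s, so a ball of
radius proportional to s about y contains no image of a trapped state with the same exosystem. The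
flow over [0, T] is Lipschitz in both directions, so holes of proportional size appear at time 0 and
the fibre of the trapped set is porous. -/
theorem exists_measure_trapped_eq_zero {X : SO3} (hcrit : p.attErr X = 0)
    (hX : (X : Matrix (Fin 3) (Fin 3) ℝ) ≠ 1) (ρ : ℝ) :
    ∃ ε > 0, ∀ T : ℝ, 0 ≤ T → BodyState.measure m (hp.trapped X ρ T ε) = 0 := by
  obtain ⟨ρ', -, hb⟩ := hp.exists_bound (m := m) (ρ + 1)
  have hρ' : ∀ z ∈ p.solutions, ‖(z 0).toAmbient‖ ≤ ρ + 1 → ∀ t ∈ Set.Ici (0 : ℝ),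
      ‖(z t).toAmbient‖ ≤ ρ' ∧ ‖p.Ωtilde (z t)‖ ≤ ρ' ∧ ‖(z t).δ - (z t).w‖ ≤ ρ' ∧
        ‖p.attErr (p.attP (z t))‖ ≤ ρ' := fun z hz h0 =>
    hb _ z (fun _ => zero_le_one) ((p.mem_solutions_iff hp.J_inv_mul z).1 hz) h0
  obtain ⟨Kf, -, hflow, hback⟩ := hp.exists_flow_lipschitz (m := m) (ρ + 1)
  obtain ⟨B, e, μ, c, K, ε₀, hcone⟩ := hp.exists_isLyapCone X.mul_transpose_self X.det_eq_one
    hcrit ρ'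
  obtain ⟨b, η, hη, c', hc', ε₁, hε₁, s₀, hs₀, C₁, hC₁, hneg, hrot⟩ :=
    hp.exists_negative_direction hcrit hX
  obtain ⟨C₂, hC₂, hpert⟩ := p.exists_perturbed_state (m := m) ρ'
  obtain ⟨Lp, hLp, hlip⟩ := p.exists_err_lipschitz (m := m) ρ'
  have hK := hcone.K_pos
  -- The bound τ ≤ η keeps the attitude difference within 2ηs of s b, and 4Kτ² ≤ c' lets the v and d
  -- parts spend at most half of the negative amount c's².
  set τ := min η (min 1 (c' / (4 * K))) with hτ
  have hτ0 : 0 < τ := lt_min hη (lt_min one_pos (by positivity))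
  have hτη : τ ≤ η := min_le_left _ _
  have hτ4 : 4 * K * τ ^ 2 ≤ c' := by
    have h1 : τ ≤ 1 := (min_le_right _ _).trans (min_le_left _ _)
    have h2 : τ ≤ c' / (4 * K) := (min_le_right _ _).trans (min_le_right _ _)
    rw [le_div_iff₀ (by positivity)] at h2
    have h3 : τ ^ 2 ≤ τ := by nlinarith
    have h4 : 4 * K * τ ^ 2 ≤ 4 * K * τ := by gcongr
    linarith
  have hLp0 : 0 < Lp := one_pos.trans_le hLp
  refine ⟨min ε₀ ε₁, lt_min hcone.ε_pos hε₁, fun T hT => ?_⟩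
  set E := Real.exp (Kf * T) with hE
  have hE0 : 0 < E := Real.exp_pos _
  have hclosed := hp.isClosed_trapped X ρ (min ε₀ ε₁) hT
  refine BodyState.measure_eq_zero_of_fibre hclosed.measurableSet fun Q w => ?_
  refine measure_eq_zero_of_porous (BodyState.fibreMeasure m) (k := τ / Lp / E)
    (C := C₂ * C₁ * E) (θ₀ := min s₀ (1 / (C₂ * C₁ * E)))
    (hclosed.preimage (BodyState.continuous_ofFibre Q w)).measurableSet (by positivity)
    (lt_min hs₀ (by positivity)) fun x hx s hs => ?_
  obtain ⟨hs0, hs1⟩ := hs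
  have hss : s < s₀ := hs1.trans_le (min_le_left _ _)
  have hsC : C₂ * C₁ * E * s ≤ 1 := by
    have := hs1.trans_le (min_le_right _ _)
    rw [lt_div_iff₀ (by positivity)] at this
    linarith
  set z := BodyState.ofFibre Q w x with hz
  replace hx : z ∈ hp.trapped X ρ T (min ε₀ ε₁) := hx
  have hzmem := hp.flow_mem z
  have hz0 : ‖(hp.flow z 0).toAmbient‖ ≤ ρ + 1 := by
    rw [flow_zero]; linarith [hx.1]
  have hzT := (hρ' _ hzmem hz0 T hT).1
  obtain ⟨P', hP', hPd, hPn, hPa⟩ := hrot (p.attP (hp.flow z T)) (p.attP_mul_transpose _)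
    (p.det_attP _) ((hx.2 T le_rfl).1.trans (min_le_right _ _)) s ⟨hs0, hss⟩
  obtain ⟨y, hyP, hyV, hyδ, hyw, hyRd, hyd⟩ := hpert (hp.flow z T) hzT P' hP' hPd
  have hyd' : dist y (hp.flow z T) * E ≤ C₂ * C₁ * E * s := by
    calc dist y (hp.flow z T) * E ≤ C₂ * (C₁ * s) * E := by
          gcongr
          exact hyd.trans (by gcongr)
      _ = _ := by ring
  obtain ⟨z₂, hz₂, hz₂T, hz₂d⟩ := hback _ hzmem hz0 T hT y (hyd'.trans hsC)
  -- The perturbation left R_d and w untouched at time T, so the past of y starts in the same fibre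
  -- as z.
  have hexo := hp.exosystem_eq hz₂ hzmem hT (by rw [hz₂T, hyRd]) (by rw [hz₂T, hyw])
    (t := 0) Set.self_mem_Ici
  rw [flow_zero] at hexo hz₂d
  have hof : BodyState.ofFibre Q w ((z₂ 0).1, (z₂ 0).2.2.1, (z₂ 0).2.2.2.2) = z₂ 0 := by
    have h1 : (z₂ 0).2.1 = Q := Subtype.ext hexo.1
    have h2 : (z₂ 0).2.2.2.1 = w := hexo.2
    rw [← h1, ← h2]
    rfl
  have hz₂n : ‖(z₂ 0).toAmbient‖ ≤ ρ + 1 := by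
    have h1 := norm_le_norm_add_norm_sub' (z₂ 0).toAmbient z.toAmbient
    rw [← dist_eq_norm, BodyState.isometry_toAmbient.dist_eq] at h1
    have h2 := hx.1
    linarith
  refine ⟨((z₂ 0).1, (z₂ 0).2.2.1, (z₂ 0).2.2.2.2), ?_, ?_⟩
  · rw [← BodyState.dist_ofFibre Q w, hof, dist_comm]
    exact hz₂d.trans hyd'
  · refine Set.disjoint_left.2 fun x₃ hx₃ hball => ?_
    rw [Metric.mem_closedBall, ← BodyState.dist_ofFibre Q w, hof] at hball
    set z₃ := BodyState.ofFibre Q w x₃ with hz₃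
    replace hx₃ : z₃ ∈ hp.trapped X ρ T (min ε₀ ε₁) := hx₃
    have hz₃n : ‖(hp.flow z₃ 0).toAmbient‖ ≤ ρ + 1 := by
      rw [flow_zero]; linarith [hx₃.1]
    have hdist := hflow _ (hp.flow_mem z₃) _ hz₂ hz₃n hz₂n T hT
    rw [flow_zero, hz₂T] at hdist
    have hdist' : dist (hp.flow z₃ T) y ≤ τ / Lp * s := by
      refine hdist.trans ?_
      calc dist z₃ (z₂ 0) * Real.exp (Kf * T) ≤ τ / Lp / E * s * E := by gcongr
        _ = _ := by field_simp
    have hLd : Lp * dist (hp.flow z₃ T) y ≤ τ * s := by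
      calc Lp * dist (hp.flow z₃ T) y ≤ Lp * (τ / Lp * s) := by gcongr
        _ = _ := by field_simp
    have hyn : ‖y.toAmbient‖ ≤ ρ' := by
      rw [← hz₂T]; exact (hρ' _ hz₂ hz₂n T hT).1
    obtain ⟨l1, l2, l3⟩ := hlip (hp.flow z₃ T) y (hρ' _ (hp.flow_mem z₃) hz₃n T hT).1 hyn
    have hnonneg := hp.pairLyap_nonneg hT (fun z hz h0 => hρ' z hz (h0.trans (by linarith)))
      hcone (min_le_left _ _) hx hx₃ rfl rfl
    refine absurd hnonneg (not_le.2 (hcone.pairLyap_neg hc' hneg hs0 hτ4 ?_ ?_ ?_))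
    · have e1 : p.attErr (p.attP (hp.flow z T)) - p.attErr (p.attP (hp.flow z₃ T)) - s • b =
          (p.attErr (p.attP (hp.flow z T)) - p.attErr P' - s • b) -
          (p.attErr (p.attP (hp.flow z₃ T)) - p.attErr (p.attP y)) := by
        rw [hyP]; abel
      rw [e1]
      refine (norm_sub_le _ _).trans ?_
      have : τ * s ≤ η * s := by gcongr
      linarith
    · rw [← hyV, norm_sub_rev]
      exact l2.trans hLd
    · rw [← hyδ, ← hyw, norm_sub_rev]
      exact l3.trans hLd

/-- Critical attitudes are isolated, because `attErr` is injective near each of them, and they form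
a closed subset of a compact group. -/
theorem finite_critical (hp : p.IsAdmissible) : {X : SO3 | p.attErr X = 0}.Finite := by
  have hc : Continuous fun X : SO3 => p.attErr (X : Matrix (Fin 3) (Fin 3) ℝ) :=
    p.continuous_attErr.comp continuous_subtype_val
  refine (isClosed_eq hc continuous_const).isCompact.finite ⟨?_⟩
  rw [discreteTopology_subtype_iff]
  intro X hX
  obtain ⟨-, hNu, -⟩ := p.critical_attitude hp.kp_pos hp.measurement X.mul_transpose_self
    X.det_eq_one hX
  obtain ⟨ε, hε, K, hK⟩ := p.exists_norm_sub_le_attErr X.mul_transpose_self hNu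
  rw [← disjoint_iff, Filter.disjoint_principal_right, mem_nhdsWithin]
  refine ⟨Metric.ball X ε, Metric.isOpen_ball, Metric.mem_ball_self hε, fun Y hY hYc => ?_⟩
  have h1 : ‖(Y : Matrix (Fin 3) (Fin 3) ℝ) - (X : Matrix (Fin 3) (Fin 3) ℝ)‖ ≤ ε := by
    rw [← SO3.dist_eq]; exact (Metric.mem_ball.1 hY.1).le
  have h2 := hK K le_rfl Y X Y.mul_transpose_self X.mul_transpose_self h1 (by simpa using hε.le)
  rw [show p.attErr (Y : Matrix (Fin 3) (Fin 3) ℝ) = 0 from hYc,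
    show p.attErr (X : Matrix (Fin 3) (Fin 3) ℝ) = 0 from hX, sub_zero, norm_zero, mul_zero] at h2
  exact hY.2 (Subtype.ext (sub_eq_zero.1 (norm_le_zero_iff.1 h2)))

/-- A trajectory that converges to a critical attitude other than I starts in a trapped set with
natural-number radius and time. These are countably many null sets; all other trajectories converge
to the target set. -/
theorem almostGloballyAttractive (hp : p.IsAdmissible) :
    AlmostGloballyAttractive (BodyState.measure m) p.solutions p.targetSet := by
  have hex : ∀ (X : SO3) (ρ : ℕ), ∃ ε > 0, p.attErr X = 0 →
      (X : Matrix (Fin 3) (Fin 3) ℝ) ≠ 1 → ∀ T : ℝ, 0 ≤ T →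
      BodyState.measure m (hp.trapped X ρ T ε) = 0 := fun X ρ => by
    by_cases h : p.attErr X = 0 ∧ (X : Matrix (Fin 3) (Fin 3) ℝ) ≠ 1
    · obtain ⟨ε, hε, hT⟩ := hp.exists_measure_trapped_eq_zero h.1 h.2 ρ
      exact ⟨ε, hε, fun _ _ => hT⟩
    · exact ⟨1, one_pos, fun h1 h2 => absurd ⟨h1, h2⟩ h⟩
  choose ε hε hnull using hex
  have hae : ∀ᵐ z₀ ∂(BodyState.measure m), ∀ X ∈ {X : SO3 | p.attErr X = 0}, ∀ ρ n : ℕ,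
      (X : Matrix (Fin 3) (Fin 3) ℝ) ≠ 1 → z₀ ∉ hp.trapped X ρ n (ε X ρ) := by
    refine (ae_ball_iff hp.finite_critical.countable).2 fun X hX => ?_
    refine ae_all_iff.2 fun ρ => ae_all_iff.2 fun n => ?_
    by_cases hX1 : (X : Matrix (Fin 3) (Fin 3) ℝ) = 1
    · exact Eventually.of_forall fun z h => absurd hX1 h
    · filter_upwards [measure_eq_zero_iff_ae_notMem.1 (hnull X ρ hX hX1 n n.cast_nonneg)]
        with z hz _ using hz
  refine hae.mono fun z₀ hz₀ z hz hz0 => ?_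
  obtain ⟨X, hcrit, hXlim⟩ := hp.exists_tendsto_attP hz
  by_cases hX : (X : Matrix (Fin 3) (Fin 3) ℝ) = 1
  · rw [hX] at hXlim
    exact hp.tendsto_infDist hz hXlim
  · exfalso
    obtain ⟨ρ, hρ⟩ := exists_nat_ge ‖z₀.toAmbient‖
    have hsq := (hp.tendsto_stateSq hz).eventually_le_const (pow_pos (hε X ρ) 2)
    obtain ⟨T, hT⟩ := eventually_atTop.1 (hsq.and (hXlim.eventually_le_const (hε X ρ)))
    obtain ⟨n, hn⟩ := exists_nat_ge T
    refine hz₀ X hcrit ρ n hX ⟨hρ, fun t ht => ?_⟩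
    have ht0 : t ∈ Set.Ici (0 : ℝ) := n.cast_nonneg.trans ht
    obtain ⟨h1, h2⟩ := hT t (hn.trans ht)
    rw [← hz0, ← hp.eq_flow hz ht0]
    unfold stateSq at h1
    have n1 := sq_nonneg ‖p.attErr (p.attP (z t))‖
    have n2 := sq_nonneg ‖p.Ωtilde (z t)‖
    have n3 := sq_nonneg ‖(z t).δ - (z t).w‖
    exact ⟨h2, abs_le_of_sq_le_sq' (by linarith) (hε X ρ).le |>.2,
      abs_le_of_sq_le_sq' (by linarith) (hε X ρ).le |>.2⟩

end IsAdmissible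

end TrackingData

end Proof

theorem proposition2 {m ν : ℕ} (hm : 3 ≤ m) (p : TrackingData m ν)
    (hJ : p.J.PosDef) (hS : p.Sᵀ = -p.S) (hobs : p.Observable)
    (hkp : 0 < p.kp) (hkI : 0 < p.kI) (hkD : 0 < p.kD)
    (hY : p.MeasurementAssumption) :
    (∀ z₀ : BodyState m, ∃ z ∈ p.solutions, z 0 = z₀) ∧
    ((∀ ρ : ℝ, LyapunovStableOn p.solutions p.targetSet {z | ‖z.w‖ ≤ ρ}) ∧
      AlmostGloballyAttractive (BodyState.measure m) p.solutions p.targetSet) ∧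
    (∀ ρ : ℝ, LocallyExponentiallyStableOn p.solutions p.targetSet {z | ‖z.w‖ ≤ ρ}) := by
  have hp : p.IsAdmissible := ⟨hJ, hS, hobs, hkp, hkI, hkD, hY⟩
  exact ⟨hp.exists_mem_solutions, ⟨fun ρ => (hp.locallyExponentiallyStableOn ρ).lyapunovStableOn,
    hp.almostGloballyAttractive⟩, hp.locallyExponentiallyStableOn⟩
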